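/- Let $k$ be an algebraically closed field (of any characteristic), $G$ a finite group scheme over $k$, $\omega$ a normalized $3$-cocycle on $G$ with values in $\mathbb G_m$, and $H,K\subset G$ closed subgroup schemes with normalized $2$-cochains $\psi\in C^2(H,\mathbb G_m)$, $\eta\in C^2(K,\mathbb G_m)$ such that $d\psi=\omega|_H$ and $d\eta=\omega|_K$. Here $\omega(x,y,zw)\,\omega(xy,z,w)=\omega(y,z,w)\,\omega(x,yz,w)\,\omega(x,y,z)$ and $d\psi(x,y,z)=\psi(x,yz)\psi(y,z)\psi(xy,z)^{-1}\psi(x,y)^{-1}$; all formulas are for points with values in arbitrary commutative $k$-algebras. Let $\mathscr M=\mathrm{Coh}^{((H,\psi),(K,\eta))}(G,\omega)$ be the category of biequivariant sheaves: finite dimensional $\mathcal O(G)$-modules $S$ with isomorphisms $S_x\cong S_{bx}$ ($b\in H$) and $S_x\cong S_{xc}$ ($c\in K$), whose inverses $\lambda_b:S_{bx}\to S_x$ and $\rho_c:S_{xc}\to S_x$ (equivalently, counital coactions $\lambda:S\to\mathcal O(H)\otimes S$, $\rho:S\to S\otimes\mathcal O(K)$, semilinear over $f\mapsto f(bx)$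 and $f\mapsto f(xc)$) satisfy, as maps to the fibre at $x$, $$\lambda_{bc}=\omega(b,c,x)\,\psi(b,c)\,\lambda_c\lambda_b,\qquad \rho_{cd}=\omega(x,c,d)^{-1}\,\eta(c,d)\,\rho_c\rho_d,\qquad \lambda_b\rho_c=\omega(b,x,c)\,\rho_c\lambda_b .$$ Morphisms are the $\mathcal O(G)$-linear maps that commute with $\lambda$ and $\rho$. An $(H,K)$-double coset is a closed subscheme $Z=HgK\subset G$ with $g\in G(k)$, i.e. the orbit of $g$ under $(h,c)\mapsto h^{-1}gc$, with defining ideal $\mathscr I(Z)=\ker(\mathcal O(G)\to\mathcal O(H\times K),\ f\mapsto f(h^{-1}gc))$. Let $\mathscr M_Z\subset\mathscr M$ be the full subcategory of objects annihilated by $\mathscr I(Z)$ and $\overline{\mathscr M_Z}$ its Serre closure, the full subcategory of objects all of whose composition factors lie in $\mathscr M_Z$. For $g\in Z(k)$ let $L^g=H\cap gKg^{-1}$, write $l'=g^{-1}lg\in K$ for $l\in L^g$, and put $$\xi_g(l,m)=\frac{\psi(l,m)}{\eta(l',m')}\cdot\frac{\omega(g,l',m')\,\omega(l,m,g)}{\omega(l,g,m')}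 .$$ Let $\mathrm{Rep}(L^g,\xi_g^{-1})$ be the category of finite dimensional left comodules over $\mathcal O(L^g)$ with the comultiplication $f\mapsto\Delta(f)\xi_g^{-1}$; equivalently, finite dimensional spaces $V$ with operators $T_l$ such that $T_1=\mathrm{id}$ and $T_mT_l=\xi_g(l,m)^{-1}T_{lm}$. **Theorem.** 1. For every double coset $Z$ and every $g\in Z(k)$ there is a $k$-linear equivalence $\mathbf{Ind}_Z:\mathrm{Rep}(L^g,\xi_g^{-1})\to\mathscr M_Z$, given as follows. $\mathbf{Ind}_Z(V)$ is the space of all functions $F\in\mathcal O(H\times K)\otimes V$ such that $T_lF(lh,l'c)=\Theta_g(l,(h,c))^{-1}F(h,c)$ for $l\in L^g$, where $$\Theta_g(l,(h,c))=\frac{\psi(l,h)}{\eta(l',c)}\cdot\frac{\omega(g,l',c)\,\omega(l,h,h^{-1}gc)}{\omega(l,g,c)},$$ with $(fF)(h,c)=f(h^{-1}gc)F(h,c)$ for $f\in\mathcal O(G)$, $$(\lambda_bF)(h,c)=\frac{F(hb^{-1},c)}{\omega(hb^{-1},b,h^{-1}gc)\,\psi(hb^{-1},b)},\qquad (\rho_dF)(h,c)=\frac{\omega(g,c,d)}{\omega(h,h^{-1}gc,d)\,\eta(c,d)}F(h,cd),$$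 and a morphism $\varphi$ acts by $F\mapsto\varphi\circ F$. 2. For any choice of a representative $g_Z\in Z(k)$ for each double coset $Z$, the assignment $(Z,V)\mapsto\mathbf{Ind}_Z(V)$ is a bijection from the set of pairs $(Z,V)$, with $Z$ a double coset and $V$ an isomorphism class of simple objects of $\mathrm{Rep}(L^{g_Z},\xi_{g_Z}^{-1})$, to the set of isomorphism classes of simple objects of $\mathscr M$. 3. $\mathscr M$ is the direct sum of the subcategories $\overline{\mathscr M_Z}$ over all double cosets $Z$: every object is a direct sum of objects of the $\overline{\mathscr M_Z}$, and there are no nonzero morphisms between objects of $\overline{\mathscr M_Z}$ and $\overline{\mathscr M_{Z'}}$ for $Z\neq Z'$. -/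

import Mathlib

open CategoryTheory TensorProduct

universe u

noncomputable section

namespace GroupSchemeSheaves

/-! ### Points of affine schemes and cochains

A finite group scheme is given by its coordinate algebra, a finite dimensional commutative Hopf
algebra.  Its group of `R`-points carries the convolution product
`(x * y) f = x f₁ * y f₂`, the unit is the counit and `x⁻¹` is `x` composed with the antipode. -/

section Points

variable {k : Type u} [Field k]

/-- The set of `R`-points of `Spec A`. -/
def Pt (k A R : Type u) [Field k] [CommRing A] [Algebra k A] [CommRing R] [Algebra k R] :
    Type u := WithConv (A →ₐ[k] R)

variable {A B R R' : Type u} [CommRing A] [CommRing B] [CommRing R] [Algebra k R]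
  [CommRing R'] [Algebra k R']

/-- The point given by an algebra homomorphism. -/
def Pt.mk [Algebra k A] (x : A →ₐ[k] R) : Pt k A R := WithConv.toConv x

/-- The algebra homomorphism given by a point. -/
def Pt.hom [Algebra k A] (x : Pt k A R) : A →ₐ[k] R := WithConv.ofConv x

@[ext] theorem Pt.ext [Algebra k A] {x y : Pt k A R} (h : ∀ a, x.hom a = y.hom a) : x = y :=
  WithConv.ext (AlgHom.ext h)

instance [HopfAlgebra k A] : Monoid (Pt k A R) :=
  inferInstanceAs (Monoid (WithConv (A →ₐ[k] R)))

theorem Pt.one_hom [HopfAlgebra k A] (a : A) :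
    (1 : Pt k A R).hom a = algebraMap k R (Coalgebra.counit a) := rfl

theorem Pt.mul_hom [HopfAlgebra k A] (x y : Pt k A R) (a : A) :
    (x * y).hom a =
      Algebra.TensorProduct.productMap x.hom y.hom (Coalgebra.comul (R := k) a) := by
  change ((WithConv.toConv x.hom * WithConv.toConv y.hom : WithConv (A →ₐ[k] R)).ofConv) a = _
  rw [AlgHom.convMul_def, Algebra.TensorProduct.productMap_eq_comp_map]
  rfl

instance [HopfAlgebra k A] : Group (Pt k A R) where
  inv x := Pt.mk (x.hom.comp (HopfAlgebra.antipodeAlgHom k A))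
  inv_mul_cancel x := by
    ext a
    have h : ∀ t : A ⊗[k] A, Algebra.TensorProduct.productMap
        (Pt.mk (x.hom.comp (HopfAlgebra.antipodeAlgHom k A))).hom x.hom t =
          x.hom (LinearMap.mul' k A ((HopfAlgebra.antipode k).rTensor A t)) := by
      intro t
      induction t with
      | zero => simp
      | tmul b c => simp [Pt.mk, Pt.hom]
      | add b c hb hc => rw [map_add, hb, hc]; simp only [map_add]
    change (Pt.mk (x.hom.comp (HopfAlgebra.antipodeAlgHom k A)) * x).hom a = _
    rw [Pt.mul_hom, h, HopfAlgebra.mul_antipode_rTensor_comul_apply, Pt.one_hom, AlgHom.commutes]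

/-- Base change of a point along `R → R'`. -/
def Pt.map [Algebra k A] (φ : R →ₐ[k] R') (x : Pt k A R) : Pt k A R' := Pt.mk (φ.comp x.hom)

theorem Pt.map_mul [HopfAlgebra k A] (φ : R →ₐ[k] R') (x y : Pt k A R) :
    (x * y).map φ = x.map φ * y.map φ := by
  ext a
  change φ ((x * y).hom a) = _
  rw [Pt.mul_hom, Pt.mul_hom]
  generalize (Coalgebra.comul (R := k) a : A ⊗[k] A) = t
  induction t with
  | zero => simp
  | tmul b c => simp [Pt.map, Pt.mk, Pt.hom]
  | add b c hb hc => rw [_root_.map_add, _root_.map_add, hb, hc, _root_.map_add]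

theorem Pt.map_inv [HopfAlgebra k A] (φ : R →ₐ[k] R') (x : Pt k A R) :
    x⁻¹.map φ = (x.map φ)⁻¹ := rfl

/-- A `k`-point regarded as an `R`-point. -/
def Pt.const [Algebra k A] (R : Type u) [CommRing R] [Algebra k R] (x : Pt k A k) : Pt k A R :=
  x.map (Algebra.ofId k R)

/-- The homomorphism on `R`-points induced by a homomorphism of group schemes
`Spec B → Spec A`. -/
def ptHom [HopfAlgebra k A] [HopfAlgebra k B] (i : A →ₐc[k] B) (R : Type u) [CommRing R]
    [Algebra k R] : Pt k B R →* Pt k A R where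
  toFun x := Pt.mk (x.hom.comp (i : A →ₐ[k] B))
  map_one' := by
    ext a
    change (1 : Pt k B R).hom (i a) = (1 : Pt k A R).hom a
    simp [Pt.one_hom]
  map_mul' x y := by
    ext a
    exact congrArg (fun z : WithConv (A →ₐ[k] R) => z.ofConv a)
      (congrArg WithConv.toConv (AlgHom.convMul_comp_bialgHom_distrib x y i))

variable [Algebra k A] [Algebra k B]

/-- The value `c(x, y) ∈ Rˣ` of a `2`-cochain with values in the multiplicative group. -/
def ev₂ (c : (A ⊗[k] A)ˣ) (x y : Pt k A R) : Rˣ :=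
  Units.map (Algebra.TensorProduct.productMap x.hom y.hom : A ⊗[k] A →ₐ[k] R) c

/-- The value `c(x, y, z) ∈ Rˣ` of a `3`-cochain with values in the multiplicative group. -/
def ev₃ (c : (A ⊗[k] A ⊗[k] A)ˣ) (x y z : Pt k A R) : Rˣ :=
  Units.map (Algebra.TensorProduct.productMap
    (Algebra.TensorProduct.productMap x.hom y.hom) z.hom : A ⊗[k] A ⊗[k] A →ₐ[k] R) c

/-- For `δ : V → A ⊗ V` and an `R`-point `p` of `Spec A`, the `R`-linear extension
`R ⊗ V → R ⊗ V` of `(p ⊗ id) ∘ δ`. -/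
def opAt {V : Type u} [AddCommGroup V] [Module k V] (δ : V →ₗ[k] A ⊗[k] V) (p : A →ₐ[k] R) :
    R ⊗[k] V →ₗ[R] R ⊗[k] V :=
  LinearMap.liftBaseChange R ((p.toLinearMap.rTensor V) ∘ₗ δ)

/-- The action of `R ⊗ A` on `R ⊗ S`, for an `A`-module `S`. -/
def act (R : Type u) [CommRing R] [Algebra k R] (S : Type u) [AddCommGroup S] [Module k S]
    [Module A S] [IsScalarTower k A S] : R ⊗[k] A →ₐ[R] Module.End R (R ⊗[k] S) :=
  Module.endTensorEndAlgHom.comp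
    (Algebra.TensorProduct.map (Algebra.lsmul R R R) (Algebra.lsmul k k S))

/-- The universal point of `Spec A` over `R ⊗ A`. -/
def gen (R : Type u) [CommRing R] [Algebra k R] : Pt k A (R ⊗[k] A) :=
  Pt.mk Algebra.TensorProduct.includeRight

/-- An `R`-point of `Spec B` regarded as an `(R ⊗ A)`-point. -/
def up (A : Type u) [CommRing A] [Algebra k A] (b : Pt k B R) :
    Pt k B (R ⊗[k] A) :=
  b.map Algebra.TensorProduct.includeLeft

end Points

/-! ### The initial data -/

/-- A finite group scheme `G` with a normalized `3`-cocycle `ω`, two closed subgroup schemes `H`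
and `K` (the restriction maps of coordinate algebras are surjective), and normalized `2`-cochains
`ψ` on `H` and `η` on `K` with `dψ = ω|_H` and `dη = ω|_K`. -/
structure Datum (k OG OH OK : Type u) [Field k] [CommRing OG] [HopfAlgebra k OG]
    [CommRing OH] [HopfAlgebra k OH] [CommRing OK] [HopfAlgebra k OK] where
  /-- restriction of functions to `H` -/
  resH : OG →ₐc[k] OH
  resH_surjective : Function.Surjective resH
  /-- restriction of functions to `K` -/
  resK : OG →ₐc[k] OK
  resK_surjective : Function.Surjective resK
  /-- the `3`-cocycle on `G` -/
  ω : (OG ⊗[k] OG ⊗[k] OG)ˣ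
  ω_norm : ∀ (R : Type u) [CommRing R] [Algebra k R] (x y : Pt k OG R),
    ev₃ ω 1 x y = 1 ∧ ev₃ ω x 1 y = 1 ∧ ev₃ ω x y 1 = 1
  ω_cocycle : ∀ (R : Type u) [CommRing R] [Algebra k R] (x y z w : Pt k OG R),
    ev₃ ω x y (z * w) * ev₃ ω (x * y) z w = ev₃ ω y z w * ev₃ ω x (y * z) w * ev₃ ω x y z
  /-- the `2`-cochain on `H` -/
  ψ : (OH ⊗[k] OH)ˣ
  ψ_norm : ∀ (R : Type u) [CommRing R] [Algebra k R] (x : Pt k OH R),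
    ev₂ ψ 1 x = 1 ∧ ev₂ ψ x 1 = 1
  ψ_coboundary : ∀ (R : Type u) [CommRing R] [Algebra k R] (x y z : Pt k OH R),
    ev₂ ψ x (y * z) * ev₂ ψ y z =
      ev₃ ω (ptHom resH R x) (ptHom resH R y) (ptHom resH R z) *
        (ev₂ ψ (x * y) z * ev₂ ψ x y)
  /-- the `2`-cochain on `K` -/
  η : (OK ⊗[k] OK)ˣ
  η_norm : ∀ (R : Type u) [CommRing R] [Algebra k R] (x : Pt k OK R),
    ev₂ η 1 x = 1 ∧ ev₂ η x 1 = 1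
  η_coboundary : ∀ (R : Type u) [CommRing R] [Algebra k R] (x y z : Pt k OK R),
    ev₂ η x (y * z) * ev₂ η y z =
      ev₃ ω (ptHom resK R x) (ptHom resK R y) (ptHom resK R z) *
        (ev₂ η (x * y) z * ev₂ η x y)

variable {k OG OH OK : Type u} [Field k] [CommRing OG] [HopfAlgebra k OG]
  [CommRing OH] [HopfAlgebra k OH] [CommRing OK] [HopfAlgebra k OK]

namespace Datum

variable (D : Datum k OG OH OK)

/-- The inclusion `H(R) → G(R)`. -/
def inH {R : Type u} [CommRing R] [Algebra k R] : Pt k OH R →* Pt k OG R := ptHom D.resH R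

/-- The inclusion `K(R) → G(R)`. -/
def inK {R : Type u} [CommRing R] [Algebra k R] : Pt k OK R →* Pt k OG R := ptHom D.resK R

end Datum

/-! ### Biequivariant sheaves -/

/-- A `((H, ψ), (K, η))`-biequivariant sheaf on `(G, ω)`: a finite dimensional `O(G)`-module `S`
with a left and a right equivariant structure.

The isomorphisms `S_x ≅ S_{bx}` (`b` in `H`) and `S_x ≅ S_{xc}` (`c` in `K`) of the equivariant
structures are recorded through their inverses `S_{bx} → S_x` and `S_{xc} → S_x`, that is, as
counital coactions `lam : S → O(H) ⊗ S` and `rho : S → S ⊗ O(K)`, semilinear over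
`f ↦ f(bx)` and `f ↦ f(xc)`.  On fibres at `x` the remaining axioms read
`lam_{bc} = ω(b,c,x) ψ(b,c) lam_c lam_b`,
`rho_{cd} = ω(x,c,d)⁻¹ η(c,d) rho_c rho_d` and
`lam_b rho_c = ω(b,x,c) rho_c lam_b`. -/
structure BiSheaf (D : Datum k OG OH OK) where
  /-- the underlying vector space -/
  carrier : Type u
  [addCommGroup : AddCommGroup carrier]
  [module : Module k carrier]
  [moduleG : Module OG carrier]
  [isScalarTower : IsScalarTower k OG carrier]
  [finite : FiniteDimensional k carrier]
  /-- the left equivariant structure -/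
  lam : carrier →ₗ[k] OH ⊗[k] carrier
  /-- the right equivariant structure -/
  rho : carrier →ₗ[k] carrier ⊗[k] OK
  lam_smul : ∀ (R : Type u) [CommRing R] [Algebra k R] (b : Pt k OH R) (f : OG) (s : carrier),
    opAt lam b.hom (1 ⊗ₜ (f • s)) =
      act R carrier ((D.inH (up OG b) * gen R).hom f) (opAt lam b.hom (1 ⊗ₜ s))
  rho_smul : ∀ (R : Type u) [CommRing R] [Algebra k R] (c : Pt k OK R) (f : OG) (s : carrier),
    opAt (TensorProduct.comm k carrier OK ∘ₗ rho) c.hom (1 ⊗ₜ (f • s)) =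
      act R carrier ((gen R * D.inK (up OG c)).hom f)
        (opAt (TensorProduct.comm k carrier OK ∘ₗ rho) c.hom (1 ⊗ₜ s))
  lam_one : ∀ (R : Type u) [CommRing R] [Algebra k R],
    opAt lam (1 : Pt k OH R).hom = LinearMap.id
  rho_one : ∀ (R : Type u) [CommRing R] [Algebra k R],
    opAt (TensorProduct.comm k carrier OK ∘ₗ rho) (1 : Pt k OK R).hom = LinearMap.id
  lam_mul : ∀ (R : Type u) [CommRing R] [Algebra k R] (b c : Pt k OH R),
    opAt lam (b * c).hom =
      (ev₂ D.ψ b c : R) • (act R carrier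
        (ev₃ D.ω (D.inH (up OG b)) (D.inH (up OG c)) (gen R) : R ⊗[k] OG) ∘ₗ
          opAt lam c.hom ∘ₗ opAt lam b.hom)
  rho_mul : ∀ (R : Type u) [CommRing R] [Algebra k R] (c d : Pt k OK R),
    opAt (TensorProduct.comm k carrier OK ∘ₗ rho) (c * d).hom =
      (ev₂ D.η c d : R) • (act R carrier
        (((ev₃ D.ω (gen R) (D.inK (up OG c)) (D.inK (up OG d)))⁻¹ : (R ⊗[k] OG)ˣ) :
          R ⊗[k] OG) ∘ₗ
          opAt (TensorProduct.comm k carrier OK ∘ₗ rho) c.hom ∘ₗ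
            opAt (TensorProduct.comm k carrier OK ∘ₗ rho) d.hom)
  lam_rho : ∀ (R : Type u) [CommRing R] [Algebra k R] (b : Pt k OH R) (c : Pt k OK R),
    opAt lam b.hom ∘ₗ opAt (TensorProduct.comm k carrier OK ∘ₗ rho) c.hom =
      act R carrier
        (ev₃ D.ω (D.inH (up OG b)) (gen R) (D.inK (up OG c)) : R ⊗[k] OG) ∘ₗ
          opAt (TensorProduct.comm k carrier OK ∘ₗ rho) c.hom ∘ₗ opAt lam b.hom

namespace BiSheaf

attribute [instance] addCommGroup module moduleG isScalarTower finite

variable {D : Datum k OG OH OK}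

/-- The operator `R ⊗ S → R ⊗ S` given by the left coaction and a point of `H`. -/
def lamAt (S : BiSheaf D) {R : Type u} [CommRing R] [Algebra k R] (b : Pt k OH R) :
    R ⊗[k] S.carrier →ₗ[R] R ⊗[k] S.carrier := opAt S.lam b.hom

/-- The operator `R ⊗ S → R ⊗ S` given by the right coaction and a point of `K`. -/
def rhoAt (S : BiSheaf D) {R : Type u} [CommRing R] [Algebra k R] (c : Pt k OK R) :
    R ⊗[k] S.carrier →ₗ[R] R ⊗[k] S.carrier :=
  opAt (TensorProduct.comm k S.carrier OK ∘ₗ S.rho) c.hom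

/-- Morphisms of biequivariant sheaves: linear maps that preserve the action of `O(G)` and the
two coactions. -/
def homs (S T : BiSheaf D) : Submodule k (S.carrier →ₗ[k] T.carrier) where
  carrier := {φ | (∀ (f : OG) (s : S.carrier), φ (f • s) = f • φ s) ∧
    T.lam ∘ₗ φ = φ.lTensor OH ∘ₗ S.lam ∧ T.rho ∘ₗ φ = φ.rTensor OK ∘ₗ S.rho}
  zero_mem' := by simp
  add_mem' := by
    rintro φ χ ⟨h1, h2, h3⟩ ⟨h1', h2', h3'⟩
    refine ⟨fun f s => by simp [h1, h1'], ?_, ?_⟩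
    · rw [LinearMap.comp_add, h2, h2', LinearMap.lTensor_add, LinearMap.add_comp]
    · rw [LinearMap.comp_add, h3, h3', LinearMap.rTensor_add, LinearMap.add_comp]
  smul_mem' := by
    rintro a φ ⟨h1, h2, h3⟩
    refine ⟨fun f s => ?_, ?_, ?_⟩
    · rw [LinearMap.smul_apply, LinearMap.smul_apply, h1, smul_comm]
    · rw [LinearMap.comp_smul, h2, LinearMap.lTensor_smul, LinearMap.smul_comp]
    · rw [LinearMap.comp_smul, h3, LinearMap.rTensor_smul, LinearMap.smul_comp]

theorem id_mem_homs (S : BiSheaf D) : LinearMap.id ∈ homs S S :=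
  ⟨fun _ _ => rfl, by rw [LinearMap.lTensor_id]; rfl, by rw [LinearMap.rTensor_id]; rfl⟩

theorem comp_mem_homs {S T U : BiSheaf D} {φ : S.carrier →ₗ[k] T.carrier}
    {χ : T.carrier →ₗ[k] U.carrier} (h : φ ∈ homs S T) (h' : χ ∈ homs T U) :
    χ ∘ₗ φ ∈ homs S U := by
  obtain ⟨h1, h2, h3⟩ := h
  obtain ⟨h1', h2', h3'⟩ := h'
  refine ⟨fun f s => by simp [h1, h1'], ?_, ?_⟩
  · rw [← LinearMap.comp_assoc, h2', LinearMap.comp_assoc, h2, ← LinearMap.comp_assoc,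
      LinearMap.lTensor_comp]
  · rw [← LinearMap.comp_assoc, h3', LinearMap.comp_assoc, h3, ← LinearMap.comp_assoc,
      LinearMap.rTensor_comp]

instance : Category (BiSheaf D) where
  Hom S T := homs S T
  id S := ⟨LinearMap.id, id_mem_homs S⟩
  comp φ χ := ⟨χ.1 ∘ₗ φ.1, comp_mem_homs φ.2 χ.2⟩

/-- The linear map underlying a morphism. -/
def Hom.lin {S T : BiSheaf D} (φ : S ⟶ T) : S.carrier →ₗ[k] T.carrier := Subtype.val φ

instance : Preadditive (BiSheaf D) where
  homGroup S T := inferInstanceAs (AddCommGroup (homs S T))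
  add_comp _ _ _ φ φ' χ := Subtype.ext (LinearMap.comp_add φ.1 φ'.1 χ.1)
  comp_add _ _ _ φ χ χ' := Subtype.ext (LinearMap.add_comp φ.1 χ'.1 χ.1)

instance : Linear k (BiSheaf D) where
  homModule S T := inferInstanceAs (Module k (homs S T))
  smul_comp _ _ _ a φ χ := Subtype.ext (LinearMap.comp_smul χ.1 a φ.1)
  comp_smul _ _ _ φ a χ := Subtype.ext (LinearMap.smul_comp a χ.1 φ.1)

end BiSheaf

/-! ### Double cosets -/

namespace Datum

variable (D : Datum k OG OH OK)

/-- The orbit map `H × K → G`, `(h, l) ↦ h⁻¹ g l`, on functions. -/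
def orbitMap (g : Pt k OG k) : OG →ₐ[k] OH ⊗[k] OK :=
  ((D.inH (Pt.mk Algebra.TensorProduct.includeLeft))⁻¹ * g.const (OH ⊗[k] OK) *
    D.inK (Pt.mk Algebra.TensorProduct.includeRight)).hom

/-- The defining ideal of the closed subscheme `HgK` of `G`. -/
def orbitIdeal (g : Pt k OG k) : Ideal OG := RingHom.ker (D.orbitMap g)

/-- The `(H, K)`-double cosets, that is, the closed subschemes of `G` of the form `HgK` with
`g ∈ G(k)`, given by their defining ideals. -/
def DoubleCoset : Type u := Set.range D.orbitIdeal

/-- The defining ideal of a double coset. -/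
def DoubleCoset.ideal {D : Datum k OG OH OK} (Z : D.DoubleCoset) : Ideal OG := Z.1

/-- `g ∈ Z(k)`. -/
def DoubleCoset.IsRep {D : Datum k OG OH OK} (Z : D.DoubleCoset) (g : Pt k OG k) : Prop :=
  Z.ideal ≤ RingHom.ker g.hom

/-- The sheaves annihilated by the defining ideal of `Z`. -/
def supportedOn (Z : D.DoubleCoset) : ObjectProperty (BiSheaf D) :=
  fun S => ∀ f ∈ Z.ideal, ∀ s : S.carrier, f • s = 0

/-! ### The stabilizer and its cocycle -/

/-- The subgroup scheme `L^g = H ∩ g K g⁻¹`, on `R`-points; an element `l` is recorded as the pair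
of `l` in `H(R)` and `g⁻¹ l g` in `K(R)`. -/
def stab (g : Pt k OG k) (R : Type u) [CommRing R] [Algebra k R] :
    Subgroup (Pt k OH R × Pt k OK R) :=
  MonoidHom.eqLocus (D.inH.comp (MonoidHom.fst _ _))
    ((MulAut.conj (g.const R)).toMonoidHom.comp (D.inK.comp (MonoidHom.snd _ _)))

/-- The ideal of `L^g` in `O(H × K)`, for the embedding `l ↦ (l, g⁻¹ l g)`. -/
def stabIdeal (g : Pt k OG k) : Ideal (OH ⊗[k] OK) :=
  Ideal.span (Set.range fun f : OG =>
    (D.inH (Pt.mk Algebra.TensorProduct.includeLeft) : Pt k OG (OH ⊗[k] OK)).hom f -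
      (g.const (OH ⊗[k] OK) * D.inK (Pt.mk Algebra.TensorProduct.includeRight) *
        (g.const (OH ⊗[k] OK))⁻¹).hom f)

/-- The coordinate algebra `O(L^g)`. -/
abbrev OL (g : Pt k OG k) : Type u := (OH ⊗[k] OK) ⧸ D.stabIdeal g

variable {D}

/-- The component in `H(R)` of a point of `L^g`. -/
def toH {g : Pt k OG k} {R : Type u} [CommRing R] [Algebra k R] (l : D.stab g R) : Pt k OH R :=
  l.1.1

/-- The component `g⁻¹ l g` in `K(R)` of a point of `L^g`. -/
def toK {g : Pt k OG k} {R : Type u} [CommRing R] [Algebra k R] (l : D.stab g R) : Pt k OK R :=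
  l.1.2

theorem stabIdeal_le_ker {g : Pt k OG k} {R : Type u} [CommRing R] [Algebra k R]
    (l : D.stab g R) : ∀ a ∈ D.stabIdeal g,
      Algebra.TensorProduct.productMap (toH l).hom (toK l).hom a = 0 := by
  have hl : D.inH (toH l) = g.const R * D.inK (toK l) * (g.const R)⁻¹ := l.2
  set p : OH ⊗[k] OK →ₐ[k] R := Algebra.TensorProduct.productMap (toH l).hom (toK l).hom with hp
  have e1 : (D.inH (Pt.mk Algebra.TensorProduct.includeLeft) : Pt k OG (OH ⊗[k] OK)).map p =
      D.inH (toH l) := by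
    ext f
    change p (D.resH f ⊗ₜ 1) = (toH l).hom (D.resH f)
    simp [hp]
  have e2 : (D.inK (Pt.mk Algebra.TensorProduct.includeRight) : Pt k OG (OH ⊗[k] OK)).map p =
      D.inK (toK l) := by
    ext f
    change p (1 ⊗ₜ D.resK f) = (toK l).hom (D.resK f)
    simp [hp]
  have e3 : (g.const (OH ⊗[k] OK)).map p = g.const R := by
    ext f
    change p (algebraMap k _ (g.hom f)) = algebraMap k _ (g.hom f)
    exact p.commutes _
  intro a ha
  refine (Ideal.span_le.2 ?_ : D.stabIdeal g ≤ RingHom.ker p) ha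
  rintro _ ⟨f, rfl⟩
  have h : ((g.const (OH ⊗[k] OK) * D.inK (Pt.mk Algebra.TensorProduct.includeRight) *
        (g.const (OH ⊗[k] OK))⁻¹).map p) = D.inH (toH l) := by
    rw [hl, Pt.map_mul, Pt.map_mul, Pt.map_inv, e2, e3]
  simp only [SetLike.mem_coe, RingHom.mem_ker, map_sub]
  rw [sub_eq_zero]
  exact congrArg (fun z : Pt k OG R => z.hom f) (e1.trans h.symm)

/-- A point of `L^g` as a homomorphism on its coordinate algebra. -/
def stabHom {g : Pt k OG k} {R : Type u} [CommRing R] [Algebra k R] (l : D.stab g R) :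
    D.OL g →ₐ[k] R :=
  Ideal.Quotient.liftₐ (D.stabIdeal g)
    (Algebra.TensorProduct.productMap (toH l).hom (toK l).hom) (stabIdeal_le_ker l)

/-- Every point of `O(L^g)` is given by a unique element of the group `L^g(R)`. -/
theorem stabHom_bijective (g : Pt k OG k) (R : Type u) [CommRing R] [Algebra k R] :
    Function.Bijective (stabHom : D.stab g R → (D.OL g →ₐ[k] R)) := by
  constructor
  · intro l m h
    have hx : ∀ x : OH ⊗[k] OK, Algebra.TensorProduct.productMap (toH l).hom (toK l).hom x =
        Algebra.TensorProduct.productMap (toH m).hom (toK m).hom x := fun x =>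
      congrArg (fun z : D.OL g →ₐ[k] R => z (Ideal.Quotient.mk _ x)) h
    apply Subtype.ext
    apply Prod.ext
    · ext a
      simpa [toH] using hx (a ⊗ₜ 1)
    · ext a
      simpa [toK] using hx (1 ⊗ₜ a)
  · intro p
    set q : OH ⊗[k] OK →ₐ[k] R := p.comp (Ideal.Quotient.mkₐ k (D.stabIdeal g)) with hq
    have h : D.inH (Pt.mk (q.comp Algebra.TensorProduct.includeLeft)) = g.const R *
        D.inK (Pt.mk (q.comp Algebra.TensorProduct.includeRight)) * (g.const R)⁻¹ := by
      have e3 : (g.const (OH ⊗[k] OK)).map q = g.const R := by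
        ext f
        exact q.commutes _
      have e : (D.inH (Pt.mk Algebra.TensorProduct.includeLeft) : Pt k OG (OH ⊗[k] OK)).map q =
          (g.const (OH ⊗[k] OK) * D.inK (Pt.mk Algebra.TensorProduct.includeRight) *
            (g.const (OH ⊗[k] OK))⁻¹).map q := by
        ext f
        exact congrArg p (Ideal.Quotient.eq.2 (Ideal.subset_span ⟨f, rfl⟩))
      rw [Pt.map_mul, Pt.map_mul, Pt.map_inv, e3] at e
      exact e
    refine ⟨⟨⟨_, _⟩, h⟩, ?_⟩
    apply Ideal.Quotient.algHom_ext
    apply Algebra.TensorProduct.ext'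
    intro a b
    change q (a ⊗ₜ 1) * q (1 ⊗ₜ b) = q (a ⊗ₜ b)
    rw [← map_mul]
    simp

variable (D)

/-- The `2`-cocycle `ξ_g(l, m) = ψ(l, m) η(l', m')⁻¹ ω(g, l', m') ω(l, m, g) ω(l, g, m')⁻¹` on
`L^g`, where `l' = g⁻¹ l g`. -/
def xi (g : Pt k OG k) {R : Type u} [CommRing R] [Algebra k R] (l m : D.stab g R) : Rˣ :=
  ev₂ D.ψ (toH l) (toH m) * (ev₂ D.η (toK l) (toK m))⁻¹ *
    ev₃ D.ω (g.const R) (D.inK (toK l)) (D.inK (toK m)) *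
    ev₃ D.ω (D.inH (toH l)) (D.inH (toH m)) (g.const R) *
    (ev₃ D.ω (D.inH (toH l)) (g.const R) (D.inK (toK m)))⁻¹

/-- The point `h⁻¹ g l` of `G`. -/
def orbitPt (g : Pt k OG k) {R : Type u} [CommRing R] [Algebra k R] (h : Pt k OH R)
    (l : Pt k OK R) : Pt k OG R :=
  (D.inH h)⁻¹ * g.const R * D.inK l

/-- The factor
`Θ_g(l, (h, c)) = ψ(l, h) η(l', c)⁻¹ ω(g, l', c) ω(l, h, h⁻¹gc) ω(l, g, c)⁻¹`, for `l` in `L^g`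
and `(h, c)` in `H × K`; it restricts to `ξ_g` along the embedding of `L^g` in `H × K`. -/
def theta (g : Pt k OG k) {R : Type u} [CommRing R] [Algebra k R] (l : D.stab g R)
    (h : Pt k OH R) (c : Pt k OK R) : Rˣ :=
  ev₂ D.ψ (toH l) h * (ev₂ D.η (toK l) c)⁻¹ *
    ev₃ D.ω (g.const R) (D.inK (toK l)) (D.inK c) *
    ev₃ D.ω (D.inH (toH l)) (D.inH h) (D.orbitPt g h c) *
    (ev₃ D.ω (D.inH (toH l)) (g.const R) (D.inK c))⁻¹

end Datum

/-! ### Projective representations of the stabilizer -/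

/-- An object of `Rep(L^g, ξ_g⁻¹)`: a finite dimensional left comodule over the twisted coalgebra
`O(L^g)` with comultiplication `f ↦ Δ(f) ξ_g⁻¹`.  On points, the operators `T_l = (l ⊗ id) ∘ coact`
satisfy `T_m T_l = ξ_g(l, m)⁻¹ T_{lm}`. -/
structure ProjRep (D : Datum k OG OH OK) (g : Pt k OG k) where
  /-- the underlying vector space -/
  carrier : Type u
  [addCommGroup : AddCommGroup carrier]
  [module : Module k carrier]
  [finite : FiniteDimensional k carrier]
  /-- the coaction -/
  coact : carrier →ₗ[k] D.OL g ⊗[k] carrier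
  coact_one : ∀ (R : Type u) [CommRing R] [Algebra k R],
    opAt coact (Datum.stabHom (1 : D.stab g R)) = LinearMap.id
  coact_mul : ∀ (R : Type u) [CommRing R] [Algebra k R] (l m : D.stab g R),
    opAt coact (Datum.stabHom m) ∘ₗ opAt coact (Datum.stabHom l) =
      (((D.xi g l m)⁻¹ : Rˣ) : R) • opAt coact (Datum.stabHom (l * m))

namespace ProjRep

attribute [instance] addCommGroup module finite

variable {D : Datum k OG OH OK} {g : Pt k OG k}

/-- The operator `T_l` on `R ⊗ V`. -/
def opT (V : ProjRep D g) {R : Type u} [CommRing R] [Algebra k R] (l : D.stab g R) :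
    R ⊗[k] V.carrier →ₗ[R] R ⊗[k] V.carrier := opAt V.coact (Datum.stabHom l)

/-- Morphisms of comodules. -/
def homs (V W : ProjRep D g) : Submodule k (V.carrier →ₗ[k] W.carrier) where
  carrier := {φ | W.coact ∘ₗ φ = φ.lTensor (D.OL g) ∘ₗ V.coact}
  zero_mem' := by simp
  add_mem' := by
    intro φ χ h h'
    simp only [Set.mem_ofPred_eq] at *
    rw [LinearMap.comp_add, h, h', LinearMap.lTensor_add, LinearMap.add_comp]
  smul_mem' := by
    intro a φ h
    simp only [Set.mem_ofPred_eq] at *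
    rw [LinearMap.comp_smul, h, LinearMap.lTensor_smul, LinearMap.smul_comp]

theorem id_mem_homs (V : ProjRep D g) : LinearMap.id ∈ homs V V := by
  change _ = _
  rw [LinearMap.lTensor_id]
  rfl

theorem comp_mem_homs {U V W : ProjRep D g} {φ : U.carrier →ₗ[k] V.carrier}
    {χ : V.carrier →ₗ[k] W.carrier} (h : φ ∈ homs U V) (h' : χ ∈ homs V W) :
    χ ∘ₗ φ ∈ homs U W := by
  have h1 : V.coact ∘ₗ φ = φ.lTensor (D.OL g) ∘ₗ U.coact := h
  have h2 : W.coact ∘ₗ χ = χ.lTensor (D.OL g) ∘ₗ V.coact := h'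
  change _ = _
  rw [← LinearMap.comp_assoc, h2, LinearMap.comp_assoc, h1, ← LinearMap.comp_assoc,
    LinearMap.lTensor_comp]

instance : Category (ProjRep D g) where
  Hom V W := homs V W
  id V := ⟨LinearMap.id, id_mem_homs V⟩
  comp φ χ := ⟨χ.1 ∘ₗ φ.1, comp_mem_homs φ.2 χ.2⟩

/-- The linear map underlying a morphism. -/
def Hom.lin {V W : ProjRep D g} (φ : V ⟶ W) : V.carrier →ₗ[k] W.carrier := Subtype.val φ

instance : Preadditive (ProjRep D g) where
  homGroup V W := inferInstanceAs (AddCommGroup (homs V W))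
  add_comp _ _ _ φ φ' χ := Subtype.ext (LinearMap.comp_add φ.1 φ'.1 χ.1)
  comp_add _ _ _ φ χ χ' := Subtype.ext (LinearMap.add_comp φ.1 χ'.1 χ.1)

instance : Linear k (ProjRep D g) where
  homModule V W := inferInstanceAs (Module k (homs V W))
  smul_comp _ _ _ a φ χ := Subtype.ext (LinearMap.comp_smul χ.1 a φ.1)
  comp_smul _ _ _ φ a χ := Subtype.ext (LinearMap.smul_comp a χ.1 φ.1)

/-- The value in `R ⊗ V` of a function `F` on `H × K` with values in `V` at an `R`-point. -/
def valAt (V : ProjRep D g) {R : Type u} [CommRing R] [Algebra k R] (h : Pt k OH R)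
    (c : Pt k OK R) : (OH ⊗[k] OK) ⊗[k] V.carrier →ₗ[k] R ⊗[k] V.carrier :=
  (Algebra.TensorProduct.productMap h.hom c.hom).toLinearMap.rTensor V.carrier

/-- The functions `F` on `H × K` with values in `V` that satisfy
`T_l F(l h, l' c) = Θ_g(l, (h, c))⁻¹ F(h, c)` for `l` in `L^g`. -/
def inducedSet (V : ProjRep D g) : Set ((OH ⊗[k] OK) ⊗[k] V.carrier) :=
  {F | ∀ (R : Type u) [CommRing R] [Algebra k R] (l : D.stab g R) (h : Pt k OH R) (c : Pt k OK R),
    V.opT l (V.valAt (Datum.toH l * h) (Datum.toK l * c) F) =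
      (((D.theta g l h c)⁻¹ : Rˣ) : R) • V.valAt h c F}

end ProjRep

/-! ### Induction -/

/-- `F` is the induction functor from `L^g`: it sends `V` to the space of functions
`inducedSet V` on `H × K` with values in `V` (and a morphism `φ` to composition with `φ`), where
* `f` in `O(G)` acts by `(f F)(h, c) = f(h⁻¹gc) F(h, c)`,
* `(lam_b F)(h, c) = ω(hb⁻¹, b, h⁻¹gc)⁻¹ ψ(hb⁻¹, b)⁻¹ F(hb⁻¹, c)` for `b` in `H`,
* `(rho_d F)(h, c) = ω(g, c, d) ω(h, h⁻¹gc, d)⁻¹ η(c, d)⁻¹ F(h, cd)` for `d` in `K`. -/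
def IsInduction {D : Datum k OG OH OK} (g : Pt k OG k) (Ind : ProjRep D g ⥤ BiSheaf D) : Prop :=
  ∃ e : ∀ V : ProjRep D g, (Ind.obj V).carrier →ₗ[k] (OH ⊗[k] OK) ⊗[k] V.carrier,
    (∀ V, Function.Injective (e V)) ∧
    (∀ V, Set.range (e V) = V.inducedSet) ∧
    (∀ (V W : ProjRep D g) (φ : V ⟶ W) (s : (Ind.obj V).carrier),
      e W (BiSheaf.Hom.lin (Ind.map φ) s) =
        (ProjRep.Hom.lin φ).lTensor (OH ⊗[k] OK) (e V s)) ∧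
    (∀ (V : ProjRep D g) (f : OG) (s : (Ind.obj V).carrier),
      e V (f • s) = D.orbitMap g f • e V s) ∧
    (∀ (V : ProjRep D g) (R : Type u) [CommRing R] [Algebra k R] (h b : Pt k OH R)
      (c : Pt k OK R) (s : (Ind.obj V).carrier),
      LinearMap.liftBaseChange R (V.valAt h c ∘ₗ e V) ((Ind.obj V).lamAt b (1 ⊗ₜ s)) =
        (((ev₃ D.ω (D.inH (h * b⁻¹)) (D.inH b) (D.orbitPt g h c) *
          ev₂ D.ψ (h * b⁻¹) b)⁻¹ : Rˣ) : R) • V.valAt (h * b⁻¹) c (e V s)) ∧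
    (∀ (V : ProjRep D g) (R : Type u) [CommRing R] [Algebra k R] (h : Pt k OH R)
      (c d : Pt k OK R) (s : (Ind.obj V).carrier),
      LinearMap.liftBaseChange R (V.valAt h c ∘ₗ e V) ((Ind.obj V).rhoAt d (1 ⊗ₜ s)) =
        ((ev₃ D.ω (g.const R) (D.inK c) (D.inK d) *
          (ev₃ D.ω (D.inH h) (D.orbitPt g h c) (D.inK d) * ev₂ D.η c d)⁻¹ : Rˣ) : R) •
            V.valAt h (c * d) (e V s))

/-! ### Simple objects and Serre closures -/

/-- The isomorphism classes of simple objects. -/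
def SimpleClass (C : Type*) [Category C] [Preadditive C] : Type _ :=
  Quotient (isIsomorphicSetoid (ObjectProperty.FullSubcategory fun X : C => Simple X))

/-- The isomorphism class of a simple object. -/
def SimpleClass.mk {C : Type*} [Category C] [Preadditive C] (X : C) (h : Simple X) :
    SimpleClass C :=
  Quotient.mk (isIsomorphicSetoid (ObjectProperty.FullSubcategory fun X : C => Simple X)) ⟨X, h⟩

/-- `T` is a composition factor of `S`: a simple object that is a quotient of a subobject. -/
def IsCompositionFactor {C : Type*} [Category C] [Preadditive C] (T S : C) : Prop :=
  Simple T ∧ ∃ (W : C) (i : W ⟶ S) (q : W ⟶ T), Mono i ∧ Epi q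

/-- The Serre closure: the objects all of whose composition factors lie in `P`. -/
def serreClosure {C : Type*} [Category C] [Preadditive C] (P : ObjectProperty C) :
    ObjectProperty C :=
  fun S => ∀ T : C, IsCompositionFactor T S → P T

/-- `C` is the direct sum of its full subcategories `P j`: there are no nonzero morphisms between
different ones, and every object is a direct sum of objects from them. -/
def IsDirectSum {C J : Type*} [Category C] [Preadditive C] (P : J → ObjectProperty C) : Prop :=
  (∀ i j, i ≠ j → ∀ X Y : C, P i X → P j Y → ∀ φ : X ⟶ Y, φ = 0) ∧
    ∀ S : C, ∃ X : J → C, (∀ j, P j (X j)) ∧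
      ∃ _ : Limits.HasBiproduct X, Nonempty (S ≅ ⨁ X)

end GroupSchemeSheaves

end

open GroupSchemeSheaves

noncomputable section
namespace GroupSchemeSheaves

/-! ### Naturality of points, cochains and operators -/

section Naturality

variable {k : Type u} [Field k] {A B R R' R'' V W : Type u} [CommRing A] [CommRing B]
  [CommRing R] [Algebra k R] [CommRing R'] [Algebra k R'] [CommRing R''] [Algebra k R'']
  [AddCommGroup V] [Module k V] [AddCommGroup W] [Module k W]

/-! This is Mackey's description of equivariant objects on an orbit, carried out for group schemes
that may be non-reduced. Identities are therefore tested on points with values in arbitrary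
algebras. After composition with a linear map that factors through the fibre at a point `x`
(`IsAt`), the sheaf axioms become identities with honest scalars, and all coherence reduces to the
cocycle equation of ω and the coboundary equations of ψ and η at suitable points.

For `g` in G(k) and a vector space V, all V-valued functions on H × K form a biequivariant sheaf
`Coind` by way of the orbit map. It is right adjoint to the fibre at `g`: a linear map π on S that
factors through this fibre corresponds to the morphism sending s to the function (h, c) ↦ π(ρ_c
λ_{h⁻¹} s), up to the unit `frobFactor` (`frob_mem_homs`, `Coind.hom_ext`). The induced sheaf is the
kernel of the morphism Coind V → Coind (O(L^g) ⊗ V) that corresponds to F ↦ (l ↦ T_l F(l, l') − F(1,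
1)) (`frob_indObstruction_eq_zero_iff`), so its sheaf structure is that of a kernel.

The geometric input is `frob_injective_and_finrank`: a sheaf S supported on Z embeds in Coind of its
fibre at `g`, and dim S = dim S_g · dim O(Z). Translation by k-points bounds all fibres over Z by
dim S_g, so Nakayama gives that many generators. Their images generate a free O(H × K)-module of the
same rank, hence form a basis, and so relations between them have coefficients in the ideal of Z.
This takes the place of faithfully flat descent along H × K → Z. Counting dimensions, the fibre at
`g` is an exact functor on such sheaves (`mem_smul_top_of_injective`).

Exactness shows that evaluation at the unit identifies the fibre of the induced sheaf with V
(`mem_smul_top_of_indEv_eq_zero`, `indEv_surjective`), which gives full faithfulness. Conversely the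
fibre of any S supported on Z is a representation of L^g, and S embeds in the sheaf induced from it;
the dimensions agree, so this is an isomorphism (`exists_iso_ind`).

A simple sheaf has a nonzero fibre at some k-point, hence embeds in a coinduced sheaf and is
supported on a double coset; simple objects therefore come from the equivalences. The direct sum
decomposition comes from idempotents e_Z of O(G), equal to 1 on Z and 0 on the other double cosets.
Idempotents are determined by their values at k-points, so e_Z is invariant under H and K and
multiplication by it is a morphism. The Serre closure of the sheaves on Z consists of those on which
e_Z acts as the identity (`serreClosure_supportedOn_iff`). -/

@[simp] theorem Pt.hom_mk [Algebra k A] (x : A →ₐ[k] R) : (Pt.mk x).hom = x := rfl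

@[simp] theorem Pt.hom_map [Algebra k A] (φ : R →ₐ[k] R') (x : Pt k A R) :
    (x.map φ).hom = φ.comp x.hom := rfl

theorem Pt.map_one [HopfAlgebra k A] (φ : R →ₐ[k] R') : (1 : Pt k A R).map φ = 1 := by
  ext a
  change φ (algebraMap k R _) = algebraMap k R' _
  simp

theorem Pt.const_map [Algebra k A] (φ : R →ₐ[k] R') (x : Pt k A k) :
    (x.const R).map φ = x.const R' := by
  ext a
  change φ (algebraMap k R _) = algebraMap k R' _
  simp

theorem Pt.const_self [Algebra k A] (x : Pt k A k) : x.const k = x := rfl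

theorem ev₂_map [Algebra k A] (φ : R →ₐ[k] R') (c : (A ⊗[k] A)ˣ) (x y : Pt k A R) :
    Units.map (φ : R →* R') (ev₂ c x y) = ev₂ c (x.map φ) (y.map φ) := by
  ext
  change φ (Algebra.TensorProduct.productMap x.hom y.hom _) =
    Algebra.TensorProduct.productMap (x.map φ).hom (y.map φ).hom _
  rw [← AlgHom.comp_apply]
  congr 1
  ext <;> simp

theorem ev₃_map [Algebra k A] (φ : R →ₐ[k] R') (c : (A ⊗[k] A ⊗[k] A)ˣ) (x y z : Pt k A R) :
    Units.map (φ : R →* R') (ev₃ c x y z) = ev₃ c (x.map φ) (y.map φ) (z.map φ) := by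
  ext
  change φ (Algebra.TensorProduct.productMap
    (Algebra.TensorProduct.productMap x.hom y.hom) z.hom _) =
    Algebra.TensorProduct.productMap
      (Algebra.TensorProduct.productMap (x.map φ).hom (y.map φ).hom) (z.map φ).hom _
  rw [← AlgHom.comp_apply]
  congr 1
  ext <;> simp

/-- Base change of vectors along `R → R'`; equivalently, the value of a vector valued function at
a point. -/
def bc (φ : R →ₐ[k] R') (V : Type u) [AddCommGroup V] [Module k V] :
    R ⊗[k] V →ₗ[k] R' ⊗[k] V := φ.toLinearMap.rTensor V

@[simp] theorem bc_tmul (φ : R →ₐ[k] R') (r : R) (v : V) :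
    bc φ V (r ⊗ₜ v) = φ r ⊗ₜ v := rfl

theorem bc_smul (φ : R →ₐ[k] R') (r : R) (x : R ⊗[k] V) : bc φ V (r • x) = φ r • bc φ V x := by
  induction x with
  | zero => simp
  | tmul s v => simp [smul_tmul']
  | add x y hx hy => rw [smul_add, map_add, map_add, hx, hy, smul_add]

theorem bc_units_smul (φ : R →ₐ[k] R') (r : Rˣ) (x : R ⊗[k] V) :
    bc φ V (r • x) = Units.map (φ : R →* R') r • bc φ V x := bc_smul φ r x

theorem bc_bc (φ : R →ₐ[k] R') (χ : R' →ₐ[k] R'') (x : R ⊗[k] V) :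
    bc χ V (bc φ V x) = bc (χ.comp φ) V x := by
  change (χ.toLinearMap.rTensor V ∘ₗ φ.toLinearMap.rTensor V) x = _
  rw [← LinearMap.rTensor_comp]
  rfl

@[simp] theorem bc_id (x : R ⊗[k] V) : bc (AlgHom.id k R) V x = x := LinearMap.rTensor_id_apply _ _ x

theorem one_tmul_lid (t : k ⊗[k] V) :
    (1 : R) ⊗ₜ[k] (TensorProduct.lid k V t) = bc (Algebra.ofId k R) V t := by
  induction t with
  | zero => simp
  | add a b ha hb => rw [map_add, map_add, tmul_add, ha, hb]
  | tmul a v =>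
    rw [TensorProduct.lid_tmul, bc_tmul, tmul_smul, smul_tmul', Algebra.ofId_apply,
      Algebra.algebraMap_eq_smul_one]

theorem bc_baseChange (φ : R →ₐ[k] R') (f : V →ₗ[k] W) (x : R ⊗[k] V) :
    bc φ W (f.baseChange R x) = f.baseChange R' (bc φ V x) := by
  induction x with
  | zero => simp
  | tmul s v => simp
  | add x y hx hy => simp only [map_add, hx, hy]

/-- Two `R`-linear maps on `R ⊗ V` agree if they agree on `1 ⊗ v`. -/
theorem ext_one_tmul {M : Type*} [AddCommGroup M] [Module R M] {f f' : R ⊗[k] V →ₗ[R] M}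
    (h : ∀ v, f (1 ⊗ₜ v) = f' (1 ⊗ₜ v)) : f = f' := by
  refine LinearMap.ext fun x => ?_
  induction x with
  | zero => simp
  | tmul r v =>
    have : (r ⊗ₜ[k] v : R ⊗[k] V) = r • (1 ⊗ₜ v) := by simp [smul_tmul']
    rw [this, map_smul, map_smul, h]
  | add x y hx hy => rw [map_add, map_add, hx, hy]

variable [Algebra k A] [Algebra k B]

/-- The `R`-linear map `R ⊗ V → R ⊗ W` given by `δ : V → A ⊗ W` and an `R`-point of `Spec A`. -/
def applyAt (δ : V →ₗ[k] A ⊗[k] W) (p : A →ₐ[k] R) : R ⊗[k] V →ₗ[R] R ⊗[k] W :=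
  LinearMap.liftBaseChange R (bc p W ∘ₗ δ)

@[simp] theorem applyAt_one_tmul (δ : V →ₗ[k] A ⊗[k] W) (p : A →ₐ[k] R) (v : V) :
    applyAt δ p (1 ⊗ₜ v) = bc p W (δ v) := by simp [applyAt]

theorem bc_applyAt (φ : R →ₐ[k] R') (δ : V →ₗ[k] A ⊗[k] W) (p : A →ₐ[k] R) (x : R ⊗[k] V) :
    bc φ W (applyAt δ p x) = applyAt δ (φ.comp p) (bc φ V x) := by
  induction x with
  | zero => simp
  | tmul s v => simp [applyAt, bc_smul, bc_bc]
  | add x y hx hy => simp only [map_add, hx, hy]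

theorem applyAt_universal (δ : V →ₗ[k] A ⊗[k] W) (v : V) :
    applyAt δ (AlgHom.id k A) (1 ⊗ₜ v) = δ v := by simp

theorem applyAt_baseChange {δ : V →ₗ[k] A ⊗[k] V} {δ' : W →ₗ[k] A ⊗[k] W} {f : V →ₗ[k] W}
    (h : δ' ∘ₗ f = f.lTensor A ∘ₗ δ) (p : A →ₐ[k] R) (x : R ⊗[k] V) :
    applyAt δ' p (f.baseChange R x) = f.baseChange R (applyAt δ p x) := by
  suffices applyAt δ' p ∘ₗ f.baseChange R = f.baseChange R ∘ₗ applyAt δ p from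
    DFunLike.congr_fun this x
  refine ext_one_tmul fun v => ?_
  have := DFunLike.congr_fun h v
  simp only [LinearMap.comp_apply] at this
  simp only [LinearMap.comp_apply, LinearMap.baseChange_tmul, applyAt_one_tmul, this]
  exact bc_baseChange p f (δ v)

/-- The identity of `A` is the universal point of Spec A, so compatibility with two coactions needs
to be tested only there. -/
theorem lTensor_comp_of_applyAt {δ : V →ₗ[k] A ⊗[k] V} {δ' : W →ₗ[k] A ⊗[k] W} {f : V →ₗ[k] W}
    (h : ∀ v, applyAt δ' (AlgHom.id k A) (1 ⊗ₜ f v) =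
      f.baseChange A (applyAt δ (AlgHom.id k A) (1 ⊗ₜ v))) :
    δ' ∘ₗ f = f.lTensor A ∘ₗ δ := by
  ext v
  have := h v
  simp only [applyAt_universal] at this
  exact this

/-- Evaluation of vector valued functions on `Spec A` with coefficients in `R` at an `R`-point. -/
def evalAt (V : Type u) [AddCommGroup V] [Module k V] (p : A →ₐ[k] R) :
    R ⊗[k] (A ⊗[k] V) →ₗ[R] R ⊗[k] V :=
  applyAt LinearMap.id p

@[simp] theorem evalAt_one_tmul (p : A →ₐ[k] R) (F : A ⊗[k] V) :
    evalAt V p (1 ⊗ₜ F) = bc p V F := applyAt_one_tmul _ p F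

theorem evalAt_bc (q : B →ₐ[k] R) (p : A →ₐ[k] R) (X : B ⊗[k] (A ⊗[k] V)) :
    evalAt V p (bc q (A ⊗[k] V) X) = bc (Algebra.TensorProduct.productMap q p) V
      ((TensorProduct.assoc k B A V).symm X) := by
  induction X with
  | zero => simp
  | add x y hx hy => simp only [map_add, hx, hy]
  | tmul b F =>
    induction F with
    | zero => simp
    | add x y hx hy => simp only [tmul_add, map_add, hx, hy]
    | tmul a v => simp [evalAt, applyAt, smul_tmul']

/-- Functions with coefficients in `R` are determined by their values at points. -/
theorem ext_evalAt {x y : R ⊗[k] (A ⊗[k] V)}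
    (h : ∀ (R' : Type u) [CommRing R'] [Algebra k R'] (φ : R →ₐ[k] R') (p : A →ₐ[k] R'),
      evalAt V p (bc φ _ x) = evalAt V p (bc φ _ y)) : x = y := by
  -- The universal test case: the two inclusions into `R ⊗ A` evaluate a function with coefficients
  -- in `R` to itself.
  have := h (R ⊗[k] A) Algebra.TensorProduct.includeLeft Algebra.TensorProduct.includeRight
  have hid : Algebra.TensorProduct.productMap Algebra.TensorProduct.includeLeft
      Algebra.TensorProduct.includeRight = AlgHom.id k (R ⊗[k] A) := by ext <;> simp
  rw [evalAt_bc, evalAt_bc, hid, bc_id, bc_id] at this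
  exact (TensorProduct.assoc k R A V).symm.injective this

theorem ext_bc {x y : A ⊗[k] V}
    (h : ∀ (R : Type u) [CommRing R] [Algebra k R] (p : A →ₐ[k] R), bc p V x = bc p V y) :
    x = y := by
  simpa using h A (AlgHom.id k A)

theorem act_tmul {S : Type u} [AddCommGroup S] [Module k S]
    [Module A S] [IsScalarTower k A S] (r r' : R) (f : A) (s : S) :
    act R S (r ⊗ₜ[k] f) (r' ⊗ₜ s) = (r * r') ⊗ₜ (f • s) := by
  rfl

/-- The map `l` on `R ⊗ S` factors through the fibre of `S` at the `R`-point `x`. -/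
def IsAt {S M : Type u} [AddCommGroup S] [Module k S] [Module A S] [AddCommGroup M] [Module R M]
    (x : Pt k A R) (l : R ⊗[k] S →ₗ[R] M) : Prop :=
  ∀ (f : A) (s : S), l (1 ⊗ₜ (f • s)) = x.hom f • l (1 ⊗ₜ s)

/-- A map out of the fibre at `x` sees a function only through its value at `x`. This turns the
operator-valued factors ω(b, c, ·) of the axioms into scalars. -/
theorem IsAt.map_act {S M : Type u} [AddCommGroup S] [Module k S] [Module A S] [IsScalarTower k A S]
    [AddCommGroup M] [Module R' M] {x : Pt k A R'} {l : R' ⊗[k] S →ₗ[R'] M} (hl : IsAt x l)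
    (φ : R →ₐ[k] R') (u : R ⊗[k] A) (y : R ⊗[k] S) :
    l (bc φ S (act R S u y)) = Algebra.TensorProduct.productMap φ x.hom u • l (bc φ S y) := by
  induction u with
  | zero => simp
  | add u v hu hv => simp only [map_add, LinearMap.add_apply, hu, hv, add_smul]
  | tmul r f =>
    induction y with
    | zero => simp
    | add y z hy hz => simp only [map_add, hy, hz, smul_add]
    | tmul r' s =>
      have h1 : ∀ (a : R') (t : S), (a ⊗ₜ[k] t : R' ⊗[k] S) = a • (1 ⊗ₜ t) := fun a t => by
        simp [smul_tmul']
      rw [act_tmul, bc_tmul, bc_tmul, h1, h1 (φ r'), map_smul, map_smul, hl f s, map_mul,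
        Algebra.TensorProduct.productMap_apply_tmul, smul_smul, smul_smul]
      congr 1
      ring

theorem IsAt.map_act_self {S M : Type u} [AddCommGroup S] [Module k S] [Module A S]
    [IsScalarTower k A S] [AddCommGroup M] [Module R M] {x : Pt k A R} {l : R ⊗[k] S →ₗ[R] M}
    (hl : IsAt x l) (u : R ⊗[k] A) (y : R ⊗[k] S) :
    l (act R S u y) = Algebra.TensorProduct.productMap (AlgHom.id k R) x.hom u • l y := by
  simpa using hl.map_act (AlgHom.id k R) u y

theorem act_baseChange {S T : Type u} [AddCommGroup S] [Module k S] [Module A S]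
    [IsScalarTower k A S] [AddCommGroup T] [Module k T] [Module A T] [IsScalarTower k A T]
    {f : S →ₗ[k] T} (hf : ∀ (a : A) (s : S), f (a • s) = a • f s) (u : R ⊗[k] A)
    (y : R ⊗[k] S) : act R T u (f.baseChange R y) = f.baseChange R (act R S u y) := by
  induction u with
  | zero => simp
  | add u v hu hv => simp only [map_add, LinearMap.add_apply, hu, hv]
  | tmul r a =>
    induction y with
    | zero => simp
    | add y z hy hz => simp only [map_add, hy, hz]
    | tmul r' s => simp [act_tmul, hf]

end Naturality


/-! ### Equivariant structures on fibres -/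

section Fibres

variable {k OG OH OK : Type u} [Field k] [CommRing OG] [HopfAlgebra k OG]
  [CommRing OH] [HopfAlgebra k OH] [CommRing OK] [HopfAlgebra k OK]
  {D : Datum k OG OH OK} {R R' : Type u} [CommRing R] [Algebra k R] [CommRing R'] [Algebra k R']

theorem Datum.inH_map (φ : R →ₐ[k] R') (x : Pt k OH R) :
    (D.inH x).map φ = D.inH (x.map φ) := rfl

theorem Datum.inK_map (φ : R →ₐ[k] R') (x : Pt k OK R) :
    (D.inK x).map φ = D.inK (x.map φ) := rfl

theorem up_map {A B : Type u} [CommRing A] [Algebra k A] [CommRing B] [Algebra k B]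
    (b : Pt k B R) (x : Pt k A R) :
    (up A b).map (Algebra.TensorProduct.productMap (AlgHom.id k R) x.hom) = b := by
  ext a
  simp [up]

theorem gen_map {A : Type u} [CommRing A] [Algebra k A] (x : Pt k A R) :
    (gen R : Pt k A (R ⊗[k] A)).map
      (Algebra.TensorProduct.productMap (AlgHom.id k R) x.hom) = x := by
  ext a
  simp [gen]

theorem val_units_map (φ : R →ₐ[k] R') (u : Rˣ) :
    φ (u : R) = (Units.map (φ : R →* R') u : R'ˣ) := rfl

theorem comm_comp_comm_symm {A W : Type u} [CommRing A] [Algebra k A] [AddCommGroup W] [Module k W]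
    (δ : W →ₗ[k] A ⊗[k] W) :
    (TensorProduct.comm k W A).toLinearMap ∘ₗ
      ((TensorProduct.comm k W A).symm.toLinearMap ∘ₗ δ) = δ := by
  ext w
  simp

namespace BiSheaf

variable {S T : BiSheaf D} {M : Type u} [AddCommGroup M] [Module R M]

/-- The right coaction with the factors exchanged. -/
def rhoOp (S : BiSheaf D) : S.carrier →ₗ[k] OK ⊗[k] S.carrier :=
  (TensorProduct.comm k S.carrier OK).toLinearMap ∘ₗ S.rho

theorem rhoAt_eq (S : BiSheaf D) (c : Pt k OK R) : S.rhoAt c = applyAt S.rhoOp c.hom := rfl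

theorem bc_lamAt (φ : R →ₐ[k] R') (b : Pt k OH R) (y : R ⊗[k] S.carrier) :
    bc φ _ (S.lamAt b y) = S.lamAt (b.map φ) (bc φ _ y) := bc_applyAt φ S.lam b.hom y

theorem bc_rhoAt (φ : R →ₐ[k] R') (c : Pt k OK R) (y : R ⊗[k] S.carrier) :
    bc φ _ (S.rhoAt c y) = S.rhoAt (c.map φ) (bc φ _ y) := bc_applyAt φ S.rhoOp c.hom y

@[simp] theorem lamAt_one (y : R ⊗[k] S.carrier) : S.lamAt 1 y = y :=
  DFunLike.congr_fun (S.lam_one R) y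

@[simp] theorem rhoAt_one (y : R ⊗[k] S.carrier) : S.rhoAt 1 y = y :=
  DFunLike.congr_fun (S.rho_one R) y

variable {x : Pt k OG R} {l : R ⊗[k] S.carrier →ₗ[R] M}

/-- The operator of `b` goes from the fibre at `bx` to the fibre at `x`, so a map out of the latter
pulls back to a map out of the former. -/
theorem isAt_lamAt (hl : IsAt x l) (b : Pt k OH R) : IsAt (D.inH b * x) (l ∘ₗ S.lamAt b) := by
  intro f s
  have h := S.lam_smul R b f s
  rw [LinearMap.comp_apply, LinearMap.comp_apply]
  change l (opAt S.lam b.hom _) = _ • l (opAt S.lam b.hom _)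
  rw [h, hl.map_act_self]
  congr 1
  change ((D.inH (up OG b) * gen R).map
    (Algebra.TensorProduct.productMap (AlgHom.id k R) x.hom)).hom f = _
  rw [Pt.map_mul, gen_map, Datum.inH_map, up_map]

theorem isAt_rhoAt (hl : IsAt x l) (c : Pt k OK R) : IsAt (x * D.inK c) (l ∘ₗ S.rhoAt c) := by
  intro f s
  have h := S.rho_smul R c f s
  rw [LinearMap.comp_apply, LinearMap.comp_apply]
  change l (opAt S.rhoOp c.hom _) = _ • l (opAt S.rhoOp c.hom _)
  change opAt S.rhoOp c.hom _ = act _ _ _ (opAt S.rhoOp c.hom _) at h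
  rw [h, hl.map_act_self]
  congr 1
  change ((gen R * D.inK (up OG c)).map
    (Algebra.TensorProduct.productMap (AlgHom.id k R) x.hom)).hom f = _
  rw [Pt.map_mul, gen_map, Datum.inK_map, up_map]

/-- The multiplicativity axiom read on the fibre at `x`, where the universal point specialises to
`x` and ω becomes a unit of `R`. -/
theorem lamAt_mul (hl : IsAt x l) (b c : Pt k OH R) (y : R ⊗[k] S.carrier) :
    l (S.lamAt (b * c) y) =
      (ev₃ D.ω (D.inH b) (D.inH c) x * ev₂ D.ψ b c) • l (S.lamAt c (S.lamAt b y)) := by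
  have h := DFunLike.congr_fun (S.lam_mul R b c) y
  simp only [LinearMap.smul_apply, LinearMap.comp_apply] at h
  change S.lamAt (b * c) y = _ • act _ _ _ (S.lamAt c (S.lamAt b y)) at h
  rw [h, map_smul, hl.map_act_self, val_units_map, ev₃_map, gen_map, Datum.inH_map, Datum.inH_map,
    up_map, up_map, smul_smul, Units.smul_def, Units.val_mul, mul_comm]

theorem rhoAt_mul (hl : IsAt x l) (c d : Pt k OK R) (y : R ⊗[k] S.carrier) :
    l (S.rhoAt (c * d) y) =
      ((ev₃ D.ω x (D.inK c) (D.inK d))⁻¹ * ev₂ D.η c d) • l (S.rhoAt c (S.rhoAt d y)) := by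
  have h := DFunLike.congr_fun (S.rho_mul R c d) y
  simp only [LinearMap.smul_apply, LinearMap.comp_apply] at h
  change S.rhoAt (c * d) y = _ • act _ _ _ (S.rhoAt c (S.rhoAt d y)) at h
  rw [h, map_smul, hl.map_act_self, val_units_map, map_inv, ev₃_map, gen_map, Datum.inK_map,
    Datum.inK_map, up_map, up_map, smul_smul, Units.smul_def, Units.val_mul, mul_comm]

theorem lamAt_rhoAt (hl : IsAt x l) (b : Pt k OH R) (c : Pt k OK R) (y : R ⊗[k] S.carrier) :
    l (S.lamAt b (S.rhoAt c y)) =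
      ev₃ D.ω (D.inH b) x (D.inK c) • l (S.rhoAt c (S.lamAt b y)) := by
  have h := DFunLike.congr_fun (S.lam_rho R b c) y
  simp only [LinearMap.comp_apply] at h
  change S.lamAt b (S.rhoAt c y) = act _ _ _ (S.rhoAt c (S.lamAt b y)) at h
  rw [h, hl.map_act_self, val_units_map, ev₃_map, gen_map, Datum.inK_map, Datum.inH_map,
    up_map, up_map, Units.smul_def]

/-! ### Morphisms on points -/

theorem Hom.lin_mem {S T : BiSheaf D} (φ : S ⟶ T) : Hom.lin φ ∈ homs S T := φ.2

@[simp] theorem Hom.lin_comp {S T U : BiSheaf D} (φ : S ⟶ T) (χ : T ⟶ U) :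
    Hom.lin (φ ≫ χ) = Hom.lin χ ∘ₗ Hom.lin φ := rfl

theorem Hom.ext_lin {S T : BiSheaf D} {φ χ : S ⟶ T} (h : ∀ s, Hom.lin φ s = Hom.lin χ s) :
    φ = χ := Subtype.ext (LinearMap.ext h)

/-- The morphism given by an element of `homs`. -/
def Hom.ofLin {S T : BiSheaf D} (f : S.carrier →ₗ[k] T.carrier) (hf : f ∈ homs S T) : S ⟶ T :=
  ⟨f, hf⟩

theorem rhoOp_comp {f : S.carrier →ₗ[k] T.carrier} :
    T.rho ∘ₗ f = f.rTensor OK ∘ₗ S.rho ↔ T.rhoOp ∘ₗ f = f.lTensor OK ∘ₗ S.rhoOp := by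
  have h : f.lTensor OK ∘ₗ S.rhoOp =
      (TensorProduct.comm k T.carrier OK).toLinearMap ∘ₗ (f.rTensor OK ∘ₗ S.rho) := by
    rw [rhoOp, ← LinearMap.comp_assoc, ← LinearMap.comp_assoc]
    congr 1
    ext s a
    rfl
  rw [h, rhoOp, LinearMap.comp_assoc]
  constructor
  · intro e
    rw [e]
  · intro e
    ext s
    exact (TensorProduct.comm k T.carrier OK).injective (DFunLike.congr_fun e s)

theorem lamAt_baseChange {f : S.carrier →ₗ[k] T.carrier} (hf : f ∈ homs S T) (b : Pt k OH R)
    (y : R ⊗[k] S.carrier) :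
    T.lamAt b (f.baseChange R y) = f.baseChange R (S.lamAt b y) :=
  applyAt_baseChange hf.2.1 b.hom y

theorem rhoAt_baseChange {f : S.carrier →ₗ[k] T.carrier} (hf : f ∈ homs S T) (c : Pt k OK R)
    (y : R ⊗[k] S.carrier) :
    T.rhoAt c (f.baseChange R y) = f.baseChange R (S.rhoAt c y) :=
  applyAt_baseChange (rhoOp_comp.1 hf.2.2) c.hom y

/-- A linear map is a morphism if it commutes with functions and with the operators of all
points. -/
theorem mem_homs_of_points {f : S.carrier →ₗ[k] T.carrier}
    (hf : ∀ (a : OG) (s : S.carrier), f (a • s) = a • f s)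
    (hlam : ∀ (R : Type u) [CommRing R] [Algebra k R] (b : Pt k OH R) (s : S.carrier),
      T.lamAt b (1 ⊗ₜ f s) = f.baseChange R (S.lamAt b (1 ⊗ₜ s)))
    (hrho : ∀ (R : Type u) [CommRing R] [Algebra k R] (c : Pt k OK R) (s : S.carrier),
      T.rhoAt c (1 ⊗ₜ f s) = f.baseChange R (S.rhoAt c (1 ⊗ₜ s))) : f ∈ homs S T :=
  ⟨hf, lTensor_comp_of_applyAt fun s => hlam OH (Pt.mk (AlgHom.id k OH)) s,
    rhoOp_comp.2 (lTensor_comp_of_applyAt fun s => hrho OK (Pt.mk (AlgHom.id k OK)) s)⟩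

end BiSheaf

end Fibres


/-! ### Sheaves of functions on the product of the two subgroups -/

section Coinduction

variable {k OG OH OK : Type u} [Field k] [CommRing OG] [HopfAlgebra k OG]
  [CommRing OH] [HopfAlgebra k OH] [CommRing OK] [HopfAlgebra k OK]
  {R R' : Type u} [CommRing R] [Algebra k R] [CommRing R'] [Algebra k R']

/-- The point of `H × K` with given components. -/
def pt (h : Pt k OH R) (c : Pt k OK R) : OH ⊗[k] OK →ₐ[k] R :=
  Algebra.TensorProduct.productMap h.hom c.hom

theorem comp_pt (φ : R →ₐ[k] R') (h : Pt k OH R) (c : Pt k OK R) :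
    φ.comp (pt h c) = pt (h.map φ) (c.map φ) := by
  unfold pt
  ext <;> simp

theorem exists_eq_pt (p : OH ⊗[k] OK →ₐ[k] R) :
    ∃ (h : Pt k OH R) (c : Pt k OK R), p = pt h c :=
  ⟨Pt.mk (p.comp Algebra.TensorProduct.includeLeft),
    Pt.mk (p.comp Algebra.TensorProduct.includeRight), by
      apply Algebra.TensorProduct.ext'
      intro a b
      simp [pt, ← map_mul]⟩

theorem up_map_productMap {A B : Type u} [CommRing A] [Algebra k A] [CommRing B] [Algebra k B]
    (φ : R →ₐ[k] R') (b : Pt k B R) (x : Pt k A R') :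
    (up A b).map (Algebra.TensorProduct.productMap φ x.hom) = b.map φ := by
  ext a
  simp [up]

theorem gen_map_productMap {A : Type u} [CommRing A] [Algebra k A] (φ : R →ₐ[k] R')
    (x : Pt k A R') :
    (gen R : Pt k A (R ⊗[k] A)).map (Algebra.TensorProduct.productMap φ x.hom) = x := by
  ext a
  simp [gen]

variable (D : Datum k OG OH OK) (g : Pt k OG k)

namespace Datum

theorem orbitPt_map (φ : R →ₐ[k] R') (h : Pt k OH R) (c : Pt k OK R) :
    (D.orbitPt g h c).map φ = D.orbitPt g (h.map φ) (c.map φ) := by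
  simp only [orbitPt, Pt.map_mul, Pt.map_inv, Pt.const_map, inH_map, inK_map]

theorem orbitPt_mul_inv (h b : Pt k OH R) (c : Pt k OK R) :
    D.orbitPt g (h * b⁻¹) c = D.inH b * D.orbitPt g h c := by
  simp only [orbitPt, map_mul, map_inv]
  group

theorem orbitPt_mul (h : Pt k OH R) (c d : Pt k OK R) :
    D.orbitPt g h (c * d) = D.orbitPt g h c * D.inK d := by
  simp only [orbitPt, map_mul]
  group

theorem orbitPt_one_one : D.orbitPt g (1 : Pt k OH R) (1 : Pt k OK R) = g.const R := by
  simp [orbitPt]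

theorem pt_orbitMap (h : Pt k OH R) (c : Pt k OK R) (f : OG) :
    pt h c (D.orbitMap g f) = (D.orbitPt g h c).hom f := by
  have e : (Pt.mk (D.orbitMap g)).map (pt h c) = D.orbitPt g h c := by
    change (D.orbitPt g (Pt.mk Algebra.TensorProduct.includeLeft)
      (Pt.mk Algebra.TensorProduct.includeRight)).map (pt h c) = _
    rw [orbitPt_map]
    congr 1 <;> ext <;> simp [pt]
  rw [← e]
  rfl

/-- The factor of the left action on functions on `H × K`. -/
def lamFactor (b h : Pt k OH R) (c : Pt k OK R) : Rˣ :=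
  (ev₃ D.ω (D.inH (h * b⁻¹)) (D.inH b) (D.orbitPt g h c) * ev₂ D.ψ (h * b⁻¹) b)⁻¹

/-- The factor of the right action on functions on `H × K`. -/
def rhoFactor (d : Pt k OK R) (h : Pt k OH R) (c : Pt k OK R) : Rˣ :=
  ev₃ D.ω (g.const R) (D.inK c) (D.inK d) *
    (ev₃ D.ω (D.inH h) (D.orbitPt g h c) (D.inK d) * ev₂ D.η c d)⁻¹

theorem lamFactor_map (φ : R →ₐ[k] R') (b h : Pt k OH R) (c : Pt k OK R) :
    Units.map (φ : R →* R') (D.lamFactor g b h c) =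
      D.lamFactor g (b.map φ) (h.map φ) (c.map φ) := by
  simp only [lamFactor, map_mul, map_inv, ev₂_map, ev₃_map, orbitPt_map, inH_map, Pt.map_mul,
    Pt.map_inv]

theorem rhoFactor_map (φ : R →ₐ[k] R') (d : Pt k OK R) (h : Pt k OH R) (c : Pt k OK R) :
    Units.map (φ : R →* R') (D.rhoFactor g d h c) =
      D.rhoFactor g (d.map φ) (h.map φ) (c.map φ) := by
  simp only [rhoFactor, map_mul, map_inv, ev₂_map, ev₃_map, orbitPt_map, inH_map, inK_map,
    Pt.const_map]

theorem inH_mul_orbitPt (h : Pt k OH R) (c : Pt k OK R) :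
    D.inH h * D.orbitPt g h c = g.const R * D.inK c := by
  simp only [orbitPt]
  group

theorem lamFactor_one (h : Pt k OH R) (c : Pt k OK R) : D.lamFactor g 1 h c = 1 := by
  simp [lamFactor, (D.ω_norm _ _ _).2.1, (D.ψ_norm _ _).2]

theorem rhoFactor_one (h : Pt k OH R) (c : Pt k OK R) : D.rhoFactor g 1 h c = 1 := by
  simp [rhoFactor, (D.ω_norm _ _ _).2.2, (D.η_norm _ _).2]

/-- With h = abc, this is the cocycle equation of ω at (a, b, c, h⁻¹ge) combined with dψ = ω at (a,
b, c). -/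
theorem lamFactor_mul (b c h : Pt k OH R) (e : Pt k OK R) :
    D.lamFactor g (b * c) h e =
      ev₃ D.ω (D.inH b) (D.inH c) (D.orbitPt g h e) * ev₂ D.ψ b c *
        (D.lamFactor g c h e * D.lamFactor g b (h * c⁻¹) e) := by
  obtain ⟨a, rfl⟩ : ∃ a, h = a * b * c := ⟨h * c⁻¹ * b⁻¹, by group⟩
  have e1 : a * b * c * (b * c)⁻¹ = a := by group
  have e2 : D.orbitPt g (a * b) e = D.inH c * D.orbitPt g (a * b * c) e := by
    rw [← orbitPt_mul_inv, mul_inv_cancel_right]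
  simp only [lamFactor, e1, mul_inv_cancel_right, e2]
  have h1 := D.ω_cocycle R (D.inH a) (D.inH b) (D.inH c) (D.orbitPt g (a * b * c) e)
  have h2 := D.ψ_coboundary R a b c
  change _ = ev₃ D.ω (D.inH a) (D.inH b) (D.inH c) * _ at h2
  simp only [map_mul] at h1 h2 ⊢
  -- Written additively, the identity between units is an integral linear combination of the cocycle
  -- equations.
  apply Additive.ofMul.injective
  apply_fun Additive.ofMul at h1 h2
  simp only [ofMul_mul, ofMul_inv] at h1 h2 ⊢
  linear_combination (norm := module) h1 - h2

/-- Two instances of the cocycle equation, at (g, e, c, d) and at (h, h⁻¹ge, c, d), are linked by h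
· h⁻¹ge = ge; the remaining term is dη = ω at (e, c, d). -/
theorem rhoFactor_mul (c d : Pt k OK R) (h : Pt k OH R) (e : Pt k OK R) :
    D.rhoFactor g (c * d) h e =
      (ev₃ D.ω (D.orbitPt g h e) (D.inK c) (D.inK d))⁻¹ * ev₂ D.η c d *
        (D.rhoFactor g c h e * D.rhoFactor g d h (e * c)) := by
  simp only [rhoFactor, orbitPt_mul]
  have h1 := D.ω_cocycle R (g.const R) (D.inK e) (D.inK c) (D.inK d)
  have h2 := D.ω_cocycle R (D.inH h) (D.orbitPt g h e) (D.inK c) (D.inK d)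
  have h3 := D.η_coboundary R e c d
  change _ = ev₃ D.ω (D.inK e) (D.inK c) (D.inK d) * _ at h3
  rw [inH_mul_orbitPt] at h2
  simp only [map_mul] at h1 h2 h3 ⊢
  apply Additive.ofMul.injective
  apply_fun Additive.ofMul at h1 h2 h3
  simp only [ofMul_mul, ofMul_inv] at h1 h2 h3 ⊢
  linear_combination (norm := module) h1 - h2 - h3

/-- With h = ab, this is the single cocycle equation at (a, b, h⁻¹ge, d); ψ and η cancel. -/
theorem lamFactor_mul_rhoFactor (b h : Pt k OH R) (d e : Pt k OK R) :
    D.lamFactor g b h e * D.rhoFactor g d (h * b⁻¹) e =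
      ev₃ D.ω (D.inH b) (D.orbitPt g h e) (D.inK d) *
        (D.rhoFactor g d h e * D.lamFactor g b h (e * d)) := by
  obtain ⟨a, rfl⟩ : ∃ a, h = a * b := ⟨h * b⁻¹, by group⟩
  have e2 : D.orbitPt g a e = D.inH b * D.orbitPt g (a * b) e := by
    rw [← orbitPt_mul_inv, mul_inv_cancel_right]
  simp only [lamFactor, rhoFactor, orbitPt_mul, mul_inv_cancel_right, e2]
  have h1 := D.ω_cocycle R (D.inH a) (D.inH b) (D.orbitPt g (a * b) e) (D.inK d)
  simp only [map_mul] at h1 ⊢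
  apply Additive.ofMul.injective
  apply_fun Additive.ofMul at h1
  simp only [ofMul_mul, ofMul_inv] at h1 ⊢
  linear_combination (norm := module) h1

end Datum

/-! ### Coactions given by a change of variables and a multiplier -/

section Twist

variable {A B : Type u} [CommRing A] [Algebra k A] [CommRing B] [Algebra k B]
  {V : Type u} [AddCommGroup V] [Module k V]

/-- The coaction `F ↦ u • (F ∘ p)` on vector valued functions. -/
def twist (p : A →ₐ[k] B ⊗[k] A) (w : B ⊗[k] A) (V : Type u) [AddCommGroup V] [Module k V] :
    A ⊗[k] V →ₗ[k] B ⊗[k] (A ⊗[k] V) :=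
  (TensorProduct.assoc k B A V).toLinearMap ∘ₗ
    (Algebra.lsmul k k ((B ⊗[k] A) ⊗[k] V) w) ∘ₗ bc p V

theorem evalAt_twist (p : A →ₐ[k] B ⊗[k] A) (w : B ⊗[k] A) (b : B →ₐ[k] R) (q : A →ₐ[k] R)
    (x : R ⊗[k] (A ⊗[k] V)) :
    evalAt V q (applyAt (twist p w V) b x) =
      Algebra.TensorProduct.productMap b q w •
        evalAt V ((Algebra.TensorProduct.productMap b q).comp p) x := by
  suffices evalAt V q ∘ₗ applyAt (twist p w V) b = Algebra.TensorProduct.productMap b q w •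
      evalAt V ((Algebra.TensorProduct.productMap b q).comp p) from DFunLike.congr_fun this x
  refine ext_one_tmul fun F => ?_
  rw [LinearMap.comp_apply, LinearMap.smul_apply, applyAt_one_tmul, evalAt_bc, evalAt_one_tmul,
    ← bc_bc, ← bc_smul]
  congr 1
  exact (TensorProduct.assoc k B A V).symm_apply_apply _

end Twist

namespace Coind

variable (V : Type u) [AddCommGroup V] [Module k V]

/-- The space of functions on `H × K` with values in `V`, regarded as a sheaf on `G` along the
orbit map of `g`. -/
def Carrier (_ : Datum k OG OH OK) (_ : Pt k OG k) (V : Type u) [AddCommGroup V] [Module k V] :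
    Type u := (OH ⊗[k] OK) ⊗[k] V

instance : AddCommGroup (Carrier D g V) := inferInstanceAs (AddCommGroup ((OH ⊗[k] OK) ⊗[k] V))
instance : Module k (Carrier D g V) := inferInstanceAs (Module k ((OH ⊗[k] OK) ⊗[k] V))
instance : Module (OH ⊗[k] OK) (Carrier D g V) :=
  inferInstanceAs (Module (OH ⊗[k] OK) ((OH ⊗[k] OK) ⊗[k] V))
instance : IsScalarTower k (OH ⊗[k] OK) (Carrier D g V) :=
  inferInstanceAs (IsScalarTower k (OH ⊗[k] OK) ((OH ⊗[k] OK) ⊗[k] V))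
instance : Module OG (Carrier D g V) := Module.compHom _ (D.orbitMap g).toRingHom

instance [FiniteDimensional k OH] [FiniteDimensional k OK] [FiniteDimensional k V] :
    FiniteDimensional k (Carrier D g V) :=
  inferInstanceAs (FiniteDimensional k ((OH ⊗[k] OK) ⊗[k] V))

theorem smul_eq (f : OG) (F : Carrier D g V) : f • F = D.orbitMap g f • F := rfl

instance : IsScalarTower k OG (Carrier D g V) where
  smul_assoc a f F := by rw [smul_eq, smul_eq, map_smul, smul_assoc]

/-- Evaluation at a point of `H × K`. -/
def ev {D : Datum k OG OH OK} {g : Pt k OG k} {V : Type u} [AddCommGroup V] [Module k V]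
    (h : Pt k OH R) (c : Pt k OK R) :
    R ⊗[k] Carrier D g V →ₗ[R] R ⊗[k] V := evalAt V (pt h c)

variable {D g V}

theorem ev_one_tmul (h : Pt k OH R) (c : Pt k OK R) (F : Carrier D g V) :
    ev h c (1 ⊗ₜ F) = bc (pt h c) V F := evalAt_one_tmul _ _

theorem ext_ev {x y : R ⊗[k] Carrier D g V}
    (h : ∀ (R' : Type u) [CommRing R'] [Algebra k R'] (φ : R →ₐ[k] R') (h : Pt k OH R')
      (c : Pt k OK R'), ev h c (bc φ _ x) = ev h c (bc φ _ y)) : x = y := by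
  refine ext_evalAt fun R' _ _ φ p => ?_
  obtain ⟨a, c, rfl⟩ := exists_eq_pt p
  exact h R' φ a c

theorem isAt_ev (h : Pt k OH R) (c : Pt k OK R) :
    IsAt (D.orbitPt g h c) (ev h c : R ⊗[k] Carrier D g V →ₗ[R] R ⊗[k] V) := by
  intro f F
  rw [ev_one_tmul, ev_one_tmul, smul_eq, ← D.pt_orbitMap]
  exact bc_smul (pt h c) _ F

/-- The left coaction on functions on `H × K`. -/
def lam (D : Datum k OG OH OK) (g : Pt k OG k) (V : Type u) [AddCommGroup V] [Module k V] :
    Carrier D g V →ₗ[k] OH ⊗[k] Carrier D g V :=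
  let b : Pt k OH (OH ⊗[k] (OH ⊗[k] OK)) := Pt.mk Algebra.TensorProduct.includeLeft
  let h : Pt k OH (OH ⊗[k] (OH ⊗[k] OK)) := Pt.mk
    (Algebra.TensorProduct.includeRight.comp Algebra.TensorProduct.includeLeft)
  let c : Pt k OK (OH ⊗[k] (OH ⊗[k] OK)) := Pt.mk
    (Algebra.TensorProduct.includeRight.comp Algebra.TensorProduct.includeRight)
  twist (pt (h * b⁻¹) c) (D.lamFactor g b h c : OH ⊗[k] (OH ⊗[k] OK)) V

/-- The right coaction on functions on `H × K`. -/
def rho (D : Datum k OG OH OK) (g : Pt k OG k) (V : Type u) [AddCommGroup V] [Module k V] :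
    Carrier D g V →ₗ[k] OK ⊗[k] Carrier D g V :=
  let d : Pt k OK (OK ⊗[k] (OH ⊗[k] OK)) := Pt.mk Algebra.TensorProduct.includeLeft
  let h : Pt k OH (OK ⊗[k] (OH ⊗[k] OK)) := Pt.mk
    (Algebra.TensorProduct.includeRight.comp Algebra.TensorProduct.includeLeft)
  let c : Pt k OK (OK ⊗[k] (OH ⊗[k] OK)) := Pt.mk
    (Algebra.TensorProduct.includeRight.comp Algebra.TensorProduct.includeRight)
  twist (pt h (c * d)) (D.rhoFactor g d h c : OK ⊗[k] (OH ⊗[k] OK)) V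

/-- The coaction is defined by its multiplier at the universal triple (b, h, c); naturality of the
multiplier gives the formula at every triple. -/
theorem ev_lam (b h : Pt k OH R) (c : Pt k OK R) (x : R ⊗[k] Carrier D g V) :
    ev h c (applyAt (lam D g V) b.hom x) = D.lamFactor g b h c • ev (h * b⁻¹) c x := by
  refine (evalAt_twist _ _ b.hom (pt h c) x).trans ?_
  rw [comp_pt, val_units_map, Datum.lamFactor_map, Pt.map_mul, Pt.map_inv, Units.smul_def]
  congr <;> ext <;> simp [pt]

theorem ev_rho (d : Pt k OK R) (h : Pt k OH R) (c : Pt k OK R) (x : R ⊗[k] Carrier D g V) :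
    ev h c (applyAt (rho D g V) d.hom x) = D.rhoFactor g d h c • ev h (c * d) x := by
  refine (evalAt_twist _ _ d.hom (pt h c) x).trans ?_
  rw [comp_pt, val_units_map, Datum.rhoFactor_map, Pt.map_mul, Units.smul_def]
  congr <;> ext <;> simp [pt]

end Coind

end Coinduction


/-! ### The sheaf axioms for functions on H × K -/

section Coinduction

variable {k OG OH OK : Type u} [Field k] [CommRing OG] [HopfAlgebra k OG]
  [CommRing OH] [HopfAlgebra k OH] [CommRing OK] [HopfAlgebra k OK]
  {R R' : Type u} [CommRing R] [Algebra k R] [CommRing R'] [Algebra k R']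

namespace Coind

variable {D : Datum k OG OH OK} {g : Pt k OG k} {V : Type u} [AddCommGroup V] [Module k V]

theorem ev_act (φ : R →ₐ[k] R') (h : Pt k OH R') (c : Pt k OK R') (w : R ⊗[k] OG)
    (y : R ⊗[k] Carrier D g V) :
    ev h c (bc φ _ (act R _ w y)) =
      Algebra.TensorProduct.productMap φ (D.orbitPt g h c).hom w • ev h c (bc φ _ y) :=
  (isAt_ev h c).map_act φ w y

/-- Evaluated at (h, c), both sides see `f` at the point b h⁻¹gc = (hb⁻¹)⁻¹gc. -/
theorem one_tmul_smul_lam (b : Pt k OH R) (f : OG) (s : Carrier D g V) :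
    applyAt (lam D g V) b.hom (1 ⊗ₜ (f • s)) =
      act R _ ((D.inH (up OG b) * gen R).hom f) (applyAt (lam D g V) b.hom (1 ⊗ₜ s)) := by
  refine ext_ev fun R' _ _ φ h c => ?_
  have e : Algebra.TensorProduct.productMap φ (D.orbitPt g h c).hom
      ((D.inH (up OG b) * gen R).hom f) = (D.orbitPt g (h * (b.map φ)⁻¹) c).hom f := by
    change ((D.inH (up OG b) * gen R).map
      (Algebra.TensorProduct.productMap φ (D.orbitPt g h c).hom)).hom f = _
    rw [Pt.map_mul, gen_map_productMap, Datum.inH_map, up_map_productMap, D.orbitPt_mul_inv]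
  rw [ev_act, e, bc_applyAt, bc_applyAt, ← Pt.hom_map, ev_lam, ev_lam, bc_tmul, bc_tmul, map_one,
    isAt_ev, smul_comm]

theorem one_tmul_smul_rho (d : Pt k OK R) (f : OG) (s : Carrier D g V) :
    applyAt (rho D g V) d.hom (1 ⊗ₜ (f • s)) =
      act R _ ((gen R * D.inK (up OG d)).hom f) (applyAt (rho D g V) d.hom (1 ⊗ₜ s)) := by
  refine ext_ev fun R' _ _ φ h c => ?_
  have e : Algebra.TensorProduct.productMap φ (D.orbitPt g h c).hom
      ((gen R * D.inK (up OG d)).hom f) = (D.orbitPt g h (c * d.map φ)).hom f := by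
    change ((gen R * D.inK (up OG d)).map
      (Algebra.TensorProduct.productMap φ (D.orbitPt g h c).hom)).hom f = _
    rw [Pt.map_mul, gen_map_productMap, Datum.inK_map, up_map_productMap, D.orbitPt_mul]
  rw [ev_act, e, bc_applyAt, bc_applyAt, ← Pt.hom_map, ev_rho, ev_rho, bc_tmul, bc_tmul, map_one,
    isAt_ev, smul_comm]

theorem lam_mul (b c : Pt k OH R) (y : R ⊗[k] Carrier D g V) :
    applyAt (lam D g V) (b * c).hom y =
      (ev₂ D.ψ b c : R) • act R _
        (ev₃ D.ω (D.inH (up OG b)) (D.inH (up OG c)) (gen R) : R ⊗[k] OG)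
        (applyAt (lam D g V) c.hom (applyAt (lam D g V) b.hom y)) := by
  refine ext_ev fun R' _ _ φ h e => ?_
  rw [bc_smul, map_smul, ev_act, val_units_map, val_units_map, ev₃_map, ev₂_map,
    gen_map_productMap, Datum.inH_map, Datum.inH_map, up_map_productMap, up_map_productMap]
  simp only [bc_applyAt]
  rw [← Pt.hom_map, ← Pt.hom_map, ← Pt.hom_map, ev_lam, ev_lam, ev_lam, Pt.map_mul,
    Datum.lamFactor_mul, ← Units.smul_def, ← Units.smul_def, smul_smul, smul_smul, smul_smul,
    mul_inv_rev, mul_assoc h]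
  congr 1
  rw [mul_comm (ev₂ _ _ _)]
  simp only [mul_assoc]

theorem rho_mul (c d : Pt k OK R) (y : R ⊗[k] Carrier D g V) :
    applyAt (rho D g V) (c * d).hom y =
      (ev₂ D.η c d : R) • act R _
        (((ev₃ D.ω (gen R) (D.inK (up OG c)) (D.inK (up OG d)))⁻¹ : (R ⊗[k] OG)ˣ) : R ⊗[k] OG)
        (applyAt (rho D g V) c.hom (applyAt (rho D g V) d.hom y)) := by
  refine ext_ev fun R' _ _ φ h e => ?_
  rw [bc_smul, map_smul, ev_act, val_units_map, val_units_map, map_inv, ev₃_map, ev₂_map,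
    gen_map_productMap, Datum.inK_map, Datum.inK_map, up_map_productMap, up_map_productMap]
  simp only [bc_applyAt]
  rw [← Pt.hom_map, ← Pt.hom_map, ← Pt.hom_map, ev_rho, ev_rho, ev_rho, Pt.map_mul,
    Datum.rhoFactor_mul, ← Units.smul_def, ← Units.smul_def, smul_smul, smul_smul, smul_smul,
    mul_assoc e]
  congr 1
  rw [mul_comm (ev₂ _ _ _)]
  simp only [mul_assoc]

theorem lam_rho (b : Pt k OH R) (d : Pt k OK R) (y : R ⊗[k] Carrier D g V) :
    applyAt (lam D g V) b.hom (applyAt (rho D g V) d.hom y) =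
      act R _ (ev₃ D.ω (D.inH (up OG b)) (gen R) (D.inK (up OG d)) : R ⊗[k] OG)
        (applyAt (rho D g V) d.hom (applyAt (lam D g V) b.hom y)) := by
  refine ext_ev fun R' _ _ φ h e => ?_
  rw [ev_act, val_units_map, ev₃_map, gen_map_productMap, Datum.inK_map, Datum.inH_map,
    up_map_productMap, up_map_productMap]
  simp only [bc_applyAt]
  rw [← Pt.hom_map, ← Pt.hom_map, ev_rho, ev_lam, ev_lam, ev_rho, ← Units.smul_def,
    smul_smul, smul_smul, smul_smul, Datum.lamFactor_mul_rhoFactor, mul_assoc]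

theorem lam_one : applyAt (lam D g V) (1 : Pt k OH R).hom = LinearMap.id := by
  refine LinearMap.ext fun y => ext_ev fun R' _ _ φ h c => ?_
  rw [bc_applyAt, ← Pt.hom_map, Pt.map_one, ev_lam, Datum.lamFactor_one, one_smul, inv_one, mul_one]
  rfl

theorem rho_one : applyAt (rho D g V) (1 : Pt k OK R).hom = LinearMap.id := by
  refine LinearMap.ext fun y => ext_ev fun R' _ _ φ h c => ?_
  rw [bc_applyAt, ← Pt.hom_map, Pt.map_one, ev_rho, Datum.rhoFactor_one, one_smul, mul_one]
  rfl

end Coind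

variable [FiniteDimensional k OH] [FiniteDimensional k OK]

/-- The biequivariant sheaf of functions on `H × K` with values in `V`. -/
def Coind (D : Datum k OG OH OK) (g : Pt k OG k) (V : Type u) [AddCommGroup V] [Module k V]
    [FiniteDimensional k V] : BiSheaf D where
  carrier := Coind.Carrier D g V
  lam := Coind.lam D g V
  rho := (TensorProduct.comm k (Coind.Carrier D g V) OK).symm.toLinearMap ∘ₗ Coind.rho D g V
  lam_smul R _ _ b f s := Coind.one_tmul_smul_lam b f s
  rho_smul R _ _ c f s := by
    rw [comm_comp_comm_symm]
    exact Coind.one_tmul_smul_rho c f s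
  lam_one R _ _ := Coind.lam_one
  rho_one R _ _ := by
    rw [comm_comp_comm_symm]
    exact Coind.rho_one
  lam_mul R _ _ b c := LinearMap.ext fun y => Coind.lam_mul b c y
  rho_mul R _ _ c d := by
    rw [comm_comp_comm_symm]
    exact LinearMap.ext fun y => Coind.rho_mul c d y
  lam_rho R _ _ b d := by
    rw [comm_comp_comm_symm]
    exact LinearMap.ext fun y => Coind.lam_rho b d y

namespace Coind

variable {D : Datum k OG OH OK} {g : Pt k OG k} {V : Type u} [AddCommGroup V] [Module k V]
  [FiniteDimensional k V]

/-- A section of the coinduced sheaf as a function on `H × K`. -/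
def fn : (Coind D g V).carrier ≃ₗ[k] (OH ⊗[k] OK) ⊗[k] V :=
  LinearEquiv.refl k ((OH ⊗[k] OK) ⊗[k] V)

theorem fn_smul (f : OG) (F : (Coind D g V).carrier) : fn (f • F) = D.orbitMap g f • fn F := rfl

/-- The value of a section of the coinduced sheaf at a point of `H × K`. -/
def val (h : Pt k OH R) (c : Pt k OK R) : R ⊗[k] (Coind D g V).carrier →ₗ[R] R ⊗[k] V :=
  ev (D := D) (g := g) h c

theorem val_one_tmul (h : Pt k OH R) (c : Pt k OK R) (F : (Coind D g V).carrier) :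
    val h c (1 ⊗ₜ F) = bc (pt h c) V (fn F) := ev_one_tmul h c F

theorem ext_val {x y : R ⊗[k] (Coind D g V).carrier}
    (h : ∀ (R' : Type u) [CommRing R'] [Algebra k R'] (φ : R →ₐ[k] R') (h : Pt k OH R')
      (c : Pt k OK R'), val h c (bc φ _ x) = val h c (bc φ _ y)) : x = y := ext_ev h

theorem ext_fn {F F' : (Coind D g V).carrier}
    (h : ∀ (R : Type u) [CommRing R] [Algebra k R] (h : Pt k OH R)
      (c : Pt k OK R), bc (pt h c) V (fn F) = bc (pt h c) V (fn F')) : F = F' := by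
  refine fn.injective (ext_bc fun R _ _ p => ?_)
  obtain ⟨a, c, rfl⟩ := exists_eq_pt p
  exact h R a c

theorem isAt_val (h : Pt k OH R) (c : Pt k OK R) :
    IsAt (D.orbitPt g h c) (val h c : R ⊗[k] (Coind D g V).carrier →ₗ[R] R ⊗[k] V) :=
  isAt_ev h c

theorem val_lamAt (b h : Pt k OH R) (c : Pt k OK R) (x : R ⊗[k] (Coind D g V).carrier) :
    val h c ((Coind D g V).lamAt b x) = D.lamFactor g b h c • val (h * b⁻¹) c x := ev_lam b h c x

theorem val_rhoAt (d : Pt k OK R) (h : Pt k OH R) (c : Pt k OK R)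
    (x : R ⊗[k] (Coind D g V).carrier) :
    val h c ((Coind D g V).rhoAt d x) = D.rhoFactor g d h c • val h (c * d) x := by
  rw [BiSheaf.rhoAt_eq]
  have : (Coind D g V).rhoOp = rho D g V := comm_comp_comm_symm _
  rw [this]
  exact ev_rho d h c x

end Coind

end Coinduction


/-! ### Frobenius reciprocity -/

section Frobenius

variable {k OG OH OK : Type u} [Field k] [CommRing OG] [HopfAlgebra k OG]
  [CommRing OH] [HopfAlgebra k OH] [CommRing OK] [HopfAlgebra k OK]
  {R R' : Type u} [CommRing R] [Algebra k R] [CommRing R'] [Algebra k R']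

namespace Datum

variable (D : Datum k OG OH OK) (g : Pt k OG k)

/-- The factor that compares the value at `(h, c)` with the value at `(1, 1)`. -/
def frobFactor (h : Pt k OH R) (c : Pt k OK R) : Rˣ :=
  ev₃ D.ω (D.inH h) (D.inH h)⁻¹ (g.const R * D.inK c) * ev₂ D.ψ h h⁻¹

theorem frobFactor_map (φ : R →ₐ[k] R') (h : Pt k OH R) (c : Pt k OK R) :
    Units.map (φ : R →* R') (D.frobFactor g h c) = D.frobFactor g (h.map φ) (c.map φ) := by
  simp only [frobFactor, map_mul, ev₂_map, ev₃_map, inH_map, inK_map, Pt.map_mul,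
    Pt.map_inv, Pt.const_map]

theorem frobFactor_one_one : D.frobFactor g (1 : Pt k OH R) (1 : Pt k OK R) = 1 := by
  simp [frobFactor, (D.ω_norm _ _ _).1, (D.ψ_norm _ _).1]

/-- With h = ab, this is the cocycle equation at (a, b, h⁻¹, gc) together with dψ = ω at (a, b,
h⁻¹). It is what makes `frob` commute with the left action. -/
theorem frobFactor_lam (b h : Pt k OH R) (c : Pt k OK R) :
    D.frobFactor g h c = D.lamFactor g b h c * D.frobFactor g (h * b⁻¹) c *
      (ev₃ D.ω (D.inH b) (D.inH h⁻¹) (g.const R * D.inK c) * ev₂ D.ψ b h⁻¹) := by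
  obtain ⟨a, rfl⟩ : ∃ a, h = a * b := ⟨h * b⁻¹, by group⟩
  have e1 : b * (a * b)⁻¹ = a⁻¹ := by group
  have h1 := D.ω_cocycle R (D.inH a) (D.inH b) (D.inH (a * b)⁻¹) (g.const R * D.inK c)
  have h2 := D.ψ_coboundary R a b (a * b)⁻¹
  change _ = ev₃ D.ω (D.inH a) (D.inH b) (D.inH (a * b)⁻¹) * _ at h2
  have e3 : D.inH (a * b)⁻¹ * (g.const R * D.inK c) = D.orbitPt g (a * b) c := by
    simp only [orbitPt, map_inv, mul_assoc]
  rw [← map_mul, ← map_mul, e1, e3] at h1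
  rw [e1] at h2
  simp only [frobFactor, lamFactor, mul_inv_cancel_right, ← map_inv]
  apply Additive.ofMul.injective
  apply_fun Additive.ofMul at h1 h2
  simp only [ofMul_mul, ofMul_inv] at h1 h2 ⊢
  linear_combination (norm := module) h1 - h2

/-- The cocycle equation at (h, h⁻¹, gc, d), where one term vanishes by normalization. It is what
makes `frob` commute with the right action. -/
theorem frobFactor_rho (h : Pt k OH R) (c d : Pt k OK R) :
    D.rhoFactor g d h c * D.frobFactor g h (c * d) *
      ((ev₃ D.ω (g.const R) (D.inK c) (D.inK d))⁻¹ * ev₂ D.η c d) =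
      D.frobFactor g h c * ev₃ D.ω (D.inH h⁻¹) (g.const R * D.inK c) (D.inK d) := by
  have h1 := D.ω_cocycle R (D.inH h) (D.inH h⁻¹) (g.const R * D.inK c) (D.inK d)
  have e3 : D.inH h⁻¹ * (g.const R * D.inK c) = D.orbitPt g h c := by
    simp only [orbitPt, map_inv, mul_assoc]
  rw [← map_mul, mul_inv_cancel, map_one, (D.ω_norm _ _ _).1, e3, mul_assoc, ← map_mul] at h1
  simp only [frobFactor, rhoFactor, ← map_inv]
  apply Additive.ofMul.injective
  apply_fun Additive.ofMul at h1
  simp only [ofMul_mul, ofMul_inv, ofMul_one] at h1 ⊢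
  linear_combination (norm := module) h1

variable {D g} in
theorem orbitPt_stab (l : D.stab g R) : D.orbitPt g (toH l) (toK l) = g.const R := by
  have hl : D.inH (toH l) = g.const R * D.inK (toK l) * (g.const R)⁻¹ := l.2
  rw [orbitPt, hl]
  group

/-- The origin of Θ: it compares the value at (lh, l'c) with the value at (l, l') after moving by
ρ_c λ_{h⁻¹}, just as `frobFactor` does for l = 1. The proof uses ω at (l, h, h⁻¹, gc) and ψ at (l,
h, h⁻¹). -/
theorem frobFactor_theta (l : D.stab g R) (h : Pt k OH R) (c : Pt k OK R) :
    D.frobFactor g h c * (D.rhoFactor g c (toH l) (toK l) *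
      D.lamFactor g h⁻¹ (toH l) (toK l * c)) = D.theta g l h c := by
  have h1 := D.ω_cocycle R (D.inH (toH l)) (D.inH h) (D.inH h⁻¹) (g.const R * D.inK c)
  have h2 := D.ψ_coboundary R (toH l) h h⁻¹
  change _ = ev₃ D.ω (D.inH (toH l)) (D.inH h) (D.inH h⁻¹) * _ at h2
  have e3 : D.inH h⁻¹ * (g.const R * D.inK c) = D.orbitPt g h c := by
    simp only [orbitPt, map_inv, mul_assoc]
  rw [e3, ← map_mul, ← map_mul, mul_inv_cancel, map_one, (D.ω_norm _ _ _).2.1] at h1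
  rw [mul_inv_cancel, (D.ψ_norm _ _).2] at h2
  simp only [frobFactor, rhoFactor, lamFactor, theta, orbitPt_mul, orbitPt_stab, inv_inv,
    ← map_inv]
  apply Additive.ofMul.injective
  apply_fun Additive.ofMul at h1 h2
  simp only [ofMul_mul, ofMul_inv, ofMul_one] at h1 h2 ⊢
  linear_combination (norm := module) h2 - h1

/-- Since m⁻¹ g m' = g, the only factor of Θ that involves the orbit point becomes ω(l, m, g). -/
theorem theta_stab (l m : D.stab g R) : D.theta g l (toH m) (toK m) = D.xi g l m := by
  rw [theta, xi, orbitPt_stab]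

/-- The multiplier of ρ_c λ_{h⁻¹} at the unit is inverse to `frobFactor`; this normalization lets
the value at (1, 1) recover the value at (h, c). -/
theorem lamFactor_inv_one (h : Pt k OH R) (c : Pt k OK R) :
    D.rhoFactor g c 1 1 * D.lamFactor g h⁻¹ 1 c = (D.frobFactor g h c)⁻¹ := by
  simp only [rhoFactor, lamFactor, frobFactor, map_one, one_mul, inv_inv, (D.ω_norm _ _ _).1,
    (D.ω_norm _ _ _).2.1, (D.η_norm _ _).1, map_inv, orbitPt, inv_one, mul_one]

end Datum

variable {D : Datum k OG OH OK} {g : Pt k OG k} {V : Type u} [AddCommGroup V] [Module k V]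

/-- The linear map `π` factors through the fibre at the `k`-point `g`. -/
def AtPoint {S : Type u} [AddCommGroup S] [Module k S] [Module OG S] (g : Pt k OG k)
    (π : S →ₗ[k] V) : Prop :=
  ∀ (f : OG) (s : S), π (f • s) = g.hom f • π s

theorem AtPoint.isAt {S : Type u} [AddCommGroup S] [Module k S] [Module OG S] {π : S →ₗ[k] V}
    (hπ : AtPoint g π) : IsAt (g.const R) (π.baseChange R) := by
  intro f s
  rw [LinearMap.baseChange_tmul, LinearMap.baseChange_tmul, hπ]
  change _ = algebraMap k R (g.hom f) • _
  rw [tmul_smul, algebraMap_smul]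

variable [FiniteDimensional k OH] [FiniteDimensional k OK] [FiniteDimensional k V]

/-- The function on `H × K` with values in `V` given by a vector `s` of a sheaf and a linear map
to `V`. -/
def frob (g : Pt k OG k) (S : BiSheaf D) (π : S.carrier →ₗ[k] V) :
    S.carrier →ₗ[k] (Coind D g V).carrier :=
  let h : Pt k OH (OH ⊗[k] OK) := Pt.mk Algebra.TensorProduct.includeLeft
  let c : Pt k OK (OH ⊗[k] OK) := Pt.mk Algebra.TensorProduct.includeRight
  Coind.fn.symm.toLinearMap ∘ₗ
    Algebra.lsmul k k ((OH ⊗[k] OK) ⊗[k] V) (D.frobFactor g h c : OH ⊗[k] OK) ∘ₗ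
      ((π.baseChange (OH ⊗[k] OK)) ∘ₗ S.rhoAt c ∘ₗ S.lamAt h⁻¹).restrictScalars k ∘ₗ
        TensorProduct.mk k (OH ⊗[k] OK) S.carrier 1

theorem bc_frob {S : BiSheaf D} (π : S.carrier →ₗ[k] V) (h : Pt k OH R) (c : Pt k OK R)
    (s : S.carrier) :
    bc (pt h c) V (Coind.fn (frob g S π s)) =
      D.frobFactor g h c • π.baseChange R (S.rhoAt c (S.lamAt h⁻¹ (1 ⊗ₜ s))) := by
  refine (bc_smul _ _ _).trans ?_
  rw [val_units_map, Datum.frobFactor_map]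
  change _ • bc _ _ (π.baseChange _ (S.rhoAt _ (S.lamAt _ (1 ⊗ₜ s)))) = _
  rw [bc_baseChange, BiSheaf.bc_rhoAt, BiSheaf.bc_lamAt, Pt.map_inv, bc_tmul, map_one,
    ← Units.smul_def]
  have e1 : (Pt.mk Algebra.TensorProduct.includeLeft : Pt k OH (OH ⊗[k] OK)).map (pt h c) = h := by
    ext
    simp [pt]
  have e2 : (Pt.mk Algebra.TensorProduct.includeRight : Pt k OK (OH ⊗[k] OK)).map (pt h c) = c := by
    ext
    simp [pt]
  rw [e1, e2]

theorem val_frob {S : BiSheaf D} (π : S.carrier →ₗ[k] V) (h : Pt k OH R) (c : Pt k OK R)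
    (y : R ⊗[k] S.carrier) :
    Coind.val h c ((frob g S π).baseChange R y) =
      D.frobFactor g h c • π.baseChange R (S.rhoAt c (S.lamAt h⁻¹ y)) := by
  suffices Coind.val h c ∘ₗ (frob g S π).baseChange R =
      D.frobFactor g h c • (π.baseChange R ∘ₗ S.rhoAt c ∘ₗ S.lamAt h⁻¹) from
    DFunLike.congr_fun this y
  refine ext_one_tmul fun s => ?_
  rw [LinearMap.comp_apply, LinearMap.baseChange_tmul, Coind.val_one_tmul, bc_frob]
  rfl

theorem val_frob_one {S : BiSheaf D} (π : S.carrier →ₗ[k] V) (h : Pt k OH R) (c : Pt k OK R)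
    (s : S.carrier) :
    Coind.val h c (1 ⊗ₜ frob g S π s) =
      D.frobFactor g h c • π.baseChange R (S.rhoAt c (S.lamAt h⁻¹ (1 ⊗ₜ s))) := by
  rw [← val_frob, LinearMap.baseChange_tmul]

/-- The map π ∘ ρ_c factors through the fibre at gc, so λ_{h⁻¹}λ_b merges into λ_{bh⁻¹} there. For
the right action λ_{h⁻¹} is first moved past ρ_d and then ρ_cρ_d merges at `g`. The resulting
scalars are absorbed by `frobFactor_lam` and `frobFactor_rho`. -/
theorem frob_mem_homs {S : BiSheaf D} {π : S.carrier →ₗ[k] V} (hπ : AtPoint g π) :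
    frob g S π ∈ BiSheaf.homs S (Coind D g V) := by
  refine BiSheaf.mem_homs_of_points (fun f s => ?_) (fun R _ _ b s => ?_) (fun R _ _ d s => ?_)
  · refine Coind.ext_fn fun R _ _ h c => ?_
    have e := (BiSheaf.isAt_lamAt (BiSheaf.isAt_rhoAt hπ.isAt c) h⁻¹) f s
    have e3 : D.inH h⁻¹ * (g.const R * D.inK c) = D.orbitPt g h c := by
      simp only [Datum.orbitPt, map_inv, mul_assoc]
    simp only [LinearMap.comp_apply, e3] at e
    rw [bc_frob, e, Coind.fn_smul]
    refine Eq.symm ((bc_smul (pt h c) (D.orbitMap g f) _).trans ?_)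
    rw [D.pt_orbitMap, bc_frob, smul_comm]
  · refine Coind.ext_val fun R' _ _ φ h c => ?_
    have e := BiSheaf.lamAt_mul (BiSheaf.isAt_rhoAt hπ.isAt c) (b.map φ) h⁻¹ (1 ⊗ₜ s)
    simp only [LinearMap.comp_apply] at e
    rw [bc_baseChange, val_frob, BiSheaf.bc_lamAt, BiSheaf.bc_lamAt, Coind.val_lamAt, bc_tmul,
      bc_tmul, map_one, D.frobFactor_lam g (b.map φ), mul_smul, ← e, val_frob_one, smul_smul,
      mul_inv_rev, inv_inv]
  · refine Coind.ext_val fun R' _ _ φ h c => ?_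
    have e := BiSheaf.lamAt_rhoAt (BiSheaf.isAt_rhoAt hπ.isAt c) h⁻¹ (d.map φ) (1 ⊗ₜ s)
    have e' := BiSheaf.rhoAt_mul hπ.isAt c (d.map φ) (S.lamAt h⁻¹ (1 ⊗ₜ s))
    simp only [LinearMap.comp_apply] at e
    rw [bc_baseChange, val_frob, BiSheaf.bc_rhoAt, BiSheaf.bc_rhoAt, Coind.val_rhoAt, bc_tmul,
      bc_tmul, map_one, e, smul_smul, ← D.frobFactor_rho, val_frob_one, e', smul_smul, smul_smul]

namespace Coind

/-- The value at the unit of `H × K`. -/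
def evOne (D : Datum k OG OH OK) (g : Pt k OG k) (V : Type u) [AddCommGroup V] [Module k V]
    [FiniteDimensional k V] : (Coind D g V).carrier →ₗ[k] V :=
  (TensorProduct.lid k V).toLinearMap ∘ₗ bc (pt 1 1) V ∘ₗ fn.toLinearMap

theorem evOne_baseChange (y : R ⊗[k] (Coind D g V).carrier) :
    (evOne D g V).baseChange R y = val 1 1 y := by
  suffices (evOne D g V).baseChange R = val 1 1 from DFunLike.congr_fun this y
  refine ext_one_tmul fun F => ?_
  have h : (pt 1 1 : OH ⊗[k] OK →ₐ[k] R) = (Algebra.ofId k R).comp (pt 1 1) := by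
    rw [comp_pt, Pt.map_one, Pt.map_one]
  rw [val_one_tmul, LinearMap.baseChange_tmul, h, ← bc_bc, ← one_tmul_lid]
  rfl

theorem evOne_atPoint : AtPoint g (evOne D g V) := by
  intro f F
  have h := isAt_val (R := k) (D := D) (g := g) (V := V) 1 1 f F
  rw [val_one_tmul, val_one_tmul, Datum.orbitPt_one_one, Pt.const_self] at h
  change TensorProduct.lid k V _ = _ • TensorProduct.lid k V _
  rw [← map_smul]
  exact congrArg _ h

/-- The value at `(h, c)` in terms of the value at `(1, 1)`. -/
theorem val_eq (h : Pt k OH R) (c : Pt k OK R) (y : R ⊗[k] (Coind D g V).carrier) :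
    val h c y = D.frobFactor g h c •
      val 1 1 ((Coind D g V).rhoAt c ((Coind D g V).lamAt h⁻¹ y)) := by
  rw [val_rhoAt, val_lamAt, smul_smul, smul_smul, one_mul, one_mul, inv_inv, mul_assoc,
    Datum.lamFactor_inv_one, mul_inv_cancel, one_smul]

theorem val_stab (l : D.stab g R) (h : Pt k OH R) (c : Pt k OK R)
    (y : R ⊗[k] (Coind D g V).carrier) :
    D.frobFactor g h c • val (Datum.toH l) (Datum.toK l)
      ((Coind D g V).rhoAt c ((Coind D g V).lamAt h⁻¹ y)) =
      D.theta g l h c • val (Datum.toH l * h) (Datum.toK l * c) y := by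
  rw [val_rhoAt, val_lamAt, smul_smul, smul_smul, inv_inv, mul_assoc, Datum.frobFactor_theta]

end Coind

/-- A morphism to a coinduced sheaf is determined by its composition with the evaluation at the
unit. -/
theorem val_hom {S : BiSheaf D} {f : S.carrier →ₗ[k] (Coind D g V).carrier}
    (hf : f ∈ BiSheaf.homs S (Coind D g V)) (h : Pt k OH R) (c : Pt k OK R)
    (y : R ⊗[k] S.carrier) :
    Coind.val h c (f.baseChange R y) = D.frobFactor g h c •
      Coind.val 1 1 (f.baseChange R (S.rhoAt c (S.lamAt h⁻¹ y))) := by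
  rw [Coind.val_eq, BiSheaf.lamAt_baseChange hf, BiSheaf.rhoAt_baseChange hf]

end Frobenius


/-! ### Kernels and cokernels -/

section Transfer

variable {k : Type u} [Field k] {A S T W : Type u} [CommRing A] [Algebra k A]
  [AddCommGroup S] [Module k S] [AddCommGroup T] [Module k T] [AddCommGroup W] [Module k W]

/-- Tensoring with `A` over a field is exact, so `A ⊗ W` is the kernel of `A ⊗ f`, and the coaction
maps `W` into it. -/
theorem exists_coaction_of_injective {δ : S →ₗ[k] A ⊗[k] S} {δ' : T →ₗ[k] A ⊗[k] T}
    {f : S →ₗ[k] T} {i : W →ₗ[k] S} (h : δ' ∘ₗ f = f.lTensor A ∘ₗ δ)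
    (hi : Function.Injective i) (hex : Function.Exact i f) :
    ∃ δW : W →ₗ[k] A ⊗[k] W, δ ∘ₗ i = i.lTensor A ∘ₗ δW := by
  have hinj : Function.Injective (i.lTensor A) :=
    Module.Flat.lTensor_preserves_injective_linearMap i hi
  have hmem : ∀ w, δ (i w) ∈ LinearMap.range (i.lTensor A) := by
    intro w
    refine (Module.Flat.lTensor_exact A hex (δ (i w))).1 ?_
    have := DFunLike.congr_fun h (i w)
    simp only [LinearMap.comp_apply, (hex (i w)).2 ⟨w, rfl⟩, map_zero] at this
    exact this.symm
  refine ⟨(LinearEquiv.ofInjective _ hinj).symm.toLinearMap ∘ₗ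
    LinearMap.codRestrict _ (δ ∘ₗ i) hmem, ?_⟩
  ext w
  have := congrArg Subtype.val ((LinearEquiv.ofInjective _ hinj).apply_symm_apply
    (LinearMap.codRestrict _ (δ ∘ₗ i) hmem w))
  exact this.symm

/-- The kernel of `q` is the image of `f`, and the coaction sends it into `A ⊗ im f`, which dies in
`A ⊗ W`. -/
theorem exists_coaction_of_surjective {δ : S →ₗ[k] A ⊗[k] S} {δ' : T →ₗ[k] A ⊗[k] T}
    {f : S →ₗ[k] T} {q : T →ₗ[k] W} (h : δ' ∘ₗ f = f.lTensor A ∘ₗ δ)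
    (hq : Function.Surjective q) (hex : Function.Exact f q) :
    ∃ δW : W →ₗ[k] A ⊗[k] W, δW ∘ₗ q = q.lTensor A ∘ₗ δ' := by
  have hqf : q ∘ₗ f = 0 := by
    ext s
    exact (hex (f s)).2 ⟨s, rfl⟩
  have hle : LinearMap.ker q ≤ LinearMap.ker (q.lTensor A ∘ₗ δ') := by
    intro t ht
    obtain ⟨s, rfl⟩ := (hex t).1 ht
    have := DFunLike.congr_fun h s
    simp only [LinearMap.comp_apply] at this
    rw [LinearMap.mem_ker, LinearMap.comp_apply, this, ← LinearMap.comp_apply,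
      ← LinearMap.lTensor_comp, hqf, LinearMap.lTensor_zero, LinearMap.zero_apply]
  refine ⟨(LinearMap.ker q).liftQ _ hle ∘ₗ (q.quotKerEquivOfSurjective hq).symm.toLinearMap, ?_⟩
  ext t
  have : (q.quotKerEquivOfSurjective hq).symm (q t) = (LinearMap.ker q).mkQ t := by
    rw [LinearEquiv.symm_apply_eq]
    rfl
  rw [LinearMap.comp_apply, LinearMap.comp_apply, LinearEquiv.coe_coe, this]
  exact Submodule.liftQ_apply _ _ _

end Transfer

/-! ### Subobjects and quotients of biequivariant sheaves -/

section Kernels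

variable {k OG OH OK : Type u} [Field k] [CommRing OG] [HopfAlgebra k OG]
  [CommRing OH] [HopfAlgebra k OH] [CommRing OK] [HopfAlgebra k OK]
  {D : Datum k OG OH OK}

namespace BiSheaf

section OfInjective

variable (S : BiSheaf D) {W : Type u} [AddCommGroup W] [Module k W] [Module OG W]
  [IsScalarTower k OG W] [FiniteDimensional k W]

/-- The sheaf structure on a subspace that is stable under all operations. -/
def ofInjective (i : W →ₗ[k] S.carrier) (hi : Function.Injective i)
    (hsmul : ∀ (f : OG) (w : W), i (f • w) = f • i w)
    (δ : W →ₗ[k] OH ⊗[k] W) (hδ : S.lam ∘ₗ i = i.lTensor OH ∘ₗ δ)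
    (ε : W →ₗ[k] OK ⊗[k] W) (hε : S.rhoOp ∘ₗ i = i.lTensor OK ∘ₗ ε) : BiSheaf D := by
  -- By flatness over the field, `R ⊗ W` embeds in `R ⊗ S`, so each axiom can be verified in `S`.
  have hinj : ∀ (R : Type u) [CommRing R] [Algebra k R], Function.Injective (i.baseChange R) :=
    fun R _ _ => Module.Flat.lTensor_preserves_injective_linearMap (M := R) i hi
  have hl : ∀ (R : Type u) [CommRing R] [Algebra k R] (b : Pt k OH R) (y : R ⊗[k] W),
      i.baseChange R (opAt δ b.hom y) = S.lamAt b (i.baseChange R y) :=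
    fun R _ _ b y => (applyAt_baseChange hδ b.hom y).symm
  have hr : ∀ (R : Type u) [CommRing R] [Algebra k R] (b : Pt k OK R) (y : R ⊗[k] W),
      i.baseChange R (opAt ε b.hom y) = S.rhoAt b (i.baseChange R y) :=
    fun R _ _ b y => (applyAt_baseChange hε b.hom y).symm
  refine
    { carrier := W
      lam := δ
      rho := (TensorProduct.comm k W OK).symm.toLinearMap ∘ₗ ε
      lam_smul := fun R _ _ b f s => hinj R ?_
      rho_smul := fun R _ _ c f s => hinj R ?_
      lam_one := fun R _ _ => LinearMap.ext fun y => hinj R ?_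
      rho_one := fun R _ _ => LinearMap.ext fun y => hinj R ?_
      lam_mul := fun R _ _ b c => LinearMap.ext fun y => hinj R ?_
      rho_mul := fun R _ _ c d => LinearMap.ext fun y => hinj R ?_
      lam_rho := fun R _ _ b d => LinearMap.ext fun y => hinj R ?_ }
  · rw [← act_baseChange hsmul, hl, hl, LinearMap.baseChange_tmul, LinearMap.baseChange_tmul, hsmul]
    exact S.lam_smul R b f (i s)
  · rw [comm_comp_comm_symm, ← act_baseChange hsmul, hr, hr, LinearMap.baseChange_tmul,
      LinearMap.baseChange_tmul, hsmul]
    exact S.rho_smul R c f (i s)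
  · rw [hl]
    exact S.lamAt_one _
  · rw [comm_comp_comm_symm, hr]
    exact S.rhoAt_one _
  · rw [LinearMap.smul_apply, map_smul, LinearMap.comp_apply, LinearMap.comp_apply,
      ← act_baseChange hsmul, hl, hl, hl]
    exact DFunLike.congr_fun (S.lam_mul R b c) (i.baseChange R y)
  · rw [comm_comp_comm_symm, LinearMap.smul_apply, map_smul, LinearMap.comp_apply,
      LinearMap.comp_apply, ← act_baseChange hsmul, hr, hr, hr]
    exact DFunLike.congr_fun (S.rho_mul R c d) (i.baseChange R y)
  · rw [comm_comp_comm_symm, LinearMap.comp_apply, LinearMap.comp_apply, LinearMap.comp_apply,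
      ← act_baseChange hsmul, hl, hr, hr, hl]
    exact DFunLike.congr_fun (S.lam_rho R b d) (i.baseChange R y)

/-- The sheaf structure on a quotient by a subspace that is stable under all operations. -/
def ofSurjective (q : S.carrier →ₗ[k] W) (hq : Function.Surjective q)
    (hsmul : ∀ (f : OG) (s : S.carrier), q (f • s) = f • q s)
    (δ : W →ₗ[k] OH ⊗[k] W) (hδ : δ ∘ₗ q = q.lTensor OH ∘ₗ S.lam)
    (ε : W →ₗ[k] OK ⊗[k] W) (hε : ε ∘ₗ q = q.lTensor OK ∘ₗ S.rhoOp) : BiSheaf D := by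
  have hsurj : ∀ (R : Type u) [CommRing R] [Algebra k R], Function.Surjective (q.baseChange R) :=
    fun R _ _ => LinearMap.lTensor_surjective R hq
  have hl : ∀ (R : Type u) [CommRing R] [Algebra k R] (b : Pt k OH R) (y : R ⊗[k] S.carrier),
      opAt δ b.hom (q.baseChange R y) = q.baseChange R (S.lamAt b y) :=
    fun R _ _ b y => applyAt_baseChange hδ b.hom y
  have hr : ∀ (R : Type u) [CommRing R] [Algebra k R] (b : Pt k OK R) (y : R ⊗[k] S.carrier),
      opAt ε b.hom (q.baseChange R y) = q.baseChange R (S.rhoAt b y) :=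
    fun R _ _ b y => applyAt_baseChange hε b.hom y
  refine
    { carrier := W
      lam := δ
      rho := (TensorProduct.comm k W OK).symm.toLinearMap ∘ₗ ε
      lam_smul := fun R _ _ b f s => ?_
      rho_smul := fun R _ _ c f s => ?_
      lam_one := fun R _ _ => LinearMap.ext fun y => ?_
      rho_one := fun R _ _ => LinearMap.ext fun y => ?_
      lam_mul := fun R _ _ b c => LinearMap.ext fun y => ?_
      rho_mul := fun R _ _ c d => LinearMap.ext fun y => ?_
      lam_rho := fun R _ _ b d => LinearMap.ext fun y => ?_ }
  · obtain ⟨s, rfl⟩ := hq s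
    rw [← hsmul, ← LinearMap.baseChange_tmul, ← LinearMap.baseChange_tmul, hl, hl,
      act_baseChange hsmul]
    exact congrArg _ (S.lam_smul R b f s)
  · obtain ⟨s, rfl⟩ := hq s
    rw [comm_comp_comm_symm, ← hsmul, ← LinearMap.baseChange_tmul, ← LinearMap.baseChange_tmul,
      hr, hr, act_baseChange hsmul]
    exact congrArg _ (S.rho_smul R c f s)
  · obtain ⟨y, rfl⟩ := hsurj R y
    rw [hl]
    exact congrArg _ (S.lamAt_one _)
  · obtain ⟨y, rfl⟩ := hsurj R y
    rw [comm_comp_comm_symm, hr]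
    exact congrArg _ (S.rhoAt_one _)
  · obtain ⟨y, rfl⟩ := hsurj R y
    rw [LinearMap.smul_apply, LinearMap.comp_apply, LinearMap.comp_apply, hl, hl, hl,
      act_baseChange hsmul, ← map_smul]
    exact congrArg _ (DFunLike.congr_fun (S.lam_mul R b c) y)
  · obtain ⟨y, rfl⟩ := hsurj R y
    rw [comm_comp_comm_symm, LinearMap.smul_apply, LinearMap.comp_apply, LinearMap.comp_apply,
      hr, hr, hr, act_baseChange hsmul, ← map_smul]
    exact congrArg _ (DFunLike.congr_fun (S.rho_mul R c d) y)
  · obtain ⟨y, rfl⟩ := hsurj R y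
    rw [comm_comp_comm_symm, LinearMap.comp_apply, LinearMap.comp_apply, LinearMap.comp_apply,
      hl, hr, hr, hl, act_baseChange hsmul]
    exact congrArg _ (DFunLike.congr_fun (S.lam_rho R b d) y)

end OfInjective

variable {S T : BiSheaf D}

/-- A morphism as an `O(G)`-linear map. -/
def Hom.linG (φ : S ⟶ T) : S.carrier →ₗ[OG] T.carrier where
  toFun := Hom.lin φ
  map_add' := map_add _
  map_smul' f s := (Hom.lin_mem φ).1 f s

theorem exact_ker (φ : S ⟶ T) :
    Function.Exact ((LinearMap.ker (Hom.linG φ)).subtype.restrictScalars k) (Hom.lin φ) :=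
  fun y => ⟨fun hy => ⟨⟨y, hy⟩, rfl⟩, by rintro ⟨w, rfl⟩; exact w.2⟩

/-- The projection to the quotient by the image of a morphism. -/
def quotMap (φ : S ⟶ T) : T.carrier →ₗ[k] T.carrier ⧸ LinearMap.range (Hom.linG φ) :=
  (LinearMap.range (Hom.linG φ)).mkQ.restrictScalars k

theorem quotMap_surjective (φ : S ⟶ T) : Function.Surjective (quotMap φ) :=
  fun y => Submodule.mkQ_surjective (LinearMap.range (Hom.linG φ)) y

theorem quotMap_smul (φ : S ⟶ T) (f : OG) (t : T.carrier) :
    quotMap φ (f • t) = f • quotMap φ t :=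
  map_smul (LinearMap.range (Hom.linG φ)).mkQ f t

theorem exact_quotMap (φ : S ⟶ T) : Function.Exact (Hom.lin φ) (quotMap φ) :=
  fun _ => ⟨fun hy => (Submodule.Quotient.mk_eq_zero _).1 hy,
    fun hy => (Submodule.Quotient.mk_eq_zero _).2 hy⟩

instance (φ : S ⟶ T) : FiniteDimensional k (T.carrier ⧸ LinearMap.range (Hom.linG φ)) :=
  Module.Finite.of_surjective (quotMap φ) (quotMap_surjective φ)

theorem exists_lam_coker (φ : S ⟶ T) :
    ∃ δ : (T.carrier ⧸ LinearMap.range (Hom.linG φ)) →ₗ[k]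
      OH ⊗[k] (T.carrier ⧸ LinearMap.range (Hom.linG φ)),
      δ ∘ₗ quotMap φ = (quotMap φ).lTensor OH ∘ₗ T.lam :=
  exists_coaction_of_surjective (Hom.lin_mem φ).2.1 (quotMap_surjective φ) (exact_quotMap φ)

theorem exists_rho_coker (φ : S ⟶ T) :
    ∃ δ : (T.carrier ⧸ LinearMap.range (Hom.linG φ)) →ₗ[k]
      OK ⊗[k] (T.carrier ⧸ LinearMap.range (Hom.linG φ)),
      δ ∘ₗ quotMap φ = (quotMap φ).lTensor OK ∘ₗ T.rhoOp :=
  exists_coaction_of_surjective (rhoOp_comp.1 (Hom.lin_mem φ).2.2) (quotMap_surjective φ)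
    (exact_quotMap φ)

/-- The kernel of a morphism. -/
def ker (φ : S ⟶ T) : BiSheaf D :=
  haveI : FiniteDimensional k (LinearMap.ker (Hom.linG φ)) :=
    inferInstanceAs (FiniteDimensional k ((LinearMap.ker (Hom.linG φ)).restrictScalars k))
  have h1 := exists_coaction_of_injective (Hom.lin_mem φ).2.1 Subtype.val_injective (exact_ker φ)
  have h2 := exists_coaction_of_injective (rhoOp_comp.1 (Hom.lin_mem φ).2.2)
    Subtype.val_injective (exact_ker φ)
  ofInjective S ((LinearMap.ker (Hom.linG φ)).subtype.restrictScalars k) Subtype.val_injective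
    (fun _ _ => rfl) h1.choose h1.choose_spec h2.choose h2.choose_spec

/-- The inclusion of the kernel. -/
def kerι (φ : S ⟶ T) : ker φ ⟶ S :=
  Hom.ofLin (S := ker φ) ((LinearMap.ker (Hom.linG φ)).subtype.restrictScalars k)
    ⟨fun _ _ => rfl, (exists_coaction_of_injective (Hom.lin_mem φ).2.1 Subtype.val_injective
      (exact_ker φ)).choose_spec, rhoOp_comp.2 (by
        have h := (exists_coaction_of_injective (rhoOp_comp.1 (Hom.lin_mem φ).2.2)
          Subtype.val_injective (exact_ker φ)).choose_spec
        refine h.trans ?_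
        congr 1
        exact (comm_comp_comm_symm _).symm)⟩

theorem kerι_injective (φ : S ⟶ T) : Function.Injective (Hom.lin (kerι φ)) :=
  Subtype.val_injective

theorem exact_kerι (φ : S ⟶ T) : Function.Exact (Hom.lin (kerι φ)) (Hom.lin φ) := exact_ker φ

/-- The cokernel of a morphism. -/
def coker (φ : S ⟶ T) : BiSheaf D :=
  ofSurjective T (quotMap φ) (quotMap_surjective φ) (quotMap_smul φ)
    (exists_lam_coker φ).choose (exists_lam_coker φ).choose_spec
    (exists_rho_coker φ).choose (exists_rho_coker φ).choose_spec

/-- The projection to the cokernel. -/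
def cokerπ (φ : S ⟶ T) : T ⟶ coker φ :=
  Hom.ofLin (T := coker φ) (quotMap φ)
    ⟨quotMap_smul φ, (exists_lam_coker φ).choose_spec, rhoOp_comp.2 (by
        refine Eq.trans ?_ (exists_rho_coker φ).choose_spec
        congr 1
        exact comm_comp_comm_symm _)⟩

theorem cokerπ_surjective (φ : S ⟶ T) : Function.Surjective (Hom.lin (cokerπ φ)) :=
  quotMap_surjective φ

theorem exact_cokerπ (φ : S ⟶ T) : Function.Exact (Hom.lin φ) (Hom.lin (cokerπ φ)) :=
  exact_quotMap φ

/-- The linear kernel is itself a sheaf, so a monomorphism must kill its inclusion; dually for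
epimorphisms and cokernels. -/
theorem mono_iff_injective (φ : S ⟶ T) : Mono φ ↔ Function.Injective (Hom.lin φ) := by
  constructor
  · intro h
    have h0 : kerι φ ≫ φ = 0 ≫ φ := by
      rw [Limits.zero_comp]
      exact Hom.ext_lin fun s => (exact_kerι φ _).2 ⟨s, rfl⟩
    have h1 := (cancel_mono φ).1 h0
    rw [injective_iff_map_eq_zero]
    intro s hs
    obtain ⟨w, rfl⟩ := (exact_kerι φ s).1 hs
    rw [h1]
    rfl
  · intro h
    exact ⟨fun a b e => Hom.ext_lin fun s => h (congrArg (fun χ => Hom.lin χ s) e)⟩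

theorem epi_iff_surjective (φ : S ⟶ T) : Epi φ ↔ Function.Surjective (Hom.lin φ) := by
  constructor
  · intro h
    have h0 : φ ≫ cokerπ φ = φ ≫ 0 := by
      rw [Limits.comp_zero]
      exact Hom.ext_lin fun s => (exact_cokerπ φ _).2 ⟨s, rfl⟩
    have h1 := (cancel_epi φ).1 h0
    intro t
    refine (exact_cokerπ φ t).1 ?_
    rw [h1]
    rfl
  · intro h
    refine ⟨fun a b e => Hom.ext_lin fun s => ?_⟩
    obtain ⟨s, rfl⟩ := h s
    exact congrArg (fun χ => Hom.lin χ s) e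

theorem symm_mem_homs {e : S.carrier ≃ₗ[k] T.carrier} (h : e.toLinearMap ∈ homs S T) :
    e.symm.toLinearMap ∈ homs T S := by
  have hR : ∀ (R : Type u) [CommRing R] [Algebra k R] (y : R ⊗[k] S.carrier),
      e.symm.toLinearMap.baseChange R (e.toLinearMap.baseChange R y) = y := by
    intro R _ _ y
    rw [← LinearMap.comp_apply, ← LinearMap.baseChange_comp]
    simp
  refine mem_homs_of_points (fun f s => ?_) (fun R _ _ b s => ?_) (fun R _ _ c s => ?_)
  · have := h.1 f (e.symm s)
    rw [LinearEquiv.coe_coe, LinearEquiv.symm_apply_eq]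
    simpa using this.symm
  · obtain ⟨s, rfl⟩ := e.surjective s
    have := lamAt_baseChange h b (1 ⊗ₜ s)
    rw [LinearMap.baseChange_tmul] at this
    rw [← LinearEquiv.coe_coe, this, hR]
    simp
  · obtain ⟨s, rfl⟩ := e.surjective s
    have := rhoAt_baseChange h c (1 ⊗ₜ s)
    rw [LinearMap.baseChange_tmul] at this
    rw [← LinearEquiv.coe_coe, this, hR]
    simp

theorem isIso_of_bijective (φ : S ⟶ T) (h : Function.Bijective (Hom.lin φ)) : IsIso φ := by
  have h' : (LinearEquiv.ofBijective (Hom.lin φ) h).toLinearMap ∈ homs S T := Hom.lin_mem φ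
  refine ⟨Hom.ofLin _ (symm_mem_homs h'), Hom.ext_lin fun s => ?_, Hom.ext_lin fun s => ?_⟩
  · exact (LinearEquiv.ofBijective (Hom.lin φ) h).symm_apply_apply s
  · exact (LinearEquiv.ofBijective (Hom.lin φ) h).apply_symm_apply s

theorem bijective_of_isIso (φ : S ⟶ T) [IsIso φ] : Function.Bijective (Hom.lin φ) :=
  ⟨(mono_iff_injective φ).1 inferInstance, (epi_iff_surjective φ).1 inferInstance⟩

end BiSheaf

end Kernels


/-! ### Finite dimensional commutative algebras -/

section CommutativeAlgebra

/-- Nakayama's lemma: a proper `N` lies in a maximal submodule, and the simple quotient by it is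
annihilated by a maximal ideal `m`, so `N + mW` would still be proper. -/
theorem eq_top_of_sup_smul_top {B W : Type*} [CommRing B] [AddCommGroup W] [Module B W]
    [Module.Finite B W] (N : Submodule B W)
    (h : ∀ m : Ideal B, m.IsMaximal → N ⊔ m • (⊤ : Submodule B W) = ⊤) : N = ⊤ := by
  by_contra hN
  obtain ⟨M, hM, hNM⟩ := (eq_top_or_exists_le_coatom N).resolve_left hN
  have : IsSimpleModule B (W ⧸ M) := isSimpleModule_iff_isCoatom.2 hM
  refine hM.1 (top_unique ?_)
  rw [← h _ (IsSimpleModule.annihilator_isMaximal (M := W ⧸ M))]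
  refine sup_le hNM (Submodule.smul_le.2 fun r hr w _ => ?_)
  have := Module.mem_annihilator.1 hr (M.mkQ w)
  rwa [← map_smul, Submodule.mkQ_apply, Submodule.Quotient.mk_eq_zero] at this

variable {k : Type u} [Field k]

/-- The residue field is finite over the algebraically closed field `k`, hence equal to it. -/
theorem exists_algHom_ker_eq [IsAlgClosed k] {A : Type u} [CommRing A] [Algebra k A]
    [FiniteDimensional k A] (Q : Ideal A) [Q.IsMaximal] :
    ∃ p : A →ₐ[k] k, RingHom.ker p = Q := by
  let := Ideal.Quotient.field Q
  have hb : Function.Bijective (Algebra.ofId k (A ⧸ Q)) :=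
    IsAlgClosed.algebraMap_bijective_of_isIntegral
  let e := AlgEquiv.ofBijective (Algebra.ofId k (A ⧸ Q)) hb
  refine ⟨(e.symm : (A ⧸ Q) →ₐ[k] k).comp (Ideal.Quotient.mkₐ k Q), ?_⟩
  ext a
  rw [RingHom.mem_ker]
  change e.symm (Ideal.Quotient.mk Q a) = 0 ↔ _
  rw [map_eq_zero_iff _ e.symm.injective, Ideal.Quotient.eq_zero_iff_mem]

theorem ker_isMaximal {A : Type u} [CommRing A] [Algebra k A] (p : A →ₐ[k] k) :
    (RingHom.ker p).IsMaximal :=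
  RingHom.ker_isMaximal_of_surjective _ fun a => ⟨algebraMap k A a, p.commutes a⟩

theorem algHom_eq_of_ker_le {A : Type u} [CommRing A] [Algebra k A] {p q : A →ₐ[k] k}
    (h : RingHom.ker p ≤ RingHom.ker q) : p = q := by
  ext a
  have : a - algebraMap k A (p a) ∈ RingHom.ker q := h (by simp [RingHom.mem_ker])
  rw [RingHom.mem_ker, map_sub, AlgHom.commutes, sub_eq_zero] at this
  exact this.symm

/-- Points lift along homomorphisms of finite dimensional algebras. -/
theorem exists_comp_eq_of_ker_le [IsAlgClosed k] {O A : Type u} [CommRing O] [Algebra k O]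
    [CommRing A] [Algebra k A] [FiniteDimensional k A] (j : O →ₐ[k] A) (z : O →ₐ[k] k)
    (h : RingHom.ker j ≤ RingHom.ker z) : ∃ p : A →ₐ[k] k, p.comp j = z := by
  let := j.toRingHom.toAlgebra
  have : IsScalarTower k O A := IsScalarTower.of_algebraMap_eq fun a => (j.commutes a).symm
  have : Module.Finite O A := Module.Finite.of_restrictScalars_finite k O A
  have := ker_isMaximal z
  -- Lying over: `A` is finite over `O`, and the maximal ideal found is again the kernel of a
  -- k-point.
  obtain ⟨Q, hQ, hQz⟩ := Ideal.exists_ideal_over_maximal_of_isIntegral (S := A) (RingHom.ker z) h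
  obtain ⟨p, hp⟩ := exists_algHom_ker_eq (k := k) Q
  refine ⟨p, (algHom_eq_of_ker_le (le_of_eq ?_)).symm⟩
  rw [← hQz, ← hp]
  rfl

/-- In an Artinian ring every prime is maximal, hence the kernel of a k-point. -/
theorem isNilpotent_of_points [IsAlgClosed k] {A : Type u} [CommRing A] [Algebra k A]
    [FiniteDimensional k A] {a : A} (h : ∀ p : A →ₐ[k] k, p a = 0) : IsNilpotent a := by
  have : IsArtinianRing A := isArtinian_of_tower k inferInstance
  rw [nilpotent_iff_mem_prime]
  intro P hP
  have := hP
  have : P.IsMaximal := inferInstance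
  obtain ⟨p, rfl⟩ := exists_algHom_ker_eq (k := k) P
  exact h p

/-- The difference x of two commuting idempotents satisfies x³ = x, and here x is nilpotent. This
makes k-points sufficient for idempotents even when the algebra is not reduced. -/
theorem eq_of_isIdempotentElem_of_points [IsAlgClosed k] {A : Type u} [CommRing A] [Algebra k A]
    [FiniteDimensional k A] {a b : A} (ha : IsIdempotentElem a) (hb : IsIdempotentElem b)
    (h : ∀ p : A →ₐ[k] k, p a = p b) : a = b := by
  have hn : IsNilpotent (a - b) := isNilpotent_of_points (k := k) fun p => by rw [map_sub, h, sub_self]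
  have h3 : (a - b) ^ 3 = a - b := by
    have ha' : a * a = a := ha
    have hb' : b * b = b := hb
    linear_combination (a - 3 * b + 1) * ha' + (3 * a - b - 1) * hb'
  have hm : ∀ n : ℕ, (a - b) ^ (3 ^ n) = a - b := by
    intro n
    induction n with
    | zero => simp
    | succ n ih => rw [pow_succ, pow_mul, ih, h3]
  obtain ⟨n, hn⟩ := hn
  have : (a - b) ^ 3 ^ n = 0 := pow_eq_zero_of_le (Nat.lt_pow_self (by norm_num)).le hn
  rw [hm] at this
  exact sub_eq_zero.1 this

/-- The vector valued functions that vanish on a closed subscheme. -/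
theorem mem_ker_smul_top_of_bc_eq_zero {A C V : Type u} [CommRing A] [Algebra k A] [CommRing C]
    [Algebra k C] [AddCommGroup V] [Module k V] {p : A →ₐ[k] C} (hp : Function.Surjective p)
    {x : A ⊗[k] V} (hx : bc p V x = 0) :
    x ∈ RingHom.ker p • (⊤ : Submodule A (A ⊗[k] V)) := by
  have hex : Function.Exact ((RingHom.ker p).subtype.restrictScalars k) p.toLinearMap :=
    fun a => ⟨fun ha => ⟨⟨a, ha⟩, rfl⟩, by rintro ⟨b, rfl⟩; exact b.2⟩
  obtain ⟨y, rfl⟩ := (rTensor_exact V hex hp x).1 hx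
  clear hx
  induction y with
  | zero => simp
  | add a b ha hb => rw [map_add]; exact Submodule.add_mem _ ha hb
  | tmul a v =>
    have : (((RingHom.ker p).subtype.restrictScalars k).rTensor V) (a ⊗ₜ[k] v) =
        (a : A) • (1 ⊗ₜ v) := by
      rw [smul_tmul', smul_eq_mul, mul_one]
      rfl
    rw [this]
    exact Submodule.smul_mem_smul a.2 trivial

theorem exists_fin_spanning {S Q : Type*} [AddCommGroup S] [Module k S] [AddCommGroup Q]
    [Module k Q] [FiniteDimensional k Q] (q : S →ₗ[k] Q) (hq : Function.Surjective q) (n : ℕ)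
    (hn : Module.finrank k Q ≤ n) :
    ∃ t : Fin n → S, ∀ x, ∃ c : Fin n → k, q (x - ∑ i, c i • t i) = 0 := by
  obtain ⟨v, hv⟩ : ∃ v : Fin n → Q, Submodule.span k (Set.range v) = ⊤ := by
    let b := Module.finBasis k Q
    -- A basis padded with zeros, since the fibre may have dimension less than `n`.
    refine ⟨fun i => if hi : i.1 < _ then b ⟨i.1, hi⟩ else 0, top_unique ?_⟩
    rw [← b.span_eq]
    refine Submodule.span_mono ?_
    rintro _ ⟨i, rfl⟩
    exact ⟨⟨i.1, i.2.trans_le hn⟩, by simp⟩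
  choose t ht using fun i => hq (v i)
  refine ⟨t, fun x => ?_⟩
  have hx : q x ∈ Submodule.span k (Set.range v) := by rw [hv]; trivial
  obtain ⟨c, hc⟩ := (Submodule.mem_span_range_iff_exists_fun k).1 hx
  exact ⟨c, by simp [ht, hc]⟩

/-- Spanning families of length `n` in the fibres at the finitely many maximal ideals are glued by
the Chinese remainder theorem; Nakayama shows that the glued family generates. -/
theorem exists_generators {O S : Type u} [CommRing O] [Algebra k O] [FiniteDimensional k O]
    [AddCommGroup S] [Module k S] [Module O S] [IsScalarTower k O S] [FiniteDimensional k S]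
    (n : ℕ) (h : ∀ m : Ideal O, m.IsMaximal →
      Module.finrank k (S ⧸ (m • (⊤ : Submodule O S))) ≤ n) :
    ∃ s : Fin n → S, Submodule.span O (Set.range s) = ⊤ := by
  have : IsArtinianRing O := isArtinian_of_tower k inferInstance
  have : Module.Finite O S := Module.Finite.of_restrictScalars_finite k O S
  have h1 : ∀ m : MaximalSpectrum O, ∃ t : Fin n → S, ∀ x, ∃ c : Fin n → k,
      x - ∑ i, c i • t i ∈ m.1 • (⊤ : Submodule O S) := by
    intro m
    have hs : Function.Surjective ((m.1 • (⊤ : Submodule O S)).mkQ.restrictScalars k) :=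
      fun y => Submodule.mkQ_surjective _ y
    have : FiniteDimensional k (S ⧸ (m.1 • (⊤ : Submodule O S))) :=
      Module.Finite.of_surjective _ hs
    obtain ⟨t, ht⟩ := exists_fin_spanning _ hs n (h m.1 m.2)
    exact ⟨t, fun x => (ht x).imp fun c hc => (Submodule.Quotient.mk_eq_zero _).1 hc⟩
  choose t ht using h1
  have hcop : Pairwise fun m m' : MaximalSpectrum O => IsCoprime m.1 m'.1 := by
    intro m m' hne
    have := m.2
    have := m'.2
    exact Ideal.isCoprime_of_isMaximal fun e => hne (MaximalSpectrum.ext e)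
  have : Fintype (MaximalSpectrum O) := Fintype.ofFinite _
  classical
  -- The coefficient `e m` is 1 modulo `m` and 0 modulo the other maximal ideals.
  choose e he using fun m : MaximalSpectrum O =>
    Ideal.exists_forall_sub_mem_ideal hcop (fun m' => if m' = m then (1 : O) else 0)
  clear hcop
  refine ⟨fun i => ∑ m, e m • t m i, eq_top_of_sup_smul_top _ fun m hm => top_unique ?_⟩
  intro x _
  have hmem : ∀ i, t ⟨m, hm⟩ i ∈
      Submodule.span O (Set.range fun i => ∑ m, e m • t m i) ⊔ m • (⊤ : Submodule O S) := by
    intro i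
    have h2 : t ⟨m, hm⟩ i - ∑ m, e m • t m i ∈ m • (⊤ : Submodule O S) := by
      have : t ⟨m, hm⟩ i = ∑ m' : MaximalSpectrum O,
          (if (⟨m, hm⟩ : MaximalSpectrum O) = m' then (1 : O) else 0) • t m' i := by
        simp
      rw [this, ← Finset.sum_sub_distrib]
      refine Submodule.sum_mem _ fun m' _ => ?_
      rw [← sub_smul, ← neg_sub, neg_smul]
      exact Submodule.neg_mem _ (Submodule.smul_mem_smul (he m' ⟨m, hm⟩) trivial)
    rw [← sub_add_cancel (t ⟨m, hm⟩ i) (∑ m, e m • t m i)]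
    exact Submodule.add_mem _ (Submodule.mem_sup_right h2)
      (Submodule.mem_sup_left (Submodule.subset_span ⟨i, rfl⟩))
  obtain ⟨c, hc⟩ := ht ⟨m, hm⟩ x
  rw [← sub_add_cancel x (∑ i, c i • t ⟨m, hm⟩ i)]
  refine Submodule.add_mem _ (Submodule.mem_sup_right hc) (Submodule.sum_mem _ fun i _ => ?_)
  rw [← algebraMap_smul O (c i)]
  exact Submodule.smul_mem _ _ (hmem i)

/-- A module over the image of `j : O → A` is free if it has enough generators and admits a
semilinear map to a free `A`-module whose image generates. -/
theorem injective_and_finrank_of_generating {O A S V : Type u} [CommRing O] [Algebra k O]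
    [FiniteDimensional k O] [CommRing A] [Algebra k A] [FiniteDimensional k A] [AddCommGroup S]
    [Module k S] [Module O S] [IsScalarTower k O S] [FiniteDimensional k S]
    [AddCommGroup V] [Module k V] [FiniteDimensional k V] (j : O →ₐ[k] A)
    (Φ : S →ₗ[k] A ⊗[k] V) (hΦ : ∀ (f : O) (s : S), Φ (f • s) = j f • Φ s)
    (hj : ∀ f ∈ RingHom.ker j, ∀ s : S, f • s = 0)
    (hfib : ∀ m : Ideal O, m.IsMaximal →
      Module.finrank k (S ⧸ (m • (⊤ : Submodule O S))) ≤ Module.finrank k V)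
    (hspan : Submodule.span A (Set.range Φ) = ⊤) :
    Function.Injective Φ ∧
      Module.finrank k S = Module.finrank k V * Module.finrank k (O ⧸ RingHom.ker j) := by
  set n := Module.finrank k V with hn
  obtain ⟨s, hs⟩ := exists_generators _ hfib
  -- The coordinate vectors go to the images of the generators of `S`. The map is onto because these
  -- images generate, hence bijective because both sides have the same dimension over `k`.
  let Ψ : (Fin n → A) →ₗ[A] A ⊗[k] V := Fintype.linearCombination A fun i => Φ (s i)
  have hΨ : ∀ f : Fin n → O, Ψ (fun i => j (f i)) = Φ (∑ i, f i • s i) := by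
    intro f
    simp [Ψ, Fintype.linearCombination_apply, map_sum, hΦ]
  have hgen : ∀ x : S, ∃ f : Fin n → O, ∑ i, f i • s i = x := by
    intro x
    have : x ∈ Submodule.span O (Set.range s) := by rw [hs]; trivial
    exact (Submodule.mem_span_range_iff_exists_fun O).1 this
  have hΨs : Function.Surjective Ψ := by
    rw [← LinearMap.range_eq_top, ← top_le_iff, ← hspan, Submodule.span_le]
    rintro _ ⟨x, rfl⟩
    obtain ⟨f, rfl⟩ := hgen x
    exact ⟨_, hΨ f⟩
  have hΨi : Function.Injective Ψ := by
    have hd : Module.finrank k (Fin n → A) = Module.finrank k (A ⊗[k] V) := by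
      rw [Module.finrank_tensorProduct, Module.finrank_pi_fintype, Finset.sum_const,
        Finset.card_univ, Fintype.card_fin, smul_eq_mul, mul_comm]
    exact (LinearMap.injective_iff_surjective_of_finrank_eq_finrank
      (f := Ψ.restrictScalars k) hd).2 hΨs
  -- Freeness: a combination of the generators that dies under `Φ` has all its coefficients in the
  -- kernel of `j`, which annihilates `S`.
  have hker : ∀ f : Fin n → O, Φ (∑ i, f i • s i) = 0 → ∀ i, f i ∈ RingHom.ker j := by
    intro f hf i
    rw [← hΨ] at hf
    exact congrFun ((injective_iff_map_eq_zero Ψ).1 hΨi _ hf) i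
  constructor
  · rw [injective_iff_map_eq_zero]
    intro x hx
    obtain ⟨f, rfl⟩ := hgen x
    exact Finset.sum_eq_zero fun i _ => hj _ (hker f hx i) _
  -- The generators form a basis of `S` over the image of `O` in `A`.
  · let E : (Fin n → O ⧸ RingHom.ker j) →ₗ[O] S := ∑ i,
      ((RingHom.ker j).liftQ (LinearMap.toSpanSingleton O S (s i)) fun f hf => hj f hf (s i)) ∘ₗ
        LinearMap.proj i
    have hE : ∀ f : Fin n → O, E (fun i => Ideal.Quotient.mk _ (f i)) = ∑ i, f i • s i := by
      intro f
      simp only [E, LinearMap.sum_apply, LinearMap.comp_apply, LinearMap.proj_apply]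
      rfl
    have hEb : Function.Bijective E := by
      constructor
      · rw [injective_iff_map_eq_zero]
        intro q hq
        choose f hf using fun i => Ideal.Quotient.mk_surjective (q i)
        obtain rfl : (fun i => Ideal.Quotient.mk _ (f i)) = q := funext hf
        rw [hE] at hq
        funext i
        exact Ideal.Quotient.eq_zero_iff_mem.2 (hker f (by rw [hq, map_zero]) i)
      · intro x
        obtain ⟨f, rfl⟩ := hgen x
        exact ⟨_, hE f⟩
    have := (LinearEquiv.ofBijective (E.restrictScalars k) hEb).finrank_eq
    rw [← this, Module.finrank_pi_fintype, Finset.sum_const, Finset.card_univ, Fintype.card_fin,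
      smul_eq_mul]

/-- Nakayama again: every maximal ideal of `A` is the kernel of a k-point, so it suffices to
generate the fibres there. -/
theorem span_range_eq_top_of_points [IsAlgClosed k] {A S V : Type u} [CommRing A] [Algebra k A]
    [FiniteDimensional k A] [AddCommGroup V] [Module k V] [FiniteDimensional k V] [AddCommGroup S]
    [Module k S] (Φ : S →ₗ[k] A ⊗[k] V)
    (h : ∀ p : A →ₐ[k] k, Function.Surjective fun s => bc p V (Φ s)) :
    Submodule.span A (Set.range Φ) = ⊤ := by
  refine eq_top_of_sup_smul_top _ fun m hm => top_unique fun x _ => ?_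
  obtain ⟨p, rfl⟩ := exists_algHom_ker_eq (k := k) m
  obtain ⟨s, hs⟩ := h p (bc p V x)
  have hx : x - Φ s ∈ RingHom.ker p • (⊤ : Submodule A (A ⊗[k] V)) :=
    mem_ker_smul_top_of_bc_eq_zero (fun a => ⟨algebraMap k A a, p.commutes a⟩)
      (by rw [map_sub, sub_eq_zero]; exact hs.symm)
  rw [← sub_add_cancel x (Φ s)]
  exact Submodule.add_mem _ (Submodule.mem_sup_right hx)
    (Submodule.mem_sup_left (Submodule.subset_span ⟨s, rfl⟩))

end CommutativeAlgebra


/-! ### Fibres of sheaves supported on a double coset -/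

section Support

variable {k OG OH OK : Type u} [Field k] [CommRing OG] [HopfAlgebra k OG]
  [CommRing OH] [HopfAlgebra k OH] [CommRing OK] [HopfAlgebra k OK]
  {D : Datum k OG OH OK} {R : Type u} [CommRing R] [Algebra k R]

namespace Datum

theorem orbitPt_orbitPt (g : Pt k OG k) (h₀ : Pt k OH k) (c₀ : Pt k OK k) (h : Pt k OH R)
    (c : Pt k OK R) :
    D.orbitPt (D.orbitPt g h₀ c₀) h c = D.orbitPt g (h₀.const R * h) (c₀.const R * c) := by
  have e : (D.orbitPt g h₀ c₀).const R = D.orbitPt g (h₀.const R) (c₀.const R) := by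
    simp only [Pt.const, orbitPt_map]
  rw [orbitPt, e]
  simp only [orbitPt, map_mul]
  group

theorem orbitIdeal_le_orbitPt (g : Pt k OG k) (h₀ : Pt k OH k) (c₀ : Pt k OK k) :
    D.orbitIdeal g ≤ D.orbitIdeal (D.orbitPt g h₀ c₀) := by
  intro f hf
  change D.orbitMap _ f = 0
  change (D.orbitPt (D.orbitPt g h₀ c₀) _ _).hom f = 0
  rw [orbitPt_orbitPt, ← pt_orbitMap, show D.orbitMap g f = 0 from hf, map_zero]

/-- Moving the base point only reparametrizes H × K; the other inclusion comes from moving it back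
by the inverses. -/
theorem orbitIdeal_orbitPt (g : Pt k OG k) (h₀ : Pt k OH k) (c₀ : Pt k OK k) :
    D.orbitIdeal (D.orbitPt g h₀ c₀) = D.orbitIdeal g := by
  refine le_antisymm ?_ (orbitIdeal_le_orbitPt g h₀ c₀)
  have h := orbitIdeal_le_orbitPt (D := D) (D.orbitPt g h₀ c₀) h₀⁻¹ c₀⁻¹
  rwa [orbitPt_orbitPt, Pt.const_self, Pt.const_self, mul_inv_cancel, mul_inv_cancel,
    orbitPt_one_one, Pt.const_self] at h

theorem orbitIdeal_le_ker (g : Pt k OG k) (h : Pt k OH k) (c : Pt k OK k) :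
    D.orbitIdeal g ≤ RingHom.ker (D.orbitPt g h c).hom := by
  intro f hf
  rw [RingHom.mem_ker, ← pt_orbitMap, show D.orbitMap g f = 0 from hf, map_zero]

/-- O(H × K) is finite over O(G), so a k-point of the closed subscheme Z lifts to H × K. Hence Z(k)
= H(k) g K(k), and the ideal of Z can be computed from any representative. -/
theorem exists_eq_orbitPt [IsAlgClosed k] [FiniteDimensional k OH] [FiniteDimensional k OK]
    (g z : Pt k OG k) (h : D.orbitIdeal g ≤ RingHom.ker z.hom) :
    ∃ (h : Pt k OH k) (c : Pt k OK k), z = D.orbitPt g h c := by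
  obtain ⟨p, hp⟩ := exists_comp_eq_of_ker_le (D.orbitMap g) z.hom h
  obtain ⟨h, c, rfl⟩ := exists_eq_pt p
  refine ⟨h, c, Pt.ext fun f => ?_⟩
  rw [← pt_orbitMap, ← hp]
  rfl

theorem DoubleCoset.ideal_eq [IsAlgClosed k] [FiniteDimensional k OH] [FiniteDimensional k OK]
    {Z : D.DoubleCoset} {g : Pt k OG k} (hg : Z.IsRep g) : Z.ideal = D.orbitIdeal g := by
  obtain ⟨_, g₀, rfl⟩ := Z
  obtain ⟨h, c, rfl⟩ := exists_eq_orbitPt (D := D) g₀ g hg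
  exact (orbitIdeal_orbitPt g₀ h c).symm

end Datum

namespace BiSheaf

/-- The axiom for b · b⁻¹ = 1 expresses `y` through the image of `y` under the operator of `b`. -/
theorem lamAt_injective (S : BiSheaf D) (b : Pt k OH R) : Function.Injective (S.lamAt b) := by
  rw [injective_iff_map_eq_zero]
  intro y hy
  have h := DFunLike.congr_fun (S.lam_mul R b b⁻¹) y
  simp only [LinearMap.smul_apply, LinearMap.comp_apply] at h
  change S.lamAt (b * b⁻¹) y = _ • act _ _ _ (S.lamAt b⁻¹ (S.lamAt b y)) at h
  rwa [hy, map_zero, map_zero, smul_zero, mul_inv_cancel, lamAt_one] at h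

theorem rhoAt_injective (S : BiSheaf D) (c : Pt k OK R) : Function.Injective (S.rhoAt c) := by
  rw [injective_iff_map_eq_zero]
  intro y hy
  have h := DFunLike.congr_fun (S.rho_mul R c⁻¹ c) y
  simp only [LinearMap.smul_apply, LinearMap.comp_apply] at h
  change S.rhoAt (c⁻¹ * c) y = _ • act _ _ _ (S.rhoAt c⁻¹ (S.rhoAt c y)) at h
  rwa [hy, map_zero, map_zero, smul_zero, inv_mul_cancel, rhoAt_one] at h

theorem lamAt_surjective (S : BiSheaf D) (b : Pt k OH k) : Function.Surjective (S.lamAt b) :=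
  LinearMap.injective_iff_surjective.1 (S.lamAt_injective b)

theorem rhoAt_surjective (S : BiSheaf D) (c : Pt k OK k) : Function.Surjective (S.rhoAt c) :=
  LinearMap.injective_iff_surjective.1 (S.rhoAt_injective c)

/-- The fibre of a sheaf at a `k`-point. -/
abbrev Fib (S : BiSheaf D) (g : Pt k OG k) : Type u :=
  S.carrier ⧸ (RingHom.ker g.hom • (⊤ : Submodule OG S.carrier))

/-- The projection to the fibre. -/
def fibπ (S : BiSheaf D) (g : Pt k OG k) : S.carrier →ₗ[k] S.Fib g :=
  (RingHom.ker g.hom • (⊤ : Submodule OG S.carrier)).mkQ.restrictScalars k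

theorem fibπ_surjective (S : BiSheaf D) (g : Pt k OG k) : Function.Surjective (S.fibπ g) :=
  fun y => Submodule.mkQ_surjective _ y

theorem fibπ_eq_zero (S : BiSheaf D) (g : Pt k OG k) (s : S.carrier) :
    S.fibπ g s = 0 ↔ s ∈ RingHom.ker g.hom • (⊤ : Submodule OG S.carrier) :=
  Submodule.Quotient.mk_eq_zero _

instance (S : BiSheaf D) (g : Pt k OG k) : FiniteDimensional k (S.Fib g) :=
  Module.Finite.of_surjective _ (S.fibπ_surjective g)

theorem fibπ_atPoint (S : BiSheaf D) (g : Pt k OG k) : AtPoint g (S.fibπ g) := by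
  intro f s
  rw [← map_smul, ← sub_eq_zero, ← map_sub, fibπ_eq_zero, ← algebraMap_smul OG (g.hom f) s, ← sub_smul]
  refine Submodule.smul_mem_smul ?_ trivial
  rw [RingHom.mem_ker, map_sub, AlgHom.commutes]
  exact sub_self _

section AtPoint

variable {S : BiSheaf D} {g : Pt k OG k} {V : Type u} [AddCommGroup V] [Module k V]
  {π : S.carrier →ₗ[k] V}

theorem eq_zero_of_atPoint (hπ : AtPoint g π) {s : S.carrier}
    (hs : s ∈ RingHom.ker g.hom • (⊤ : Submodule OG S.carrier)) : π s = 0 := by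
  refine Submodule.smul_induction_on hs (fun f hf t _ => ?_) fun s t hs ht => ?_
  · rw [hπ, show g.hom f = 0 from hf, zero_smul]
  · rw [map_add, hs, ht, add_zero]

theorem ker_fibπ_le (hπ : AtPoint g π) : LinearMap.ker (S.fibπ g) ≤ LinearMap.ker π :=
  fun _ hs => eq_zero_of_atPoint hπ ((S.fibπ_eq_zero g _).1 hs)

/-- The map on the fibre induced by a linear map that factors through it. -/
def fibLift (hπ : AtPoint g π) : S.Fib g →ₗ[k] V :=
  (LinearMap.ker (S.fibπ g)).liftQ π (ker_fibπ_le hπ) ∘ₗ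
    ((S.fibπ g).quotKerEquivOfSurjective (S.fibπ_surjective g)).symm.toLinearMap

theorem fibLift_fibπ (hπ : AtPoint g π) (s : S.carrier) : fibLift hπ (S.fibπ g s) = π s := by
  have : ((S.fibπ g).quotKerEquivOfSurjective (S.fibπ_surjective g)).symm (S.fibπ g s) =
      (LinearMap.ker (S.fibπ g)).mkQ s := by
    rw [LinearEquiv.symm_apply_eq]
    rfl
  rw [fibLift, LinearMap.comp_apply, LinearEquiv.coe_coe, this]
  exact Submodule.liftQ_apply _ _ _

theorem fibLift_surjective (hπ : AtPoint g π) (h : Function.Surjective π) :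
    Function.Surjective (fibLift hπ) := fun v => by
  obtain ⟨s, rfl⟩ := h v
  exact ⟨_, fibLift_fibπ hπ s⟩

end AtPoint

theorem one_tmul_surjective {V : Type u} [AddCommGroup V] [Module k V] :
    Function.Surjective fun v : V => (1 : k) ⊗ₜ[k] v := fun t => by
  refine ⟨TensorProduct.lid k V t, ?_⟩
  exact (one_tmul_lid (R := k) t).trans (bc_id t)

/-- With z = h⁻¹gc, the bijection λ_h ρ_{c⁻¹} followed by the projection to the fibre at `z` factors
through the fibre at hzc⁻¹ = g. The resulting map of fibres is onto; this inequality suffices. -/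
theorem finrank_fib_orbitPt_le (S : BiSheaf D) (g : Pt k OG k) (h : Pt k OH k) (c : Pt k OK k) :
    Module.finrank k (S.Fib (D.orbitPt g h c)) ≤ Module.finrank k (S.Fib g) := by
  let z := D.orbitPt g h c
  let l : k ⊗[k] S.carrier →ₗ[k] k ⊗[k] S.Fib z :=
    ((S.fibπ z).baseChange k ∘ₗ S.lamAt h) ∘ₗ S.rhoAt c⁻¹
  have hl : IsAt (g.const k) l := by
    have := isAt_rhoAt (isAt_lamAt (S.fibπ_atPoint z).isAt h) c⁻¹
    have e : D.inH h * z.const k * D.inK c⁻¹ = g.const k := by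
      simp only [Pt.const_self, z, Datum.orbitPt, map_inv]
      group
    rwa [e] at this
  let π : S.carrier →ₗ[k] k ⊗[k] S.Fib z := l ∘ₗ TensorProduct.mk k k S.carrier 1
  have hπ : AtPoint g π := fun f s => hl f s
  have hs : Function.Surjective π := by
    have h1 : Function.Surjective ((S.fibπ z).baseChange k) :=
      LinearMap.lTensor_surjective k (S.fibπ_surjective z)
    exact ((h1.comp (S.lamAt_surjective h)).comp (S.rhoAt_surjective c⁻¹)).comp one_tmul_surjective
  have h2 := LinearMap.finrank_le_finrank_of_surjective (fibLift_surjective hπ hs)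
  rwa [Module.finrank_tensorProduct, Module.finrank_self, one_mul] at h2

variable [IsAlgClosed k] [FiniteDimensional k OG] [FiniteDimensional k OH] [FiniteDimensional k OK]

/-- The hypotheses of `injective_and_finrank_of_generating` hold for the orbit map: fibres over Z
are bounded by translation, and at each k-point of H × K the values of `frob` fill the fibre. -/
theorem frob_injective_and_finrank {S : BiSheaf D} {g : Pt k OG k}
    (hS : ∀ f ∈ D.orbitIdeal g, ∀ s : S.carrier, f • s = 0) :
    Function.Injective (frob g S (S.fibπ g)) ∧ Module.finrank k S.carrier =
      Module.finrank k (S.Fib g) * Module.finrank k (OG ⧸ D.orbitIdeal g) := by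
  refine injective_and_finrank_of_generating (D.orbitMap g)
    (Coind.fn.toLinearMap ∘ₗ frob g S (S.fibπ g)) (fun f s => ?_) hS (fun m hm => ?_) ?_
  · exact (congrArg Coind.fn ((frob_mem_homs (S.fibπ_atPoint g)).1 f s)).trans (Coind.fn_smul _ _)
  · by_cases hle : D.orbitIdeal g ≤ m
    · obtain ⟨z, rfl⟩ := exists_algHom_ker_eq (k := k) m
      obtain ⟨h, c, hz⟩ := Datum.exists_eq_orbitPt g (Pt.mk z) hle
      have h1 := S.finrank_fib_orbitPt_le g h c
      rwa [← hz] at h1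
    -- At a point outside Z the fibre is zero, because the ideal of Z kills `S` and is comaximal
    -- with `m`.
    · have h1 : m ⊔ D.orbitIdeal g = ⊤ := by
        refine hm.1.2 _ (lt_of_le_of_ne le_sup_left fun e => hle ?_)
        rw [e]
        exact le_sup_right
      have h2 : m • (⊤ : Submodule OG S.carrier) = ⊤ := by
        refine top_unique fun s _ => ?_
        obtain ⟨a, ha, b, hb, hab⟩ := Submodule.mem_sup.1 (h1 ▸ Submodule.mem_top (x := (1 : OG)))
        have : s = a • s := by
          conv_lhs => rw [← one_smul OG s, ← hab, add_smul, hS b hb, add_zero]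
        rw [this]
        exact Submodule.smul_mem_smul ha trivial
      rw [h2]
      have : Subsingleton (S.carrier ⧸ (⊤ : Submodule OG S.carrier)) :=
        Submodule.Quotient.subsingleton_iff.2 rfl
      rw [Module.finrank_zero_of_subsingleton]
      exact Nat.zero_le _
  · refine span_range_eq_top_of_points (k := k) _ fun p => ?_
    obtain ⟨h, c, rfl⟩ := exists_eq_pt p
    intro t
    have h1 : Function.Surjective ((S.fibπ g).baseChange k) :=
      LinearMap.lTensor_surjective k (S.fibπ_surjective g)
    -- At a k-point (h, c) the value of `frob` is a unit times a composition of surjections, the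
    -- operators of k-points being bijective.
    obtain ⟨s, hs⟩ := (((h1.comp (S.rhoAt_surjective c)).comp (S.lamAt_surjective h⁻¹)).comp
      one_tmul_surjective) ((D.frobFactor g h c)⁻¹ • t)
    refine ⟨s, ?_⟩
    have := bc_frob (g := g) (S.fibπ g) h c s
    simp only [Function.comp_apply] at hs
    rw [hs, smul_inv_smul] at this
    exact this

end BiSheaf

end Support


/-! ### Exactness of fibres -/

section Exactness

variable {k OG OH OK : Type u} [Field k] [CommRing OG] [HopfAlgebra k OG]
  [CommRing OH] [HopfAlgebra k OH] [CommRing OK] [HopfAlgebra k OK]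
  {D : Datum k OG OH OK}

namespace BiSheaf

variable {S T U : BiSheaf D}

theorem exists_lift (i : T ⟶ U) (hi : Function.Injective (Hom.lin i)) (χ : S ⟶ U)
    (h : ∀ s, Hom.lin χ s ∈ LinearMap.range (Hom.lin i)) :
    ∃ χ' : S ⟶ T, ∀ s, Hom.lin i (Hom.lin χ' s) = Hom.lin χ s := by
  obtain ⟨f, hf⟩ : ∃ f : S.carrier →ₗ[k] T.carrier, Hom.lin i ∘ₗ f = Hom.lin χ :=
    ⟨(LinearEquiv.ofInjective _ hi).symm.toLinearMap ∘ₗ LinearMap.codRestrict _ (Hom.lin χ) h,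
      LinearMap.ext fun s => congrArg Subtype.val ((LinearEquiv.ofInjective _ hi).apply_symm_apply
        (LinearMap.codRestrict _ (Hom.lin χ) h s))⟩
  have hf' : ∀ s, Hom.lin i (f s) = Hom.lin χ s := fun s => DFunLike.congr_fun hf s
  have hinj : ∀ (R : Type u) [CommRing R] [Algebra k R],
      Function.Injective ((Hom.lin i).baseChange R) := fun R _ _ =>
    Module.Flat.lTensor_preserves_injective_linearMap (M := R) _ hi
  have hR : ∀ (R : Type u) [CommRing R] [Algebra k R] (y : R ⊗[k] S.carrier),
      (Hom.lin i).baseChange R (f.baseChange R y) = (Hom.lin χ).baseChange R y := by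
    intro R _ _ y
    rw [← hf, LinearMap.baseChange_comp, LinearMap.comp_apply]
  refine ⟨Hom.ofLin f (mem_homs_of_points (fun a s => hi ?_) (fun R _ _ b s => hinj R ?_)
    (fun R _ _ c s => hinj R ?_)), hf'⟩
  · rw [hf', (Hom.lin_mem χ).1, (Hom.lin_mem i).1, hf']
  · rw [← lamAt_baseChange (Hom.lin_mem i), LinearMap.baseChange_tmul, hf', hR,
      ← lamAt_baseChange (Hom.lin_mem χ), LinearMap.baseChange_tmul]
  · rw [← rhoAt_baseChange (Hom.lin_mem i), LinearMap.baseChange_tmul, hf', hR,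
      ← rhoAt_baseChange (Hom.lin_mem χ), LinearMap.baseChange_tmul]

theorem exists_desc (q : S ⟶ T) (hq : Function.Surjective (Hom.lin q)) (χ : S ⟶ U)
    (h : ∀ s, Hom.lin q s = 0 → Hom.lin χ s = 0) :
    ∃ χ' : T ⟶ U, ∀ s, Hom.lin χ' (Hom.lin q s) = Hom.lin χ s := by
  obtain ⟨f, hf⟩ : ∃ f : T.carrier →ₗ[k] U.carrier, ∀ s, f (Hom.lin q s) = Hom.lin χ s := by
    refine ⟨(LinearMap.ker (Hom.lin q)).liftQ (Hom.lin χ) h ∘ₗ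
      ((Hom.lin q).quotKerEquivOfSurjective hq).symm.toLinearMap, fun s => ?_⟩
    have : ((Hom.lin q).quotKerEquivOfSurjective hq).symm (Hom.lin q s) =
        (LinearMap.ker (Hom.lin q)).mkQ s := by
      rw [LinearEquiv.symm_apply_eq]
      rfl
    rw [LinearMap.comp_apply, LinearEquiv.coe_coe, this]
    exact Submodule.liftQ_apply _ _ _
  have hR : ∀ (R : Type u) [CommRing R] [Algebra k R] (y : R ⊗[k] S.carrier),
      f.baseChange R ((Hom.lin q).baseChange R y) = (Hom.lin χ).baseChange R y := by
    intro R _ _ y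
    rw [show Hom.lin χ = f ∘ₗ Hom.lin q from (LinearMap.ext hf).symm, LinearMap.baseChange_comp,
      LinearMap.comp_apply]
  refine ⟨Hom.ofLin f (mem_homs_of_points (fun a t => ?_) (fun R _ _ b t => ?_)
    (fun R _ _ c t => ?_)), hf⟩
  · obtain ⟨s, rfl⟩ := hq t
    rw [← (Hom.lin_mem q).1, hf, (Hom.lin_mem χ).1, hf]
  · obtain ⟨s, rfl⟩ := hq t
    rw [hf, ← LinearMap.baseChange_tmul (Hom.lin q), lamAt_baseChange (Hom.lin_mem q), hR,
      ← lamAt_baseChange (Hom.lin_mem χ), LinearMap.baseChange_tmul]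
  · obtain ⟨s, rfl⟩ := hq t
    rw [hf, ← LinearMap.baseChange_tmul (Hom.lin q), rhoAt_baseChange (Hom.lin_mem q), hR,
      ← rhoAt_baseChange (Hom.lin_mem χ), LinearMap.baseChange_tmul]

/-- The sheaf is annihilated by an ideal. -/
def KilledBy (I : Ideal OG) (S : BiSheaf D) : Prop := ∀ f ∈ I, ∀ s : S.carrier, f • s = 0

theorem KilledBy.of_injective {I : Ideal OG} (hT : KilledBy I T) (i : S ⟶ T)
    (hi : Function.Injective (Hom.lin i)) : KilledBy I S := fun f hf s => hi (by
  rw [(Hom.lin_mem i).1, hT f hf, map_zero])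

theorem KilledBy.of_surjective {I : Ideal OG} (hS : KilledBy I S) (q : S ⟶ T)
    (hq : Function.Surjective (Hom.lin q)) : KilledBy I T := fun f hf t => by
  obtain ⟨s, rfl⟩ := hq t
  rw [← (Hom.lin_mem q).1, hS f hf, map_zero]

theorem fibπ_comp_atPoint (φ : S ⟶ T) (g : Pt k OG k) : AtPoint g (T.fibπ g ∘ₗ Hom.lin φ) := by
  intro f s
  rw [LinearMap.comp_apply, (Hom.lin_mem φ).1, T.fibπ_atPoint g]
  rfl

theorem mem_smul_top_of_surjective (q : S ⟶ T) (hq : Function.Surjective (Hom.lin q))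
    (I : Ideal OG) {t : T.carrier} (ht : t ∈ I • (⊤ : Submodule OG T.carrier)) :
    ∃ s ∈ I • (⊤ : Submodule OG S.carrier), Hom.lin q s = t := by
  have h : (I • (⊤ : Submodule OG S.carrier)).map (Hom.linG q) = I • ⊤ := by
    rw [Submodule.map_smul'', Submodule.map_top, (LinearMap.range_eq_top (f := Hom.linG q)).2 hq]
  rw [← h] at ht
  exact ht

theorem finrank_quotient_orbitIdeal_pos [FiniteDimensional k OG] (g : Pt k OG k) :
    0 < Module.finrank k (OG ⧸ D.orbitIdeal g) := by
  have h : D.orbitIdeal g ≠ ⊤ := fun h => by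
    have h1 := Datum.orbitIdeal_le_ker (D := D) g 1 1
    rw [h, top_le_iff] at h1
    exact (ker_isMaximal _).ne_top h1
  have : Nontrivial (OG ⧸ D.orbitIdeal g) := Ideal.Quotient.nontrivial_iff.2 h
  exact Module.finrank_pos

variable [IsAlgClosed k] [FiniteDimensional k OG] [FiniteDimensional k OH] [FiniteDimensional k OK]

/-- Left exactness of the fibre at `g`. Dimensions are additive for S, T and the cokernel, and each
equals that of the fibre times dim O(Z); so the dimensions of the fibres are additive, and right
exactness forces injectivity on fibres. -/
theorem mem_smul_top_of_injective {g : Pt k OG k} (hS : KilledBy (D.orbitIdeal g) S)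
    (hT : KilledBy (D.orbitIdeal g) T) (φ : S ⟶ T) (hφ : Function.Injective (Hom.lin φ))
    {s : S.carrier}
    (hs : Hom.lin φ s ∈ RingHom.ker g.hom • (⊤ : Submodule OG T.carrier)) :
    s ∈ RingHom.ker g.hom • (⊤ : Submodule OG S.carrier) := by
  set q := cokerπ φ
  have hq : Function.Surjective (Hom.lin q) := cokerπ_surjective φ
  have hC : KilledBy (D.orbitIdeal g) (coker φ) := hT.of_surjective q hq
  have d1 : Module.finrank k S.carrier + Module.finrank k (coker φ).carrier =
      Module.finrank k T.carrier := by
    have h1 := (Hom.lin q).finrank_range_add_finrank_ker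
    rw [LinearMap.range_eq_top.2 hq, finrank_top, (exact_cokerπ φ).linearMap_ker_eq,
      LinearMap.finrank_range_of_inj hφ] at h1
    rw [← h1, add_comm]
  rw [(frob_injective_and_finrank hS).2, (frob_injective_and_finrank hT).2,
    (frob_injective_and_finrank hC).2, ← add_mul] at d1
  have d2 := Nat.eq_of_mul_eq_mul_right (finrank_quotient_orbitIdeal_pos (D := D) g) d1
  let φg : S.Fib g →ₗ[k] T.Fib g := fibLift (fibπ_comp_atPoint φ g)
  let qg : T.Fib g →ₗ[k] (coker φ).Fib g := fibLift (fibπ_comp_atPoint q g)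
  have hφg : ∀ s, φg (S.fibπ g s) = T.fibπ g (Hom.lin φ s) := fibLift_fibπ _
  have hqg : ∀ s, qg (T.fibπ g s) = (coker φ).fibπ g (Hom.lin q s) := fibLift_fibπ _
  have hqs : Function.Surjective qg := fibLift_surjective _ (((coker φ).fibπ_surjective g).comp hq)
  -- Right exactness: a vector that dies in the fibre of the cokernel is corrected by an element of
  -- m_g T to come from `S`.
  have hle : LinearMap.ker qg ≤ LinearMap.range φg := by
    intro y hy
    obtain ⟨t, rfl⟩ := T.fibπ_surjective g y
    rw [LinearMap.mem_ker, hqg, fibπ_eq_zero] at hy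
    obtain ⟨t', ht', e⟩ := mem_smul_top_of_surjective q hq _ hy
    have h0 : Hom.lin q (t - t') = 0 := by rw [map_sub, e, sub_self]
    obtain ⟨s', hs'⟩ := (exact_cokerπ φ _).1 h0
    refine ⟨S.fibπ g s', ?_⟩
    rw [hφg, hs', map_sub, (T.fibπ_eq_zero g t').2 ht', sub_zero]
  have d3 := qg.finrank_range_add_finrank_ker
  rw [LinearMap.range_eq_top.2 hqs, finrank_top] at d3
  have d4 := φg.finrank_range_add_finrank_ker
  have d5 := Submodule.finrank_mono hle
  have d6 : Module.finrank k (LinearMap.ker φg) = 0 := by omega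
  have hker : LinearMap.ker φg = ⊥ := Submodule.finrank_eq_zero.1 d6
  rw [← fibπ_eq_zero]
  refine (LinearMap.ker_eq_bot'.1 hker) _ ?_
  rw [hφg]
  exact (T.fibπ_eq_zero g _).2 hs

/-- The fibre of the kernel maps onto the kernel on fibres: factor `φ` through S / ker φ, which
embeds in `T`, and apply left exactness there. It corrects approximate solutions of an equation to
exact ones. -/
theorem exists_ker_sub_mem_smul_top {g : Pt k OG k} (hS : KilledBy (D.orbitIdeal g) S)
    (hT : KilledBy (D.orbitIdeal g) T) (φ : S ⟶ T) {s : S.carrier}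
    (hs : Hom.lin φ s ∈ RingHom.ker g.hom • (⊤ : Submodule OG T.carrier)) :
    ∃ t : (ker φ).carrier,
      s - Hom.lin (kerι φ) t ∈ RingHom.ker g.hom • (⊤ : Submodule OG S.carrier) := by
  set q := cokerπ (kerι φ)
  have hq : Function.Surjective (Hom.lin q) := cokerπ_surjective _
  have hqk : ∀ s, Hom.lin q s = 0 ↔ Hom.lin φ s = 0 := fun s =>
    (exact_cokerπ (kerι φ) s).trans (exact_kerι φ s).symm
  obtain ⟨χ, hχ⟩ := exists_desc q hq φ fun s => (hqk s).1
  have hχi : Function.Injective (Hom.lin χ) := by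
    rw [injective_iff_map_eq_zero]
    intro t ht
    obtain ⟨s, rfl⟩ := hq t
    rw [hχ] at ht
    exact (hqk s).2 ht
  have h1 : Hom.lin q s ∈ RingHom.ker g.hom • (⊤ : Submodule OG (coker (kerι φ)).carrier) :=
    mem_smul_top_of_injective (hS.of_surjective q hq) hT χ hχi (by rwa [hχ])
  obtain ⟨s', hs', e⟩ := mem_smul_top_of_surjective q hq _ h1
  have h2 : Hom.lin φ (s - s') = 0 := (hqk _).1 (by rw [map_sub, e, sub_self])
  obtain ⟨t, ht⟩ := (exact_kerι φ _).1 h2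
  refine ⟨t, ?_⟩
  rwa [ht, sub_sub_cancel]

end BiSheaf

end Exactness


/-! ### Induction from the stabilizer -/

section Induction

variable {k OG OH OK : Type u} [Field k] [CommRing OG] [HopfAlgebra k OG]
  [CommRing OH] [HopfAlgebra k OH] [CommRing OK] [HopfAlgebra k OK]
  {D : Datum k OG OH OK} {g : Pt k OG k}
  {R R' : Type u} [CommRing R] [Algebra k R] [CommRing R'] [Algebra k R']

namespace Datum

/-- Base change of a point of the stabilizer. -/
def stabMap (φ : R →ₐ[k] R') (l : D.stab g R) : D.stab g R' :=
  ⟨((toH l).map φ, (toK l).map φ), by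
    have hl : D.inH (toH l) = g.const R * D.inK (toK l) * (g.const R)⁻¹ := l.2
    have := congrArg (Pt.map φ) hl
    rw [Pt.map_mul, Pt.map_mul, Pt.map_inv, Pt.const_map] at this
    exact this⟩

@[simp] theorem toH_stabMap (φ : R →ₐ[k] R') (l : D.stab g R) :
    toH (stabMap φ l) = (toH l).map φ := rfl

@[simp] theorem toK_stabMap (φ : R →ₐ[k] R') (l : D.stab g R) :
    toK (stabMap φ l) = (toK l).map φ := rfl

@[simp] theorem toH_mul (l m : D.stab g R) : toH (l * m) = toH l * toH m := rfl
@[simp] theorem toK_mul (l m : D.stab g R) : toK (l * m) = toK l * toK m := rfl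
@[simp] theorem toH_one : toH (1 : D.stab g R) = 1 := rfl
@[simp] theorem toK_one : toK (1 : D.stab g R) = 1 := rfl

theorem stabMap_inv (φ : R →ₐ[k] R') (l : D.stab g R) :
    stabMap φ l⁻¹ = (stabMap φ l)⁻¹ := rfl

theorem stabHom_comp_mk (l : D.stab g R) :
    (stabHom l).comp (Ideal.Quotient.mkₐ k _) = pt (toH l) (toK l) := rfl

theorem stabHom_stabMap (φ : R →ₐ[k] R') (l : D.stab g R) :
    stabHom (stabMap φ l) = φ.comp (stabHom l) := by
  apply Ideal.Quotient.algHom_ext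
  change pt ((toH l).map φ) ((toK l).map φ) = φ.comp (pt (toH l) (toK l))
  rw [comp_pt]

/-- The universal point of the stabilizer. -/
def stabGen (D : Datum k OG OH OK) (g : Pt k OG k) : D.stab g (D.OL g) :=
  ((stabHom_bijective g (D.OL g)).2 (AlgHom.id k _)).choose

theorem stabHom_stabGen : stabHom (stabGen D g) = AlgHom.id k _ :=
  ((stabHom_bijective g (D.OL g)).2 (AlgHom.id k _)).choose_spec

theorem stabMap_stabGen (l : D.stab g R) : stabMap (stabHom l) (stabGen D g) = l :=
  (stabHom_bijective g R).1 (by rw [stabHom_stabMap, stabHom_stabGen, AlgHom.comp_id])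

theorem pt_stabGen : pt (toH (stabGen D g)) (toK (stabGen D g)) =
    Ideal.Quotient.mkₐ k (D.stabIdeal g) := by
  rw [← stabHom_comp_mk, stabHom_stabGen, AlgHom.id_comp]

theorem xi_map (φ : R →ₐ[k] R') (l m : D.stab g R) :
    Units.map (φ : R →* R') (D.xi g l m) = D.xi g (stabMap φ l) (stabMap φ m) := by
  simp only [xi, map_mul, map_inv, ev₂_map, ev₃_map, inH_map, inK_map, Pt.const_map,
    toH_stabMap, toK_stabMap]

/-- The stabilizer is the fibre of the orbit map. -/
theorem stabIdeal_le_map (D : Datum k OG OH OK) (g : Pt k OG k) :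
    D.stabIdeal g ≤ (RingHom.ker g.hom).map (D.orbitMap g) := by
  set J := (RingHom.ker g.hom).map (D.orbitMap g)
  let p : OH ⊗[k] OK →ₐ[k] (OH ⊗[k] OK) ⧸ J := Ideal.Quotient.mkₐ k J
  -- The universal point of the fibre of the orbit map over `g` satisfies h⁻¹gc = g, hence is a
  -- point of the stabilizer.
  obtain ⟨h, c, hp⟩ := exists_eq_pt p
  have e : D.orbitPt g h c = g.const _ := by
    ext f
    rw [← pt_orbitMap, ← hp]
    change Ideal.Quotient.mk J (D.orbitMap g f) = algebraMap k _ (g.hom f)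
    have h1 : Ideal.Quotient.mk J (D.orbitMap g (f - algebraMap k OG (g.hom f))) = 0 :=
      Ideal.Quotient.eq_zero_iff_mem.2 (Ideal.mem_map_of_mem _ (by simp [RingHom.mem_ker]))
    rw [map_sub, map_sub, sub_eq_zero, AlgHom.commutes] at h1
    exact h1
  have e' : D.inH h = g.const _ * D.inK c * (g.const _)⁻¹ := by
    rw [orbitPt, mul_assoc, inv_mul_eq_iff_eq_mul] at e
    rw [eq_mul_inv_iff_mul_eq]
    exact e.symm
  have hl : ∀ a ∈ D.stabIdeal g, p a = 0 := by
    rw [hp]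
    exact stabIdeal_le_ker (D := D) (g := g) ⟨(h, c), e'⟩
  exact fun a ha => Ideal.Quotient.eq_zero_iff_mem.1 (hl a ha)

end Datum

namespace ProjRep

variable (V : ProjRep D g)

theorem opT_eq (l : D.stab g R) : V.opT l = applyAt V.coact (Datum.stabHom l) := rfl

theorem bc_opT (φ : R →ₐ[k] R') (l : D.stab g R) (y : R ⊗[k] V.carrier) :
    bc φ _ (V.opT l y) = V.opT (Datum.stabMap φ l) (bc φ _ y) := by
  rw [opT_eq, opT_eq, bc_applyAt, Datum.stabHom_stabMap]

@[simp] theorem opT_one (y : R ⊗[k] V.carrier) : V.opT 1 y = y :=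
  DFunLike.congr_fun (V.coact_one R) y

theorem opT_opT (l m : D.stab g R) (y : R ⊗[k] V.carrier) :
    V.opT m (V.opT l y) = (D.xi g l m)⁻¹ • V.opT (l * m) y :=
  DFunLike.congr_fun (V.coact_mul R l m) y

/-- T_{l⁻¹} T_l is multiplication by a unit. -/
theorem opT_injective (l : D.stab g R) : Function.Injective (V.opT l) := by
  intro y y' h
  have := congrArg (V.opT l⁻¹) h
  rw [opT_opT, opT_opT, mul_inv_cancel, opT_one, opT_one] at this
  exact smul_left_cancel _ this

end ProjRep

variable [FiniteDimensional k OH] [FiniteDimensional k OK]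

/-- The orbit map is constant with value `g` on the stabilizer, so restricting functions to it
factors through the fibre at `g`. -/
theorem Coind.bc_mk_atPoint (V : Type u) [AddCommGroup V] [Module k V] [FiniteDimensional k V] :
    AtPoint g (bc (Ideal.Quotient.mkₐ k (D.stabIdeal g)) V ∘ₗ
      (Coind.fn (D := D) (g := g) (V := V)).toLinearMap) := by
  intro f F
  have h3 : Ideal.Quotient.mkₐ k (D.stabIdeal g) (D.orbitMap g f) = algebraMap k _ (g.hom f) := by
    rw [← Datum.pt_stabGen, Datum.pt_orbitMap, Datum.orbitPt_stab]
    rfl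
  rw [LinearMap.comp_apply, LinearMap.comp_apply, LinearEquiv.coe_coe, Coind.fn_smul, bc_smul, h3,
    algebraMap_smul]

namespace ProjRep

variable (V : ProjRep D g)

/-- The obstruction to being induced. -/
def indObstruction : (Coind D g V.carrier).carrier →ₗ[k] D.OL g ⊗[k] V.carrier :=
  (V.opT (Datum.stabGen D g)).restrictScalars k ∘ₗ
      bc (Ideal.Quotient.mkₐ k (D.stabIdeal g)) V.carrier ∘ₗ Coind.fn.toLinearMap -
    TensorProduct.mk k (D.OL g) V.carrier 1 ∘ₗ Coind.evOne D g V.carrier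

/-- At `l` the obstruction is T_l F(l, l') − F(1, 1), the failure of the invariance condition at the
unit. -/
theorem evalAt_indObstruction (l : D.stab g R) (y : R ⊗[k] (Coind D g V.carrier).carrier) :
    evalAt V.carrier (Datum.stabHom l) (V.indObstruction.baseChange R y) =
      V.opT l (Coind.val (Datum.toH l) (Datum.toK l) y) - Coind.val 1 1 y := by
  suffices evalAt V.carrier (Datum.stabHom l) ∘ₗ V.indObstruction.baseChange R =
      V.opT l ∘ₗ Coind.val (Datum.toH l) (Datum.toK l) - Coind.val 1 1 from
    DFunLike.congr_fun this y
  refine ext_one_tmul fun F => ?_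
  rw [LinearMap.comp_apply, LinearMap.baseChange_tmul, evalAt_one_tmul, LinearMap.sub_apply,
    LinearMap.comp_apply, ← Coind.evOne_baseChange, LinearMap.baseChange_tmul]
  refine (map_sub (bc (Datum.stabHom l) V.carrier) _ _).trans ?_
  congr 1
  · refine (V.bc_opT _ _ _).trans ?_
    rw [Datum.stabMap_stabGen, Coind.val_one_tmul]
    exact congrArg _ (bc_bc _ _ _)
  · change bc _ _ ((1 : D.OL g) ⊗ₜ Coind.evOne D g V.carrier F) = _
    rw [bc_tmul, map_one]

theorem indObstruction_atPoint : AtPoint g V.indObstruction := by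
  intro f F
  refine (congrArg₂ (· - ·) (congrArg (V.opT (Datum.stabGen D g)) (Coind.bc_mk_atPoint _ f F))
    (congrArg ((1 : D.OL g) ⊗ₜ[k] ·) (Coind.evOne_atPoint f F))).trans ?_
  rw [LinearMap.map_smul_of_tower, tmul_smul]
  exact (smul_sub _ _ _).symm

/-- The values of the obstruction. -/
theorem evalAt_frob_indObstruction (l : D.stab g R) (h : Pt k OH R) (c : Pt k OK R)
    (F : (Coind D g V.carrier).carrier) :
    evalAt V.carrier (Datum.stabHom l)
        (bc (pt h c) _ (Coind.fn (frob g (Coind D g V.carrier) V.indObstruction F))) =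
      D.theta g l h c • V.opT l (bc (pt (Datum.toH l * h) (Datum.toK l * c)) _ (Coind.fn F)) -
        bc (pt h c) _ (Coind.fn F) := by
  rw [bc_frob, Units.smul_def, map_smul, evalAt_indObstruction, smul_sub, ← map_smul,
    ← Units.smul_def, ← Units.smul_def, Coind.val_stab, ← Coind.val_eq, Coind.val_one_tmul,
    Coind.val_one_tmul, Units.smul_def, map_smul]
  rfl

/-- Frobenius reciprocity spreads the condition at the unit to all (h, c), the factor Θ arising on
the way. The induced functions thus form the kernel of a morphism. -/
theorem frob_indObstruction_eq_zero_iff (F : (Coind D g V.carrier).carrier) :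
    frob g (Coind D g V.carrier) V.indObstruction F = 0 ↔ Coind.fn F ∈ V.inducedSet := by
  constructor
  · intro hF R _ _ l h c
    have := V.evalAt_frob_indObstruction l h c F
    rw [hF, map_zero, map_zero, map_zero, eq_comm, sub_eq_zero] at this
    change V.opT l (bc (pt _ _) _ _) = (D.theta g l h c)⁻¹ • bc (pt _ _) _ _
    rw [← this, inv_smul_smul]
  · intro hF
    refine Coind.ext_fn fun R _ _ h c => ?_
    refine ext_evalAt fun R' _ _ φ p => ?_
    obtain ⟨l, rfl⟩ := (Datum.stabHom_bijective g R').2 p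
    rw [bc_bc, comp_pt, evalAt_frob_indObstruction]
    have := hF R' l (h.map φ) (c.map φ)
    change V.opT l (bc (pt _ _) _ _) = (D.theta g l _ _)⁻¹ • bc (pt _ _) _ _ at this
    rw [this, smul_inv_smul, sub_self]
    simp

end ProjRep

/-- Frobenius reciprocity: the morphism to a coinduced sheaf. -/
def frobHom {S : BiSheaf D} {V : Type u} [AddCommGroup V] [Module k V] [FiniteDimensional k V]
    (π : S.carrier →ₗ[k] V) (hπ : AtPoint g π) : S ⟶ Coind D g V :=
  BiSheaf.Hom.ofLin (frob g S π) (frob_mem_homs hπ)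

/-- All factors are 1 at the unit by normalization; evaluation there recovers π from its morphism.
-/
theorem Coind.evOne_frob {S : BiSheaf D} {V : Type u} [AddCommGroup V] [Module k V]
    [FiniteDimensional k V] (π : S.carrier →ₗ[k] V) (s : S.carrier) :
    Coind.evOne D g V (frob g S π s) = π s := by
  change TensorProduct.lid k V (bc (pt 1 1) V (Coind.fn (frob g S π s))) = _
  rw [bc_frob, Datum.frobFactor_one_one, one_smul, inv_one, BiSheaf.lamAt_one, BiSheaf.rhoAt_one,
    LinearMap.baseChange_tmul, TensorProduct.lid_tmul, one_smul]

theorem Coind.killedBy (V : Type u) [AddCommGroup V] [Module k V] [FiniteDimensional k V] :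
    BiSheaf.KilledBy (D.orbitIdeal g) (Coind D g V) := by
  intro f hf F
  apply Coind.fn.injective
  rw [Coind.fn_smul, show D.orbitMap g f = 0 from hf, zero_smul, map_zero]

/-- A function that vanishes on the stabilizer has coefficients in its ideal, which is contained in
the ideal generated by the pullback of m_g, as the stabilizer is the fibre of the orbit map. -/
theorem Coind.mem_smul_top {V : Type u} [AddCommGroup V] [Module k V] [FiniteDimensional k V]
    {F : (Coind D g V).carrier}
    (hF : bc (Ideal.Quotient.mkₐ k (D.stabIdeal g)) V (Coind.fn F) = 0) :
    F ∈ RingHom.ker g.hom • (⊤ : Submodule OG (Coind D g V).carrier) := by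
  have h1 := mem_ker_smul_top_of_bc_eq_zero
    (Ideal.Quotient.mkₐ_surjective k (D.stabIdeal g)) hF
  suffices h : ∀ x ∈ RingHom.ker (Ideal.Quotient.mkₐ k (D.stabIdeal g)) •
      (⊤ : Submodule (OH ⊗[k] OK) ((OH ⊗[k] OK) ⊗[k] V)),
      Coind.fn.symm x ∈ RingHom.ker g.hom • (⊤ : Submodule OG (Coind D g V).carrier) by
    simpa using h _ h1
  intro x hx
  refine Submodule.smul_induction_on hx (fun a ha y _ => ?_) fun x y hx hy => ?_
  · have ha : a ∈ D.stabIdeal g := Ideal.Quotient.eq_zero_iff_mem.1 ha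
    have ha' := Datum.stabIdeal_le_map D g ha
    clear ha hx
    revert y
    refine Submodule.span_induction (p := fun a _ => ∀ y ∈ (⊤ : Submodule _ _), Coind.fn.symm (a • y) ∈
      RingHom.ker g.hom • (⊤ : Submodule OG (Coind D g V).carrier)) ?_ ?_ ?_ ?_ ha'
    · rintro _ ⟨f, hf, rfl⟩ y _
      have : Coind.fn.symm (D.orbitMap g f • y) =
          f • (Coind.fn.symm y : (Coind D g V).carrier) := rfl
      change Coind.fn.symm (D.orbitMap g f • y) ∈ _
      rw [this]
      exact Submodule.smul_mem_smul hf trivial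
    · intro y _
      rw [zero_smul, map_zero]
      exact Submodule.zero_mem _
    · intro a b _ _ ha hb y hy
      rw [add_smul, map_add]
      exact Submodule.add_mem _ (ha y hy) (hb y hy)
    · intro b a _ ha y _
      rw [smul_eq_mul, mul_comm, mul_smul]
      exact ha _ trivial
  · rw [map_add]
    exact Submodule.add_mem _ hx hy

namespace ProjRep

variable (V : ProjRep D g)

/-- The induced sheaf. -/
def ind : BiSheaf D := BiSheaf.ker (frobHom V.indObstruction V.indObstruction_atPoint)

/-- The inclusion of the induced sheaf in the coinduced sheaf. -/
def indι : V.ind ⟶ Coind D g V.carrier :=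
  BiSheaf.kerι (frobHom V.indObstruction V.indObstruction_atPoint)

theorem indι_injective : Function.Injective (BiSheaf.Hom.lin V.indι) := BiSheaf.kerι_injective _

theorem mem_range_indι (F : (Coind D g V.carrier).carrier) :
    F ∈ LinearMap.range (BiSheaf.Hom.lin V.indι) ↔ Coind.fn F ∈ V.inducedSet :=
  (BiSheaf.exact_kerι _ F).symm.trans (V.frob_indObstruction_eq_zero_iff F)

theorem frob_indObstruction_indι (F : V.ind.carrier) :
    frob g (Coind D g V.carrier) V.indObstruction (BiSheaf.Hom.lin V.indι F) = 0 :=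
  (BiSheaf.exact_kerι _ _).2 ⟨F, rfl⟩

theorem ind_killedBy : BiSheaf.KilledBy (D.orbitIdeal g) V.ind :=
  (Coind.killedBy V.carrier).of_injective V.indι V.indι_injective

/-- The value at the unit of a section of the induced sheaf. -/
def indEv : V.ind.carrier →ₗ[k] V.carrier :=
  Coind.evOne D g V.carrier ∘ₗ BiSheaf.Hom.lin V.indι

theorem indEv_atPoint : AtPoint g V.indEv := by
  intro f F
  rw [indEv, LinearMap.comp_apply, (BiSheaf.Hom.lin_mem V.indι).1, Coind.evOne_atPoint]
  rfl

/-- The invariance condition at h = c = 1: on the stabilizer a section is determined by its value at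
the unit. -/
theorem opT_val_indι (l : D.stab g R) (F : V.ind.carrier) :
    V.opT l (Coind.val (Datum.toH l) (Datum.toK l) (1 ⊗ₜ BiSheaf.Hom.lin V.indι F)) =
      1 ⊗ₜ V.indEv F := by
  have h0 : V.indObstruction (BiSheaf.Hom.lin V.indι F) = 0 := by
    rw [← Coind.evOne_frob (g := g) V.indObstruction, frob_indObstruction_indι, map_zero]
  have := V.evalAt_indObstruction l (1 ⊗ₜ BiSheaf.Hom.lin V.indι F)
  rw [LinearMap.baseChange_tmul, h0, tmul_zero, map_zero, eq_comm, sub_eq_zero,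
    ← Coind.evOne_baseChange, LinearMap.baseChange_tmul] at this
  exact this

variable [IsAlgClosed k] [FiniteDimensional k OG]

/-- If the value at the unit is zero, the section vanishes on the whole stabilizer, so it lies in
m_g Coind. Left exactness of the fibre brings it back to m_g Ind. -/
theorem mem_smul_top_of_indEv_eq_zero {F : V.ind.carrier} (hF : V.indEv F = 0) :
    F ∈ RingHom.ker g.hom • (⊤ : Submodule OG V.ind.carrier) := by
  refine BiSheaf.mem_smul_top_of_injective V.ind_killedBy (Coind.killedBy V.carrier) V.indι
    V.indι_injective (Coind.mem_smul_top ?_)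
  have := V.opT_val_indι (Datum.stabGen D g) F
  rw [hF, tmul_zero, ← map_zero (V.opT (Datum.stabGen D g))] at this
  have h1 := V.opT_injective _ this
  rwa [Coind.val_one_tmul, Datum.pt_stabGen] at h1

/-- A section with value `v` at the unit is forced on the stabilizer. Any extension of it to H × K
satisfies the invariance condition modulo m_g, and exactness of the fibre corrects it to a true
section. -/
theorem indEv_surjective : Function.Surjective V.indEv := by
  intro v
  -- This is T_l⁻¹ v; the multiplier comes from T_l T_{l⁻¹} = ξ(l⁻¹, l)⁻¹.
  let t : ∀ {R : Type u} [CommRing R] [Algebra k R] (_ : D.stab g R), R ⊗[k] V.carrier :=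
    fun l => D.xi g l⁻¹ l • V.opT l⁻¹ (1 ⊗ₜ v)
  have ht : ∀ {R : Type u} [CommRing R] [Algebra k R] (l : D.stab g R), V.opT l (t l) = 1 ⊗ₜ v := by
    intro R _ _ l
    simp only [t]
    rw [Units.smul_def, map_smul, ← Units.smul_def, opT_opT, inv_mul_cancel, opT_one,
      smul_inv_smul]
  have htm : ∀ {R R' : Type u} [CommRing R] [Algebra k R] [CommRing R'] [Algebra k R']
      (φ : R →ₐ[k] R') (l : D.stab g R), bc φ _ (t l) = t (Datum.stabMap φ l) := by
    intro R R' _ _ _ _ φ l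
    simp only [t]
    rw [bc_units_smul, bc_opT, Datum.xi_map, bc_tmul, map_one, Datum.stabMap_inv]
  -- Functions on the closed subscheme L^g extend to H × K; the choice of the extension does not
  -- matter.
  obtain ⟨f, hf⟩ : ∃ f, bc (Ideal.Quotient.mkₐ k (D.stabIdeal g)) V.carrier f =
      t (Datum.stabGen D g) :=
    LinearMap.rTensor_surjective V.carrier (Ideal.Quotient.mkₐ_surjective k (D.stabIdeal g)) _
  have hfl : ∀ {R : Type u} [CommRing R] [Algebra k R] (l : D.stab g R),
      bc (pt (Datum.toH l) (Datum.toK l)) _ f = t l := by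
    intro R _ _ l
    rw [← Datum.stabHom_comp_mk, ← bc_bc, hf, htm, Datum.stabMap_stabGen]
  let F : (Coind D g V.carrier).carrier := Coind.fn.symm f
  have hF : Coind.fn F = f := Coind.fn.apply_symm_apply f
  -- On the stabilizer Θ restricts to ξ, and the condition reads ξ(l, m) T_l T_{lm}⁻¹ v = T_m⁻¹ v,
  -- which is the projective multiplicativity of T.
  have hmem : BiSheaf.Hom.lin (frobHom V.indObstruction V.indObstruction_atPoint) F ∈
      RingHom.ker g.hom • (⊤ : Submodule OG (Coind D g (D.OL g ⊗[k] V.carrier)).carrier) := by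
    refine Coind.mem_smul_top (ext_evalAt fun R' _ _ φ p => ?_)
    obtain ⟨l, rfl⟩ := (Datum.stabHom_bijective g R').2 p
    rw [← Datum.pt_stabGen, bc_bc, comp_pt, ← Datum.toH_stabMap, ← Datum.toK_stabMap]
    refine (V.evalAt_frob_indObstruction _ _ _ _).trans ?_
    rw [hF, Datum.theta_stab, ← Datum.toH_mul, ← Datum.toK_mul, hfl, hfl, map_zero, map_zero,
      sub_eq_zero]
    apply V.opT_injective (Datum.stabMap φ (Datum.stabGen D g))
    rw [Units.smul_def, map_smul, ← Units.smul_def, opT_opT, smul_inv_smul, ht, ht]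
  obtain ⟨s, hs⟩ := BiSheaf.exists_ker_sub_mem_smul_top (Coind.killedBy V.carrier)
    (Coind.killedBy _) (frobHom V.indObstruction V.indObstruction_atPoint) hmem
  refine ⟨s, ?_⟩
  -- The correction lies in m_g Coind, so it does not change the value at the unit.
  have h1 := BiSheaf.eq_zero_of_atPoint Coind.evOne_atPoint hs
  rw [map_sub, sub_eq_zero] at h1
  refine h1.symm.trans ?_
  change TensorProduct.lid k V.carrier (bc (pt 1 1) _ (Coind.fn F)) = v
  have h2 := hfl (1 : D.stab g k)
  have h3 := ht (1 : D.stab g k)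
  rw [opT_one] at h3
  rw [Datum.toH_one, Datum.toK_one, h3] at h2
  rw [hF, h2, TensorProduct.lid_tmul, one_smul]

end ProjRep

end Induction


/-! ### The induction functor -/

section InductionFunctor

variable {k OG OH OK : Type u} [Field k] [CommRing OG] [HopfAlgebra k OG]
  [CommRing OH] [HopfAlgebra k OH] [CommRing OK] [HopfAlgebra k OK]
  {D : Datum k OG OH OK} {g : Pt k OG k}
  {R R' : Type u} [CommRing R] [Algebra k R] [CommRing R'] [Algebra k R']

namespace ProjRep

variable {V W : ProjRep D g}

theorem Hom.ext_lin {φ χ : V ⟶ W} (h : ∀ v, Hom.lin φ v = Hom.lin χ v) : φ = χ :=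
  Subtype.ext (LinearMap.ext h)

/-- The morphism given by an element of `homs`. -/
def Hom.ofLin (f : V.carrier →ₗ[k] W.carrier) (hf : f ∈ homs V W) : V ⟶ W := ⟨f, hf⟩

theorem opT_baseChange (φ : V ⟶ W) (l : D.stab g R) (y : R ⊗[k] V.carrier) :
    W.opT l ((Hom.lin φ).baseChange R y) = (Hom.lin φ).baseChange R (V.opT l y) :=
  applyAt_baseChange φ.2 _ y

theorem mem_homs_of_points {f : V.carrier →ₗ[k] W.carrier}
    (h : ∀ (R : Type u) [CommRing R] [Algebra k R] (l : D.stab g R) (y : R ⊗[k] V.carrier),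
      W.opT l (f.baseChange R y) = f.baseChange R (V.opT l y)) : f ∈ homs V W := by
  refine lTensor_comp_of_applyAt fun v => ?_
  have := h (D.OL g) (Datum.stabGen D g) (1 ⊗ₜ v)
  rw [opT_eq, opT_eq, Datum.stabHom_stabGen, LinearMap.baseChange_tmul] at this
  exact this

theorem lTensor_mem_inducedSet (φ : V ⟶ W) {F : (OH ⊗[k] OK) ⊗[k] V.carrier}
    (hF : F ∈ V.inducedSet) : (Hom.lin φ).lTensor (OH ⊗[k] OK) F ∈ W.inducedSet := by
  intro R _ _ l h c
  have e : ∀ (h : Pt k OH R) (c : Pt k OK R),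
      W.valAt h c ((Hom.lin φ).lTensor (OH ⊗[k] OK) F) =
        (Hom.lin φ).baseChange R (V.valAt h c F) := fun h c => bc_baseChange (pt h c) (Hom.lin φ) F
  rw [e, e, opT_baseChange, hF, map_smul]

end ProjRep

variable [FiniteDimensional k OH] [FiniteDimensional k OK]

namespace Coind

variable {V W : Type u} [AddCommGroup V] [Module k V] [FiniteDimensional k V]
  [AddCommGroup W] [Module k W] [FiniteDimensional k W]

/-- Uniqueness in Frobenius reciprocity: all values of a section are values at the unit of its
translates. -/
theorem hom_ext {S : BiSheaf D} {φ χ : S ⟶ Coind D g V}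
    (h : ∀ s, evOne D g V (BiSheaf.Hom.lin φ s) = evOne D g V (BiSheaf.Hom.lin χ s)) : φ = χ := by
  have h' : evOne D g V ∘ₗ BiSheaf.Hom.lin φ = evOne D g V ∘ₗ BiSheaf.Hom.lin χ :=
    LinearMap.ext h
  refine BiSheaf.Hom.ext_lin fun s => ext_fn fun R _ _ a c => ?_
  have e : ∀ (φ : S ⟶ Coind D g V), bc (pt a c) V (fn (BiSheaf.Hom.lin φ s)) =
      D.frobFactor g a c • (evOne D g V ∘ₗ BiSheaf.Hom.lin φ).baseChange R
        (S.rhoAt c (S.lamAt a⁻¹ (1 ⊗ₜ s))) := by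
    intro φ
    rw [← val_one_tmul, ← LinearMap.baseChange_tmul, val_hom (BiSheaf.Hom.lin_mem φ),
      ← evOne_baseChange, LinearMap.baseChange_comp, LinearMap.comp_apply]
  rw [e, e, h']

/-- Composition of sections of the coinduced sheaf with a linear map. -/
def map (f : V →ₗ[k] W) : Coind D g V ⟶ Coind D g W :=
  frobHom (f ∘ₗ evOne D g V) fun a F => by
    rw [LinearMap.comp_apply, evOne_atPoint, map_smul]
    rfl

/-- The morphism obtained from Frobenius reciprocity is composition with `f`, since both are
determined by values at the unit. -/
theorem fn_map (f : V →ₗ[k] W) (F : (Coind D g V).carrier) :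
    fn (BiSheaf.Hom.lin (map f) F) = f.lTensor (OH ⊗[k] OK) (fn F) := by
  refine ext_bc fun R _ _ p => ?_
  obtain ⟨a, c, rfl⟩ := exists_eq_pt p
  refine (bc_frob _ a c F).trans ?_
  rw [LinearMap.baseChange_comp, LinearMap.comp_apply, evOne_baseChange]
  refine Eq.trans ?_ (bc_baseChange (pt a c) f (fn F)).symm
  rw [← val_one_tmul, val_eq a c, Units.smul_def, Units.smul_def, map_smul]

theorem val_map (f : V →ₗ[k] W) (a : Pt k OH R) (c : Pt k OK R)
    (y : R ⊗[k] (Coind D g V).carrier) :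
    val a c ((BiSheaf.Hom.lin (map (D := D) (g := g) f)).baseChange R y) =
      f.baseChange R (val a c y) := by
  suffices val a c ∘ₗ (BiSheaf.Hom.lin (map (D := D) (g := g) f)).baseChange R =
      f.baseChange R ∘ₗ val a c from DFunLike.congr_fun this y
  refine ext_one_tmul fun F => ?_
  rw [LinearMap.comp_apply, LinearMap.comp_apply, LinearMap.baseChange_tmul, val_one_tmul,
    val_one_tmul, fn_map]
  exact bc_baseChange (pt a c) f (fn F)

theorem evOne_map (f : V →ₗ[k] W) (F : (Coind D g V).carrier) :
    evOne D g W (BiSheaf.Hom.lin (map f) F) = f (evOne D g V F) := evOne_frob _ F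

end Coind

namespace ProjRep

variable {V W : ProjRep D g}

/-- A section of the induced sheaf as a function on `H × K`. -/
def indFn (V : ProjRep D g) : V.ind.carrier →ₗ[k] (OH ⊗[k] OK) ⊗[k] V.carrier :=
  Coind.fn.toLinearMap ∘ₗ BiSheaf.Hom.lin V.indι

theorem indFn_injective (V : ProjRep D g) : Function.Injective V.indFn :=
  Coind.fn.injective.comp V.indι_injective

theorem range_indFn (V : ProjRep D g) : Set.range V.indFn = V.inducedSet := by
  ext F
  refine Iff.trans ?_ (V.mem_range_indι (Coind.fn.symm F))
  constructor
  · rintro ⟨s, rfl⟩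
    exact ⟨s, rfl⟩
  · rintro ⟨s, hs⟩
    exact ⟨s, congrArg Coind.fn hs⟩

theorem exists_indMap (φ : V ⟶ W) : ∃ χ : V.ind ⟶ W.ind, ∀ s,
    BiSheaf.Hom.lin W.indι (BiSheaf.Hom.lin χ s) =
      BiSheaf.Hom.lin (V.indι ≫ Coind.map (Hom.lin φ)) s := by
  refine BiSheaf.exists_lift W.indι W.indι_injective _ fun s => ?_
  rw [mem_range_indι, BiSheaf.Hom.lin_comp, LinearMap.comp_apply, Coind.fn_map]
  exact lTensor_mem_inducedSet φ ((V.mem_range_indι _).1 ⟨s, rfl⟩)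

/-- The morphism of induced sheaves given by a morphism of representations. -/
def indMap (φ : V ⟶ W) : V.ind ⟶ W.ind := (exists_indMap φ).choose

theorem indι_indMap (φ : V ⟶ W) (s : V.ind.carrier) :
    BiSheaf.Hom.lin W.indι (BiSheaf.Hom.lin (indMap φ) s) =
      BiSheaf.Hom.lin (Coind.map (Hom.lin φ)) (BiSheaf.Hom.lin V.indι s) :=
  (exists_indMap φ).choose_spec s

theorem indFn_indMap (φ : V ⟶ W) (s : V.ind.carrier) :
    W.indFn (BiSheaf.Hom.lin (indMap φ) s) = (Hom.lin φ).lTensor (OH ⊗[k] OK) (V.indFn s) := by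
  refine (congrArg Coind.fn (indι_indMap φ s)).trans ?_
  rw [Coind.fn_map]
  rfl

theorem indEv_indMap (φ : V ⟶ W) (s : V.ind.carrier) :
    W.indEv (BiSheaf.Hom.lin (indMap φ) s) = Hom.lin φ (V.indEv s) := by
  rw [indEv, LinearMap.comp_apply, indι_indMap, Coind.evOne_map]
  rfl

theorem indFn_smul (V : ProjRep D g) (f : OG) (s : V.ind.carrier) :
    V.indFn (f • s) = D.orbitMap g f • V.indFn s := by
  rw [indFn, LinearMap.comp_apply, (BiSheaf.Hom.lin_mem V.indι).1]
  exact Coind.fn_smul f _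

theorem liftBaseChange_indFn (V : ProjRep D g) (h : Pt k OH R) (c : Pt k OK R)
    (y : R ⊗[k] V.ind.carrier) :
    LinearMap.liftBaseChange R (V.valAt h c ∘ₗ V.indFn) y =
      Coind.val h c ((BiSheaf.Hom.lin V.indι).baseChange R y) := by
  suffices LinearMap.liftBaseChange R (V.valAt h c ∘ₗ V.indFn) =
      Coind.val h c ∘ₗ (BiSheaf.Hom.lin V.indι).baseChange R from DFunLike.congr_fun this y
  refine ext_one_tmul fun F => ?_
  rw [LinearMap.liftBaseChange_tmul, one_smul, LinearMap.comp_apply, LinearMap.comp_apply,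
    LinearMap.baseChange_tmul, Coind.val_one_tmul]
  rfl

theorem liftBaseChange_indFn_lamAt (V : ProjRep D g) (h b : Pt k OH R) (c : Pt k OK R)
    (s : V.ind.carrier) :
    LinearMap.liftBaseChange R (V.valAt h c ∘ₗ V.indFn) (V.ind.lamAt b (1 ⊗ₜ s)) =
      (D.lamFactor g b h c : R) • V.valAt (h * b⁻¹) c (V.indFn s) := by
  rw [liftBaseChange_indFn, ← BiSheaf.lamAt_baseChange (BiSheaf.Hom.lin_mem V.indι) b,
    Coind.val_lamAt, LinearMap.baseChange_tmul, Coind.val_one_tmul]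
  rfl

theorem liftBaseChange_indFn_rhoAt (V : ProjRep D g) (h : Pt k OH R) (c d : Pt k OK R)
    (s : V.ind.carrier) :
    LinearMap.liftBaseChange R (V.valAt h c ∘ₗ V.indFn) (V.ind.rhoAt d (1 ⊗ₜ s)) =
      (D.rhoFactor g d h c : R) • V.valAt h (c * d) (V.indFn s) := by
  rw [liftBaseChange_indFn, ← BiSheaf.rhoAt_baseChange (BiSheaf.Hom.lin_mem V.indι) d,
    Coind.val_rhoAt, LinearMap.baseChange_tmul, Coind.val_one_tmul]
  rfl

end ProjRep

/-- Induction from the stabilizer. -/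
def indFunctor (D : Datum k OG OH OK) (g : Pt k OG k) : ProjRep D g ⥤ BiSheaf D where
  obj V := V.ind
  map φ := ProjRep.indMap φ
  map_id V := BiSheaf.Hom.ext_lin fun s => V.indFn_injective (by
    rw [ProjRep.indFn_indMap]
    exact LinearMap.lTensor_id_apply _ _ _)
  map_comp {U V W} φ χ := BiSheaf.Hom.ext_lin fun s => W.indFn_injective (by
    rw [ProjRep.indFn_indMap]
    refine Eq.trans ?_ (ProjRep.indFn_indMap χ _).symm
    refine Eq.trans ?_ (congrArg _ (ProjRep.indFn_indMap φ s)).symm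
    exact LinearMap.lTensor_comp_apply _ _ _ _)

theorem isInduction_indFunctor (D : Datum k OG OH OK) (g : Pt k OG k) :
    IsInduction g (indFunctor D g) := by
  refine ⟨fun V => V.indFn, fun V => V.indFn_injective, fun V => V.range_indFn,
    fun V W φ s => ProjRep.indFn_indMap φ s, fun V f s => V.indFn_smul f s,
    fun V R _ _ h b c s => V.liftBaseChange_indFn_lamAt h b c s,
    fun V R _ _ h c d s => V.liftBaseChange_indFn_rhoAt h c d s⟩

variable [IsAlgClosed k] [FiniteDimensional k OG]

namespace ProjRep

variable {V W : ProjRep D g}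

/-- Followed by the injective T_l, evaluation at (l, l') is evaluation at the unit, which is onto.
-/
theorem val_indι_surjective (V : ProjRep D g) (l : D.stab g R) : Function.Surjective
    (Coind.val (Datum.toH l) (Datum.toK l) ∘ₗ (BiSheaf.Hom.lin V.indι).baseChange R) := by
  have e : V.opT l ∘ₗ
      (Coind.val (Datum.toH l) (Datum.toK l) ∘ₗ (BiSheaf.Hom.lin V.indι).baseChange R) =
      V.indEv.baseChange R := by
    refine ext_one_tmul fun F => ?_
    rw [LinearMap.comp_apply, LinearMap.comp_apply, LinearMap.baseChange_tmul, opT_val_indι,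
      LinearMap.baseChange_tmul]
  intro y
  obtain ⟨z, hz⟩ := LinearMap.lTensor_surjective R V.indEv_surjective (V.opT l y)
  exact ⟨z, V.opT_injective l ((DFunLike.congr_fun e z).trans hz)⟩

/-- Evaluation at the unit is the projection to the fibre, so a morphism of induced sheaves descends
to a linear map V → W. Its compatibility with T_l is read off from values on the stabilizer. -/
theorem indMap_surjective (Φ : V.ind ⟶ W.ind) : ∃ φ : V ⟶ W, indMap φ = Φ := by
  have hat : AtPoint g (W.indEv ∘ₗ BiSheaf.Hom.lin Φ) := by
    intro f F
    rw [LinearMap.comp_apply, (BiSheaf.Hom.lin_mem Φ).1, W.indEv_atPoint]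
    rfl
  obtain ⟨f, hf⟩ : ∃ f : V.carrier →ₗ[k] W.carrier, ∀ F,
      f (V.indEv F) = W.indEv (BiSheaf.Hom.lin Φ F) := by
    refine ⟨(LinearMap.ker V.indEv).liftQ (W.indEv ∘ₗ BiSheaf.Hom.lin Φ) (fun F hF =>
      BiSheaf.eq_zero_of_atPoint hat (V.mem_smul_top_of_indEv_eq_zero hF)) ∘ₗ
        (V.indEv.quotKerEquivOfSurjective V.indEv_surjective).symm.toLinearMap, fun F => ?_⟩
    have : (V.indEv.quotKerEquivOfSurjective V.indEv_surjective).symm (V.indEv F) =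
        (LinearMap.ker V.indEv).mkQ F := by
      rw [LinearEquiv.symm_apply_eq]
      rfl
    rw [LinearMap.comp_apply, LinearEquiv.coe_coe, this]
    exact Submodule.liftQ_apply _ _ _
  -- Two morphisms to a coinduced sheaf that agree at the unit are equal.
  have hΦ : V.indι ≫ Coind.map f = Φ ≫ W.indι :=
    Coind.hom_ext fun F => (Coind.evOne_map f _).trans (hf F)
  have hΦ' : ∀ F, BiSheaf.Hom.lin (Coind.map f) (BiSheaf.Hom.lin V.indι F) =
      BiSheaf.Hom.lin W.indι (BiSheaf.Hom.lin Φ F) := fun F =>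
    DFunLike.congr_fun (congrArg BiSheaf.Hom.lin hΦ) F
  have hfm : f ∈ homs V W := by
    refine mem_homs_of_points fun R _ _ l y => ?_
    -- It suffices to compare on values F(l, l') of sections, where T_l F(l, l') = F(1, 1) on both
    -- sides.
    obtain ⟨z, rfl⟩ := V.val_indι_surjective l y
    suffices W.opT l ∘ₗ f.baseChange R ∘ₗ
        (Coind.val (Datum.toH l) (Datum.toK l) ∘ₗ (BiSheaf.Hom.lin V.indι).baseChange R) =
        f.baseChange R ∘ₗ V.opT l ∘ₗ
        (Coind.val (Datum.toH l) (Datum.toK l) ∘ₗ (BiSheaf.Hom.lin V.indι).baseChange R) from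
      DFunLike.congr_fun this z
    refine ext_one_tmul fun F => ?_
    simp only [LinearMap.comp_apply]
    rw [← Coind.val_map, LinearMap.baseChange_tmul, LinearMap.baseChange_tmul, hΦ', opT_val_indι,
      opT_val_indι, LinearMap.baseChange_tmul, hf]
  refine ⟨Hom.ofLin f hfm, BiSheaf.Hom.ext_lin fun s => W.indι_injective ?_⟩
  rw [indι_indMap]
  exact hΦ' s

end ProjRep

instance : (indFunctor D g).Additive where
  map_add {V W φ χ} := BiSheaf.Hom.ext_lin fun s => W.indFn_injective (by
    refine (ProjRep.indFn_indMap (φ + χ) s).trans ?_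
    refine Eq.trans ?_ (map_add W.indFn _ _).symm
    refine Eq.trans ?_ (congrArg₂ (· + ·) (ProjRep.indFn_indMap φ s)
      (ProjRep.indFn_indMap χ s)).symm
    exact DFunLike.congr_fun (LinearMap.lTensor_add _ (ProjRep.Hom.lin φ) (ProjRep.Hom.lin χ)) _)

instance : (indFunctor D g).Linear k where
  map_smul {V W} φ a := BiSheaf.Hom.ext_lin fun s => W.indFn_injective (by
    refine (ProjRep.indFn_indMap (a • φ) s).trans ?_
    refine Eq.trans ?_ (map_smul W.indFn a _).symm
    refine Eq.trans ?_ (congrArg (a • ·) (ProjRep.indFn_indMap φ s)).symm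
    exact DFunLike.congr_fun (LinearMap.lTensor_smul _ a (ProjRep.Hom.lin φ)) _)

instance : (indFunctor D g).Faithful where
  map_injective {V W φ χ} h := ProjRep.Hom.ext_lin fun v => by
    obtain ⟨s, rfl⟩ := V.indEv_surjective v
    have := congrArg (fun Φ : V.ind ⟶ W.ind => W.indEv (BiSheaf.Hom.lin Φ s)) h
    refine (ProjRep.indEv_indMap φ s).symm.trans (Eq.trans ?_ (ProjRep.indEv_indMap χ s))
    exact this

instance : (indFunctor D g).Full where
  map_surjective := ProjRep.indMap_surjective

end InductionFunctor


/-! ### The stabilizer acts on the fibre -/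

section Fibre

variable {k OG OH OK : Type u} [Field k] [CommRing OG] [HopfAlgebra k OG]
  [CommRing OH] [HopfAlgebra k OH] [CommRing OK] [HopfAlgebra k OK]
  {D : Datum k OG OH OK} {g : Pt k OG k}
  {R R' : Type u} [CommRing R] [Algebra k R] [CommRing R'] [Algebra k R']

theorem BiSheaf.fibπ_baseChange_surjective (S : BiSheaf D) :
    Function.Surjective ((S.fibπ g).baseChange R) :=
  LinearMap.lTensor_surjective R (S.fibπ_surjective g)

variable [FiniteDimensional k OH] [FiniteDimensional k OK]

namespace BiSheaf

variable (S : BiSheaf D) (g)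

theorem fibAct_atPoint : AtPoint g ((bc (Ideal.Quotient.mkₐ k (D.stabIdeal g)) (S.Fib g) ∘ₗ
    (Coind.fn (D := D) (g := g) (V := S.Fib g)).toLinearMap) ∘ₗ frob g S (S.fibπ g)) := by
  intro f s
  rw [LinearMap.comp_apply, (frob_mem_homs (S.fibπ_atPoint g)).1, Coind.bc_mk_atPoint]
  rfl

/-- The operators of the stabilizer on the fibre, inverse to those of a representation. -/
def fibAct : S.Fib g →ₗ[k] D.OL g ⊗[k] S.Fib g := fibLift (S.fibAct_atPoint g)

variable {g}

theorem applyAt_fibAct_baseChange (l : D.stab g R) (y : R ⊗[k] S.carrier) :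
    applyAt (S.fibAct g) (Datum.stabHom l) ((S.fibπ g).baseChange R y) =
      Coind.val (Datum.toH l) (Datum.toK l) ((frob g S (S.fibπ g)).baseChange R y) := by
  suffices applyAt (S.fibAct g) (Datum.stabHom l) ∘ₗ (S.fibπ g).baseChange R =
      Coind.val (Datum.toH l) (Datum.toK l) ∘ₗ (frob g S (S.fibπ g)).baseChange R from
    DFunLike.congr_fun this y
  refine ext_one_tmul fun s => ?_
  rw [LinearMap.comp_apply, LinearMap.comp_apply, LinearMap.baseChange_tmul,
    LinearMap.baseChange_tmul, applyAt_one_tmul, fibAct, fibLift_fibπ, Coind.val_one_tmul]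
  exact bc_bc _ _ _

/-- The operator of `l` on the fibre is evaluation of `frob` at (l, l'). Applied to the value at (h,
c), it moves the argument to (lh, l'c) at the cost of Θ, by `Coind.val_stab`. -/
theorem applyAt_fibAct_val (l : D.stab g R) (h : Pt k OH R) (c : Pt k OK R)
    (y : R ⊗[k] S.carrier) :
    applyAt (S.fibAct g) (Datum.stabHom l)
        (Coind.val h c ((frob g S (S.fibπ g)).baseChange R y)) =
      D.theta g l h c •
        Coind.val (Datum.toH l * h) (Datum.toK l * c) ((frob g S (S.fibπ g)).baseChange R y) := by
  have hm := frob_mem_homs (S.fibπ_atPoint g)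
  rw [val_frob, Units.smul_def, map_smul, applyAt_fibAct_baseChange, ← rhoAt_baseChange hm,
    ← lamAt_baseChange hm, ← Units.smul_def, Coind.val_stab]

/-- The previous formula at (h, c) = (m, m'), where Θ becomes ξ. -/
theorem applyAt_fibAct_applyAt (l m : D.stab g R) (y : R ⊗[k] S.Fib g) :
    applyAt (S.fibAct g) (Datum.stabHom l) (applyAt (S.fibAct g) (Datum.stabHom m) y) =
      D.xi g l m • applyAt (S.fibAct g) (Datum.stabHom (l * m)) y := by
  obtain ⟨y, rfl⟩ := S.fibπ_baseChange_surjective y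
  rw [applyAt_fibAct_baseChange, applyAt_fibAct_val, applyAt_fibAct_baseChange, Datum.theta_stab]
  rfl

theorem applyAt_fibAct_one (y : R ⊗[k] S.Fib g) :
    applyAt (S.fibAct g) (Datum.stabHom (1 : D.stab g R)) y = y := by
  obtain ⟨y, rfl⟩ := S.fibπ_baseChange_surjective y
  rw [applyAt_fibAct_baseChange, Datum.toH_one, Datum.toK_one, val_frob, D.frobFactor_one_one,
    one_smul, inv_one, lamAt_one, rhoAt_one]

theorem applyAt_fibAct_injective (l : D.stab g R) :
    Function.Injective (applyAt (S.fibAct g) (Datum.stabHom l)) := by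
  intro y y' h
  have := congrArg (applyAt (S.fibAct g) (Datum.stabHom l⁻¹)) h
  rw [applyAt_fibAct_applyAt, applyAt_fibAct_applyAt, inv_mul_cancel, applyAt_fibAct_one,
    applyAt_fibAct_one] at this
  exact smul_left_cancel _ this

/-- The coaction on the fibre. -/
def fibCoact (S : BiSheaf D) (g : Pt k OG k) : S.Fib g →ₗ[k] D.OL g ⊗[k] S.Fib g :=
  ((D.xi g (Datum.stabGen D g) (Datum.stabGen D g)⁻¹)⁻¹ •
    applyAt (S.fibAct g) (Datum.stabHom (Datum.stabGen D g)⁻¹)).restrictScalars k ∘ₗ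
      TensorProduct.mk k (D.OL g) (S.Fib g) 1

theorem applyAt_fibCoact (l : D.stab g R) (y : R ⊗[k] S.Fib g) :
    applyAt (S.fibCoact g) (Datum.stabHom l) y =
      (D.xi g l l⁻¹)⁻¹ • applyAt (S.fibAct g) (Datum.stabHom l⁻¹) y := by
  suffices applyAt (S.fibCoact g) (Datum.stabHom l) =
      (D.xi g l l⁻¹)⁻¹ • applyAt (S.fibAct g) (Datum.stabHom l⁻¹) from DFunLike.congr_fun this y
  refine ext_one_tmul fun v => ?_
  rw [applyAt_one_tmul]
  refine (bc_units_smul _ _ _).trans ?_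
  rw [map_inv, Datum.xi_map, bc_applyAt, ← Datum.stabHom_stabMap, Datum.stabMap_inv,
    Datum.stabMap_stabGen, TensorProduct.mk_apply, bc_tmul, map_one]
  rfl

/-- With A_l the action just constructed, A_l A_{l⁻¹} = ξ(l, l⁻¹); the coaction is normalized so
that T_l = A_l⁻¹. Inversion reverses the order and inverts the cocycle, as Rep(L^g, ξ_g⁻¹) requires.
-/
theorem applyAt_fibAct_fibCoact (l : D.stab g R) (y : R ⊗[k] S.Fib g) :
    applyAt (S.fibAct g) (Datum.stabHom l) (applyAt (S.fibCoact g) (Datum.stabHom l) y) = y := by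
  rw [applyAt_fibCoact, Units.smul_def, map_smul, applyAt_fibAct_applyAt, ← Units.smul_def,
    mul_inv_cancel, inv_smul_smul, applyAt_fibAct_one]

/-- The fibre at `g` as a representation of the stabilizer. -/
def fibRep (S : BiSheaf D) (g : Pt k OG k) : ProjRep D g where
  carrier := S.Fib g
  coact := S.fibCoact g
  coact_one R _ _ := LinearMap.ext fun y =>
    S.applyAt_fibAct_injective 1 ((S.applyAt_fibAct_fibCoact 1 y).trans (S.applyAt_fibAct_one y).symm)
  coact_mul R _ _ l m := LinearMap.ext fun y => by
    -- Cancelling T_m and then T_l reduces the claim to the multiplicativity of their inverses.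
    apply S.applyAt_fibAct_injective m
    refine (S.applyAt_fibAct_fibCoact m _).trans ?_
    apply S.applyAt_fibAct_injective l
    refine (S.applyAt_fibAct_fibCoact l _).trans ?_
    rw [applyAt_fibAct_applyAt, LinearMap.smul_apply, map_smul, ← Units.smul_def, smul_inv_smul]
    exact (S.applyAt_fibAct_fibCoact (l * m) y).symm

/-- The rule A_l F(h, c) = Θ F(lh, l'c) for F = `frob` s is the invariance condition once A_l is
inverted. -/
theorem fn_frob_mem_inducedSet (s : S.carrier) :
    Coind.fn (frob g S (S.fibπ g) s) ∈ (S.fibRep g).inducedSet := by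
  intro R _ _ l h c
  apply S.applyAt_fibAct_injective l
  refine (S.applyAt_fibAct_fibCoact l _).trans ?_
  have := S.applyAt_fibAct_val l h c (1 ⊗ₜ s)
  rw [LinearMap.baseChange_tmul, Coind.val_one_tmul, Coind.val_one_tmul] at this
  refine Eq.trans ?_ (map_smul (applyAt (S.fibAct g) (Datum.stabHom l)) _ _).symm
  refine Eq.trans ?_ (congrArg _ this).symm
  rw [← Units.smul_def, inv_smul_smul]
  rfl

variable [IsAlgClosed k] [FiniteDimensional k OG]

/-- The kernel of evaluation at the unit is contained in m_g Ind, so the fibre of the induced sheaf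
is V and the general dimension formula applies. -/
theorem finrank_ind (V : ProjRep D g) : Module.finrank k V.ind.carrier =
    Module.finrank k V.carrier * Module.finrank k (OG ⧸ D.orbitIdeal g) := by
  rw [(frob_injective_and_finrank V.ind_killedBy).2]
  congr 1
  refine LinearEquiv.finrank_eq (LinearEquiv.ofBijective (fibLift V.indEv_atPoint) ⟨?_,
    fibLift_surjective _ V.indEv_surjective⟩)
  rw [injective_iff_map_eq_zero]
  intro y hy
  obtain ⟨F, rfl⟩ := V.ind.fibπ_surjective g y
  rw [fibLift_fibπ] at hy
  exact (V.ind.fibπ_eq_zero g F).2 (V.mem_smul_top_of_indEv_eq_zero hy)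

/-- The Frobenius embedding of S lands in the sheaf induced from its fibre, and both have dimension
dim S_g · dim O(Z). -/
theorem exists_iso_ind (hS : KilledBy (D.orbitIdeal g) S) : Nonempty ((S.fibRep g).ind ≅ S) := by
  obtain ⟨χ, hχ⟩ := exists_lift (S.fibRep g).indι (S.fibRep g).indι_injective
    (frobHom (S.fibπ g) (S.fibπ_atPoint g)) fun s =>
      ((S.fibRep g).mem_range_indι _).2 (S.fn_frob_mem_inducedSet s)
  have hinj : Function.Injective (Hom.lin χ) := by
    intro s t h
    apply (frob_injective_and_finrank hS).1
    refine (hχ s).symm.trans (Eq.trans ?_ (hχ t))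
    rw [h]
  have hdim : Module.finrank k S.carrier = Module.finrank k (S.fibRep g).ind.carrier := by
    rw [finrank_ind, (frob_injective_and_finrank hS).2]
    rfl
  have := isIso_of_bijective χ
    ⟨hinj, (LinearMap.injective_iff_surjective_of_finrank_eq_finrank hdim).1 hinj⟩
  exact ⟨(asIso χ).symm⟩

end BiSheaf

/-- Induction to the sheaves supported on a double coset. -/
def indOn (Z : D.DoubleCoset) (g : Pt k OG k) (hg : Z.IsRep g) [IsAlgClosed k] :
    ProjRep D g ⥤ (D.supportedOn Z).FullSubcategory :=
  (D.supportedOn Z).lift (indFunctor D g) fun V => by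
    have h := V.ind_killedBy
    rw [← Datum.DoubleCoset.ideal_eq hg] at h
    exact h

variable [IsAlgClosed k] {Z : D.DoubleCoset} (hg : Z.IsRep g)

theorem isInduction_indOn : IsInduction g (indOn Z g hg ⋙ (D.supportedOn Z).ι) :=
  isInduction_indFunctor D g

variable [FiniteDimensional k OG]

instance : (indOn Z g hg).Additive where
  map_add := (D.supportedOn Z).ι.map_injective (indFunctor D g).map_add

instance : (indOn Z g hg).Linear k where
  map_smul φ a := (D.supportedOn Z).ι.map_injective ((indFunctor D g).map_smul a φ)

instance : (indOn Z g hg).Faithful :=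
  Functor.Faithful.of_comp_iso ((D.supportedOn Z).liftCompιIso (indFunctor D g) _)

instance : (indOn Z g hg).Full :=
  Functor.Full.of_comp_faithful_iso ((D.supportedOn Z).liftCompιIso (indFunctor D g) _)

instance : (indOn Z g hg).EssSurj where
  mem_essImage S := by
    have hS : BiSheaf.KilledBy (D.orbitIdeal g) S.obj := by
      rw [← Datum.DoubleCoset.ideal_eq hg]
      exact S.property
    obtain ⟨e⟩ := S.obj.exists_iso_ind hS
    exact ⟨S.obj.fibRep g, ⟨(D.supportedOn Z).isoMk e⟩⟩

instance : (indOn Z g hg).IsEquivalence where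

end Fibre


/-! ### Simple objects -/

section SimpleObjects

variable {k OG OH OK : Type u} [Field k] [CommRing OG] [HopfAlgebra k OG]
  [CommRing OH] [HopfAlgebra k OH] [CommRing OK] [HopfAlgebra k OK]
  {D : Datum k OG OH OK}

namespace Datum.DoubleCoset

theorem exists_isRep (Z : D.DoubleCoset) : ∃ g, Z.IsRep g := by
  obtain ⟨_, g, rfl⟩ := Z
  refine ⟨g, ?_⟩
  have h := orbitIdeal_le_ker (D := D) g 1 1
  rwa [orbitPt_one_one, Pt.const_self] at h

/-- The double coset of a point. -/
def of (D : Datum k OG OH OK) (g : Pt k OG k) : D.DoubleCoset := ⟨D.orbitIdeal g, g, rfl⟩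

theorem isRep_of (g : Pt k OG k) : (of D g).IsRep g := by
  have h := orbitIdeal_le_ker (D := D) g 1 1
  rwa [orbitPt_one_one, Pt.const_self] at h

variable [IsAlgClosed k] [FiniteDimensional k OH] [FiniteDimensional k OK]

theorem eq_of_isRep {Z Z' : D.DoubleCoset} {g : Pt k OG k} (h : Z.IsRep g) (h' : Z'.IsRep g) :
    Z = Z' :=
  Subtype.ext ((ideal_eq h).trans (ideal_eq h').symm)

theorem IsRep.orbitPt {Z : D.DoubleCoset} {g : Pt k OG k} (hg : Z.IsRep g) (h : Pt k OH k) (c : Pt k OK k) :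
    Z.IsRep (D.orbitPt g h c) := by
  rw [IsRep, ideal_eq hg]
  exact orbitIdeal_le_ker g h c

theorem isRep_orbitPt {Z : D.DoubleCoset} {g : Pt k OG k} (h : Pt k OH k) (c : Pt k OK k) :
    Z.IsRep (D.orbitPt g h c) ↔ Z.IsRep g := by
  refine ⟨fun hz => ?_, fun hg => hg.orbitPt h c⟩
  have h1 := hz.orbitPt h⁻¹ c⁻¹
  rwa [orbitPt_orbitPt, Pt.const_self, Pt.const_self, mul_inv_cancel, mul_inv_cancel,
    orbitPt_one_one, Pt.const_self] at h1

end Datum.DoubleCoset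

namespace BiSheaf

variable {S T : BiSheaf D}

theorem nontrivial_of_simple [Simple S] : Nontrivial S.carrier := by
  by_contra h
  rw [not_nontrivial_iff_subsingleton] at h
  exact id_nonzero S (Hom.ext_lin fun s => Subsingleton.elim _ _)

theorem injective_of_simple [Simple S] (φ : S ⟶ T) (hφ : φ ≠ 0) :
    Function.Injective (Hom.lin φ) := by
  have hm : Mono (kerι φ) := (mono_iff_injective _).2 (kerι_injective φ)
  have h0 : kerι φ = 0 := by
    by_contra h
    have := (Simple.mono_isIso_iff_nonzero (kerι φ)).2 h
    refine hφ (Hom.ext_lin fun s => ?_)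
    obtain ⟨t, rfl⟩ := (bijective_of_isIso (kerι φ)).2 s
    exact (exact_kerι φ _).2 ⟨t, rfl⟩
  rw [injective_iff_map_eq_zero]
  intro s hs
  obtain ⟨t, rfl⟩ := (exact_kerι φ s).1 hs
  rw [h0]
  rfl

/-- Descent on the dimension: a sheaf that is not simple has a nonzero subobject of smaller
dimension. -/
theorem exists_simple_subobject (S : BiSheaf D) [Nontrivial S.carrier] :
    ∃ (T : BiSheaf D) (i : T ⟶ S), Simple T ∧ Mono i := by
  induction hn : Module.finrank k S.carrier using Nat.strong_induction_on generalizing S with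
  | _ n ih =>
    by_cases hS : Simple S
    · exact ⟨S, 𝟙 S, hS, inferInstance⟩
    obtain ⟨Y, f, hf, h⟩ : ∃ (Y : BiSheaf D) (f : Y ⟶ S), Mono f ∧ ¬ (IsIso f ↔ f ≠ 0) := by
      by_contra! h
      exact hS ⟨fun {Y} f hf => h Y f hf⟩
    have h0 : f ≠ 0 := by
      rintro rfl
      refine h ⟨fun hi => ?_, fun h => (h rfl).elim⟩
      obtain ⟨s, hs⟩ := exists_ne (0 : S.carrier)
      obtain ⟨y, hy⟩ := (bijective_of_isIso (0 : Y ⟶ S)).2 s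
      exact (hs hy.symm).elim
    have hni : ¬ IsIso f := fun hi => h ⟨fun _ => h0, fun _ => hi⟩
    have hinj := (mono_iff_injective f).1 hf
    have hlt : Module.finrank k Y.carrier < n := by
      rw [← hn]
      refine lt_of_le_of_ne (LinearMap.finrank_le_finrank_of_injective hinj) fun he => ?_
      exact hni (isIso_of_bijective f
        ⟨hinj, (LinearMap.injective_iff_surjective_of_finrank_eq_finrank he).1 hinj⟩)
    have : Nontrivial Y.carrier := by
      by_contra hY
      rw [not_nontrivial_iff_subsingleton] at hY
      refine h0 (Hom.ext_lin fun y => ?_)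
      rw [Subsingleton.elim y 0, map_zero, map_zero]
    obtain ⟨T, i, hT, hi⟩ := ih _ hlt Y rfl
    exact ⟨T, i ≫ f, hT, mono_comp i f⟩

theorem lin_sum {ι : Type*} (s : Finset ι) (φ : ι → (S ⟶ T)) (x : S.carrier) :
    Hom.lin (∑ i ∈ s, φ i) x = ∑ i ∈ s, Hom.lin (φ i) x := by
  classical
  induction s using Finset.induction_on with
  | empty => rfl
  | insert i s hi ih =>
    rw [Finset.sum_insert hi, Finset.sum_insert hi, ← ih]
    rfl

theorem smul_eq_self_of_injective {a : OG} (i : S ⟶ T) (hi : Function.Injective (Hom.lin i))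
    (hT : ∀ t : T.carrier, a • t = t) (s : S.carrier) : a • s = s :=
  hi (by rw [(Hom.lin_mem i).1, hT])

theorem smul_eq_self_of_surjective {a : OG} (q : S ⟶ T) (hq : Function.Surjective (Hom.lin q))
    (hS : ∀ s : S.carrier, a • s = s) (t : T.carrier) : a • t = t := by
  obtain ⟨s, rfl⟩ := hq t
  rw [← (Hom.lin_mem q).1, hS]

/-- By Nakayama, a sheaf all of whose fibres at k-points vanish is zero. -/
theorem exists_fibπ_ne_zero [IsAlgClosed k] [FiniteDimensional k OG] (S : BiSheaf D)
    [Nontrivial S.carrier] : ∃ z, S.fibπ z ≠ 0 := by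
  by_contra! h
  have : Module.Finite OG S.carrier := Module.Finite.of_restrictScalars_finite k OG S.carrier
  refine bot_ne_top (α := Submodule OG S.carrier) (eq_top_of_sup_smul_top _ fun m hm => ?_)
  obtain ⟨p, rfl⟩ := exists_algHom_ker_eq (k := k) m
  rw [bot_sup_eq, eq_top_iff]
  intro s _
  exact (S.fibπ_eq_zero (Pt.mk p) s).1 (DFunLike.congr_fun (h (Pt.mk p)) s)

variable [IsAlgClosed k] [FiniteDimensional k OG] [FiniteDimensional k OH] [FiniteDimensional k OK]

/-- A nonzero fibre at `z` gives a nonzero morphism to a coinduced sheaf. It is injective by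
simplicity, and its target is killed by the ideal of HzK. -/
theorem exists_supportedOn_of_simple (S : BiSheaf D) [Simple S] : ∃ Z, D.supportedOn Z S := by
  have := nontrivial_of_simple (S := S)
  obtain ⟨z, hz⟩ := S.exists_fibπ_ne_zero
  let φ : S ⟶ Coind D z (S.Fib z) := frobHom (S.fibπ z) (S.fibπ_atPoint z)
  have hφ : φ ≠ 0 := by
    intro h
    refine hz (LinearMap.ext fun s => ?_)
    rw [← Coind.evOne_frob (D := D) (g := z) (S.fibπ z) s]
    change Coind.evOne D z _ (Hom.lin φ s) = _
    rw [h]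
    exact map_zero (Coind.evOne D z (S.Fib z))
  exact ⟨Datum.DoubleCoset.of D z,
    (Coind.killedBy (S.Fib z)).of_injective φ (injective_of_simple φ hφ)⟩

/-- A point with nonzero fibre lies on every double coset that supports the sheaf, and a point lies
on only one. -/
theorem eq_of_supportedOn [Nontrivial S.carrier] {Z Z' : D.DoubleCoset}
    (h : D.supportedOn Z S) (h' : D.supportedOn Z' S) : Z = Z' := by
  obtain ⟨z, hz⟩ := S.exists_fibπ_ne_zero
  have key : ∀ Z : D.DoubleCoset, D.supportedOn Z S → Z.IsRep z := by
    intro Z hZ f hf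
    by_contra hne
    refine hz (LinearMap.ext fun s => ?_)
    have := S.fibπ_atPoint z f s
    rw [hZ f hf, map_zero, eq_comm, smul_eq_zero] at this
    exact this.resolve_left hne
  exact Datum.DoubleCoset.eq_of_isRep (key Z h) (key Z' h')

end BiSheaf

variable [IsAlgClosed k] [FiniteDimensional k OG] [FiniteDimensional k OH] [FiniteDimensional k OK]
  {g : Pt k OG k}

namespace ProjRep

variable (V : ProjRep D g)

/-- A sheaf killed by the ideal of Z is induced, so by fullness its morphisms to an induced sheaf
come from representations. Hence subobjects can be compared, though the induction functor here takes
values in all sheaves. -/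
theorem exists_indFunctor_map_eq {X : BiSheaf D} (hX : BiSheaf.KilledBy (D.orbitIdeal g) X)
    (f : X ⟶ V.ind) : ∃ (U : ProjRep D g) (e : U.ind ≅ X) (φ : U ⟶ V),
      (indFunctor D g).map φ = e.hom ≫ f := by
  obtain ⟨e⟩ := X.exists_iso_ind hX
  obtain ⟨φ, hφ⟩ := indMap_surjective (e.hom ≫ f)
  exact ⟨_, e, φ, hφ⟩

theorem simple_ind [Simple V] : Simple V.ind := by
  refine ⟨fun {X} f hf => ?_⟩
  obtain ⟨U, e, φ, h⟩ := V.exists_indFunctor_map_eq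
    (V.ind_killedBy.of_injective f ((BiSheaf.mono_iff_injective f).1 hf)) f
  have hm : Mono ((indFunctor D g).map φ) := by
    rw [h]
    exact mono_comp e.hom f
  have hφ : Mono φ := (indFunctor D g).mono_of_mono_map hm
  have h1 : IsIso f ↔ IsIso φ := by
    rw [← isIso_iff_of_reflects_iso φ (indFunctor D g), h]
    exact (isIso_comp_left_iff e.hom f).symm
  have h2 : f = 0 ↔ φ = 0 := by
    rw [← (indFunctor D g).map_eq_zero_iff, h]
    refine ⟨fun h => ?_, fun h => ?_⟩
    · rw [h]
      exact Limits.comp_zero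
    · rw [← cancel_epi e.hom, Limits.comp_zero]
      exact h
  rw [h1, Simple.mono_isIso_iff_nonzero φ, ne_eq, ne_eq, h2]

theorem simple_of_simple_ind [Simple V.ind] : Simple V := by
  refine ⟨fun {W} φ hφ => ?_⟩
  -- Induction preserves this monomorphism: the kernel of its image is killed by the ideal of Z, so
  -- its inclusion comes from a morphism of representations that `φ` kills.
  have hm : Mono ((indFunctor D g).map φ) := by
    let Φ : W.ind ⟶ V.ind := (indFunctor D g).map φ
    obtain ⟨U, e, χ, h⟩ := W.exists_indFunctor_map_eq
      (W.ind_killedBy.of_injective (BiSheaf.kerι Φ) (BiSheaf.kerι_injective Φ)) (BiSheaf.kerι Φ)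
    have h0 : BiSheaf.kerι Φ ≫ Φ = 0 :=
      BiSheaf.Hom.ext_lin fun s => (BiSheaf.exact_kerι Φ _).2 ⟨s, rfl⟩
    have h1 : χ ≫ φ = 0 := by
      apply (indFunctor D g).map_injective
      rw [Functor.map_comp, Functor.map_zero, h]
      exact (Category.assoc _ _ _).trans ((congrArg (e.hom ≫ ·) h0).trans Limits.comp_zero)
    have h2 : χ = 0 := by rwa [← cancel_mono φ, Limits.zero_comp]
    have h3 : BiSheaf.kerι Φ = 0 := by
      rw [h2, Functor.map_zero] at h
      rw [← cancel_epi e.hom, Limits.comp_zero]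
      exact h.symm
    refine (BiSheaf.mono_iff_injective Φ).2 ((injective_iff_map_eq_zero _).2 fun s hs => ?_)
    obtain ⟨t, rfl⟩ := (BiSheaf.exact_kerι Φ s).1 hs
    rw [h3]
    rfl
  have h : Simple ((indFunctor D g).obj V) := inferInstanceAs (Simple V.ind)
  rw [← isIso_iff_of_reflects_iso φ (indFunctor D g), Simple.mono_isIso_iff_nonzero, ne_eq, ne_eq,
    (indFunctor D g).map_eq_zero_iff]

end ProjRep

/-- The isomorphism class of a simple sheaf induced from a simple representation. -/
def indClass (D : Datum k OG OH OK) (g : Pt k OG k) :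
    SimpleClass (ProjRep D g) → SimpleClass (BiSheaf D) :=
  Quotient.map' (fun V => ⟨V.obj.ind, have := V.property; V.obj.simple_ind⟩) fun _ _ ⟨e⟩ =>
    ⟨ObjectProperty.isoMk _ ((indFunctor D g).mapIso ((ObjectProperty.ι _).mapIso e))⟩

/-- For injectivity, the support of the simple sheaf recovers Z and full faithfulness recovers V;
for surjectivity, a simple sheaf is supported on some Z and is induced from its fibre. -/
theorem bijective_indClass (rep : D.DoubleCoset → Pt k OG k)
    (hrep : ∀ Z : D.DoubleCoset, Z.IsRep (rep Z)) :
    Function.Bijective fun x : Σ Z : D.DoubleCoset, SimpleClass (ProjRep D (rep Z)) =>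
      indClass D (rep x.1) x.2 := by
  have hs : ∀ (Z : D.DoubleCoset) (V : ProjRep D (rep Z)), D.supportedOn Z V.ind := by
    intro Z V
    have h := V.ind_killedBy
    rwa [← Datum.DoubleCoset.ideal_eq (hrep Z)] at h
  constructor
  · rintro ⟨Z, x⟩ ⟨Z', x'⟩ h
    induction x using Quotient.inductionOn' with | _ V
    induction x' using Quotient.inductionOn' with | _ V'
    obtain ⟨e⟩ := Quotient.exact h
    let e' : V.obj.ind ≅ V'.obj.ind := (ObjectProperty.ι _).mapIso e
    have := V.property
    have := V.obj.simple_ind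
    have := BiSheaf.nontrivial_of_simple (S := V.obj.ind)
    have hV' : BiSheaf.KilledBy Z'.ideal V.obj.ind :=
      BiSheaf.KilledBy.of_injective (hs Z' V'.obj) e'.hom (BiSheaf.bijective_of_isIso e'.hom).1
    obtain rfl := BiSheaf.eq_of_supportedOn (hs Z V.obj) hV'
    refine congrArg (Sigma.mk Z) (Quotient.sound' ⟨ObjectProperty.isoMk _ ?_⟩)
    exact (indFunctor D (rep Z)).preimageIso e'
  · intro y
    induction y using Quotient.inductionOn' with | _ T
    have := T.property
    obtain ⟨Z, hZ⟩ := T.obj.exists_supportedOn_of_simple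
    have hT : BiSheaf.KilledBy (D.orbitIdeal (rep Z)) T.obj := by
      rw [← Datum.DoubleCoset.ideal_eq (hrep Z)]
      exact hZ
    obtain ⟨e⟩ := T.obj.exists_iso_ind hT
    have := Simple.of_iso e
    have := (T.obj.fibRep (rep Z)).simple_of_simple_ind
    exact ⟨⟨Z, SimpleClass.mk (T.obj.fibRep (rep Z)) this⟩,
      Quotient.sound' ⟨ObjectProperty.isoMk _ e⟩⟩

end SimpleObjects


/-! ### The decomposition by double cosets -/

section Decomposition

variable {k OG OH OK : Type u} [Field k] [CommRing OG] [HopfAlgebra k OG]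
  [CommRing OH] [HopfAlgebra k OH] [CommRing OK] [HopfAlgebra k OK]
  {D : Datum k OG OH OK} [FiniteDimensional k OG]

/-- In a finite dimensional algebra there is an idempotent with given zeros, for the points of a
closed subscheme. -/
theorem exists_idempotent_of_ideal (I : Ideal OG) : ∃ e : OG, IsIdempotentElem e ∧
    ∀ z : OG →ₐ[k] k, (I ≤ RingHom.ker z → z e = 1) ∧ (¬ I ≤ RingHom.ker z → z e = 0) := by
  have : IsArtinianRing OG := isArtinian_of_tower k inferInstance
  -- The spectrum of an Artinian ring is discrete, so every closed subset is cut out by an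
  -- idempotent.
  obtain ⟨e, he, h⟩ := PrimeSpectrum.exists_idempotent_basicOpen_eq_of_isClopen
    (isClopen_discrete (PrimeSpectrum.zeroLocus (I : Set OG)))
  refine ⟨e, he, fun z => ?_⟩
  have hz : I ≤ RingHom.ker z ↔ z e ≠ 0 :=
    Set.ext_iff.1 h ⟨RingHom.ker z, (ker_isMaximal z).isPrime⟩
  have h01 : z e = 0 ∨ z e = 1 := IsIdempotentElem.iff_eq_zero_or_one.1 (he.map z)
  exact ⟨fun h => h01.resolve_left (hz.1 h), fun h => not_not.1 fun h' => h (hz.2 h')⟩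

namespace Datum.DoubleCoset

/-- The idempotent function with value one on a double coset and zero on the others. -/
def idem (Z : D.DoubleCoset) : OG := (exists_idempotent_of_ideal (k := k) Z.ideal).choose

variable (Z : D.DoubleCoset) {Z' : D.DoubleCoset}

theorem isIdempotentElem_idem : IsIdempotentElem Z.idem :=
  (exists_idempotent_of_ideal (k := k) Z.ideal).choose_spec.1

variable {Z}

theorem hom_idem_of_isRep {z : Pt k OG k} (h : Z.IsRep z) : z.hom Z.idem = 1 :=
  ((exists_idempotent_of_ideal (k := k) Z.ideal).choose_spec.2 z.hom).1 h

theorem hom_idem_of_not_isRep {z : Pt k OG k} (h : ¬ Z.IsRep z) : z.hom Z.idem = 0 :=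
  ((exists_idempotent_of_ideal (k := k) Z.ideal).choose_spec.2 z.hom).2 h

theorem hom_idem_congr {z z' : Pt k OG k} (h : Z.IsRep z ↔ Z.IsRep z') :
    z.hom Z.idem = z'.hom Z.idem := by
  by_cases hz : Z.IsRep z
  · rw [hom_idem_of_isRep hz, hom_idem_of_isRep (h.1 hz)]
  · rw [hom_idem_of_not_isRep hz, hom_idem_of_not_isRep fun h' => hz (h.2 h')]

variable [IsAlgClosed k] [FiniteDimensional k OH] [FiniteDimensional k OK]

/-- Pulled back to H × K, the idempotent has value 1 at every k-point and is therefore 1; this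
handles the nilpotents of O(Z). -/
theorem one_sub_idem_mem : 1 - Z.idem ∈ Z.ideal := by
  obtain ⟨g, hg⟩ := Z.exists_isRep
  rw [ideal_eq hg, orbitIdeal, RingHom.mem_ker, map_sub, map_one, sub_eq_zero]
  refine eq_of_isIdempotentElem_of_points (k := k) (one_mul 1)
    (Z.isIdempotentElem_idem.map (D.orbitMap g)) fun p => ?_
  obtain ⟨h, c, rfl⟩ := exists_eq_pt p
  rw [map_one, pt_orbitMap, hom_idem_of_isRep (hg.orbitPt h c)]

theorem idem_mem_of_ne (hne : Z ≠ Z') : Z.idem ∈ Z'.ideal := by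
  obtain ⟨g, hg⟩ := Z'.exists_isRep
  rw [ideal_eq hg, orbitIdeal, RingHom.mem_ker]
  refine eq_of_isIdempotentElem_of_points (k := k) (Z.isIdempotentElem_idem.map (D.orbitMap g))
    (mul_zero 0) fun p => ?_
  obtain ⟨h, c, rfl⟩ := exists_eq_pt p
  rw [map_zero, pt_orbitMap,
    hom_idem_of_not_isRep fun h' => hne (eq_of_isRep h' (hg.orbitPt h c))]

theorem idem_mul_idem_of_ne (hne : Z ≠ Z') : Z.idem * Z'.idem = 0 := by
  have hi : IsIdempotentElem (Z.idem * Z'.idem) :=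
    Z.isIdempotentElem_idem.mul Z'.isIdempotentElem_idem
  refine eq_of_isIdempotentElem_of_points (k := k) hi (mul_zero 0) fun p => ?_
  rw [map_mul, map_zero]
  change (Pt.mk p).hom _ * (Pt.mk p).hom _ = 0
  by_cases h : Z.IsRep (Pt.mk p)
  · rw [hom_idem_of_not_isRep (Z := Z') fun h' => hne (eq_of_isRep h h'), mul_zero]
  · rw [hom_idem_of_not_isRep h, zero_mul]

instance : Finite D.DoubleCoset := by
  have : IsArtinianRing OG := isArtinian_of_tower k inferInstance
  -- Different double cosets have different representatives, and there are finitely many k-points.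
  refine Finite.of_injective (β := MaximalSpectrum OG)
    (fun Z => ⟨_, ker_isMaximal Z.exists_isRep.choose.hom⟩) fun Z Z' h => ?_
  have h1 : RingHom.ker Z.exists_isRep.choose.hom = RingHom.ker Z'.exists_isRep.choose.hom :=
    congrArg MaximalSpectrum.asIdeal h
  refine eq_of_isRep Z.exists_isRep.choose_spec ?_
  rw [IsRep, h1]
  exact Z'.exists_isRep.choose_spec

theorem sum_idem [Fintype D.DoubleCoset] : ∑ Z : D.DoubleCoset, Z.idem = 1 := by
  have ho : OrthogonalIdempotents (fun Z : D.DoubleCoset => Z.idem) :=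
    ⟨fun Z => Z.isIdempotentElem_idem, fun _ _ h => idem_mul_idem_of_ne h⟩
  refine eq_of_isIdempotentElem_of_points (k := k) ho.isIdempotentElem_sum (one_mul 1) fun p => ?_
  rw [map_sum, map_one]
  change ∑ Z : D.DoubleCoset, (Pt.mk p).hom Z.idem = 1
  have h := isRep_of (D := D) (Pt.mk p)
  rw [Fintype.sum_eq_single (of D (Pt.mk p)) fun Z hne =>
    hom_idem_of_not_isRep fun h' => hne (eq_of_isRep h' h), hom_idem_of_isRep h]

/-- The idempotent of a double coset is invariant under left translation by `H`. -/
theorem hom_idem_left {R : Type u} [CommRing R] [Algebra k R] (b : Pt k OH R) :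
    (D.inH (up OG b) * gen R).hom Z.idem = 1 ⊗ₜ Z.idem := by
  -- The universal case, where both sides are idempotents of O(H) ⊗ O(G). At a k-point (h, x) they
  -- compare e_Z at hx and at x, which lie in the same double coset.
  have key : (D.inH (up OG (Pt.mk (AlgHom.id k OH))) * gen OH).hom Z.idem =
      (Algebra.TensorProduct.includeRight : OG →ₐ[k] OH ⊗[k] OG) Z.idem := by
    refine eq_of_isIdempotentElem_of_points (k := k) (Z.isIdempotentElem_idem.map _)
      (Z.isIdempotentElem_idem.map _) fun p => ?_
    let h : Pt k OH k := Pt.mk (p.comp Algebra.TensorProduct.includeLeft)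
    let x : Pt k OG k := Pt.mk (p.comp Algebra.TensorProduct.includeRight)
    have e : (D.inH (up OG (Pt.mk (AlgHom.id k OH))) * gen OH).map p = D.orbitPt x h⁻¹ 1 := by
      rw [Pt.map_mul, orbitPt, map_inv, inv_inv, map_one, mul_one, Pt.const_self]
      rfl
    have h1 := hom_idem_congr (isRep_orbitPt (Z := Z) (g := x) h⁻¹ 1)
    rw [← e] at h1
    exact h1
  have h2 := congrArg (Algebra.TensorProduct.map b.hom (AlgHom.id k OG)) key
  have e : (D.inH (up OG (Pt.mk (AlgHom.id k OH))) * gen OH).map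
      (Algebra.TensorProduct.map b.hom (AlgHom.id k OG)) = D.inH (up OG b) * gen R := by
    rw [Pt.map_mul, inH_map]
    have e1 : (up OG (Pt.mk (AlgHom.id k OH))).map
        (Algebra.TensorProduct.map b.hom (AlgHom.id k OG)) = up OG b := by
      ext a
      simp [up]
    have e2 : (gen OH : Pt k OG (OH ⊗[k] OG)).map
        (Algebra.TensorProduct.map b.hom (AlgHom.id k OG)) = gen R := by
      ext a
      simp [gen]
    rw [e1, e2]
  rw [← e]
  refine h2.trans ?_
  simp

/-- The idempotent of a double coset is invariant under right translation by `K`. -/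
theorem hom_idem_right {R : Type u} [CommRing R] [Algebra k R] (c : Pt k OK R) :
    (gen R * D.inK (up OG c)).hom Z.idem = 1 ⊗ₜ Z.idem := by
  have key : (gen OK * D.inK (up OG (Pt.mk (AlgHom.id k OK)))).hom Z.idem =
      (Algebra.TensorProduct.includeRight : OG →ₐ[k] OK ⊗[k] OG) Z.idem := by
    -- At a k-point (c, x) the comparison is between e_Z at xc and at x.
    refine eq_of_isIdempotentElem_of_points (k := k) (Z.isIdempotentElem_idem.map _)
      (Z.isIdempotentElem_idem.map _) fun p => ?_
    let c : Pt k OK k := Pt.mk (p.comp Algebra.TensorProduct.includeLeft)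
    let x : Pt k OG k := Pt.mk (p.comp Algebra.TensorProduct.includeRight)
    have e : (gen OK * D.inK (up OG (Pt.mk (AlgHom.id k OK)))).map p = D.orbitPt x 1 c := by
      rw [Pt.map_mul, orbitPt, map_one, inv_one, one_mul, Pt.const_self]
      rfl
    have h1 := hom_idem_congr (isRep_orbitPt (Z := Z) (g := x) 1 c)
    rw [← e] at h1
    exact h1
  have h2 := congrArg (Algebra.TensorProduct.map c.hom (AlgHom.id k OG)) key
  have e : (gen OK * D.inK (up OG (Pt.mk (AlgHom.id k OK)))).map
      (Algebra.TensorProduct.map c.hom (AlgHom.id k OG)) = gen R * D.inK (up OG c) := by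
    rw [Pt.map_mul, inK_map]
    have e1 : (up OG (Pt.mk (AlgHom.id k OK))).map
        (Algebra.TensorProduct.map c.hom (AlgHom.id k OG)) = up OG c := by
      ext a
      simp [up]
    have e2 : (gen OK : Pt k OG (OK ⊗[k] OG)).map
        (Algebra.TensorProduct.map c.hom (AlgHom.id k OG)) = gen R := by
      ext a
      simp [gen]
    rw [e1, e2]
  rw [← e]
  refine h2.trans ?_
  simp

end Datum.DoubleCoset

namespace BiSheaf

variable [IsAlgClosed k] [FiniteDimensional k OH] [FiniteDimensional k OK] (S : BiSheaf D) {T : BiSheaf D}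
  (Z : D.DoubleCoset)

/-- The projection to the part of a sheaf over a double coset. -/
def proj : S ⟶ S :=
  Hom.ofLin (Algebra.lsmul k k S.carrier Z.idem) (by
    have h : ∀ (R : Type u) [CommRing R] [Algebra k R] (y : R ⊗[k] S.carrier),
        act R S.carrier (1 ⊗ₜ Z.idem) y =
          (Algebra.lsmul k k S.carrier Z.idem).baseChange R y := by
      intro R _ _ y
      suffices act R S.carrier (1 ⊗ₜ Z.idem) =
          (Algebra.lsmul k k S.carrier Z.idem).baseChange R from DFunLike.congr_fun this y
      refine ext_one_tmul fun s => ?_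
      rw [act_tmul, one_mul]
      rfl
    refine mem_homs_of_points (fun a s => smul_comm _ _ _) (fun R _ _ b s => ?_)
      (fun R _ _ c s => ?_)
    · refine (S.lam_smul R b Z.idem s).trans ?_
      rw [Datum.DoubleCoset.hom_idem_left]
      exact h R _
    · refine (S.rho_smul R c Z.idem s).trans ?_
      rw [Datum.DoubleCoset.hom_idem_right]
      exact h R _)

theorem proj_apply (s : S.carrier) : Hom.lin (S.proj Z) s = Z.idem • s := rfl

/-- The part of a sheaf over a double coset. -/
def part : BiSheaf D := ker (𝟙 S - S.proj Z)

/-- The inclusion of the part of a sheaf over a double coset. -/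
def partι : S.part Z ⟶ S := kerι (𝟙 S - S.proj Z)

theorem partι_injective : Function.Injective (Hom.lin (S.partι Z)) := kerι_injective _

theorem mem_range_partι (s : S.carrier) :
    s ∈ LinearMap.range (Hom.lin (S.partι Z)) ↔ Z.idem • s = s := by
  refine (exact_kerι (𝟙 S - S.proj Z) s).symm.trans ?_
  change s - Z.idem • s = 0 ↔ _
  rw [sub_eq_zero, eq_comm]

variable {S Z}

theorem idem_smul_of_supportedOn (h : D.supportedOn Z S) (s : S.carrier) : Z.idem • s = s := by
  have := h _ Datum.DoubleCoset.one_sub_idem_mem s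
  rw [sub_smul, one_smul, sub_eq_zero] at this
  exact this.symm

/-- If e_Z is not the identity, its kernel has a simple subobject, on which e_Z is both zero and, by
support on Z, the identity. Conversely e_Z is the identity on every composition factor, and it kills
the simple sheaves supported on other double cosets. -/
theorem serreClosure_supportedOn_iff :
    serreClosure (D.supportedOn Z) S ↔ ∀ s : S.carrier, Z.idem • s = s := by
  constructor
  · intro hS s
    by_contra hs
    let W := ker (S.proj Z)
    have hW : Nontrivial W.carrier := by
      have h0 : Hom.lin (S.proj Z) (s - Z.idem • s) = 0 := by
        rw [proj_apply, smul_sub, ← mul_smul, Z.isIdempotentElem_idem.eq, sub_self]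
      obtain ⟨w, hw⟩ := (exact_kerι (S.proj Z) _).1 h0
      refine ⟨w, 0, ?_⟩
      rintro rfl
      rw [map_zero, eq_comm, sub_eq_zero] at hw
      exact hs hw.symm
    obtain ⟨T, i, hT, hi⟩ := W.exists_simple_subobject
    have hm : Mono (i ≫ kerι (S.proj Z)) := by
      have := (mono_iff_injective _).2 (kerι_injective (S.proj Z))
      exact mono_comp i _
    have hTZ := hS T ⟨hT, T, i ≫ kerι (S.proj Z), 𝟙 T, hm, inferInstance⟩
    have := nontrivial_of_simple (S := T)
    obtain ⟨t, ht⟩ := exists_ne (0 : T.carrier)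
    refine ht ((mono_iff_injective _).1 hm ?_)
    have h1 : Hom.lin (S.proj Z) (Hom.lin (i ≫ kerι (S.proj Z)) t) = 0 :=
      (exact_kerι (S.proj Z) _).2 ⟨Hom.lin i t, rfl⟩
    rw [proj_apply, ← (Hom.lin_mem (i ≫ kerι (S.proj Z))).1, idem_smul_of_supportedOn hTZ] at h1
    rw [h1, map_zero]
  · rintro hS T ⟨hT, W, i, q, hi, hq⟩
    have hTe := smul_eq_self_of_surjective q ((epi_iff_surjective q).1 hq)
      (smul_eq_self_of_injective i ((mono_iff_injective i).1 hi) hS)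
    obtain ⟨Z', hZ'⟩ := T.exists_supportedOn_of_simple
    obtain rfl | hne := eq_or_ne Z Z'
    · exact hZ'
    have := nontrivial_of_simple (S := T)
    obtain ⟨t, ht⟩ := exists_ne (0 : T.carrier)
    refine (ht ?_).elim
    rw [← hTe t]
    exact hZ' _ (Datum.DoubleCoset.idem_mem_of_ne hne) t

variable (S)

theorem exists_partπ (Z : D.DoubleCoset) : ∃ χ : S ⟶ S.part Z, ∀ s,
    Hom.lin (S.partι Z) (Hom.lin χ s) = Hom.lin (S.proj Z) s :=
  exists_lift (S.partι Z) (S.partι_injective Z) (S.proj Z) fun s => by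
    rw [mem_range_partι, proj_apply, ← mul_smul, Z.isIdempotentElem_idem.eq]

/-- The projection to the part of a sheaf over a double coset. -/
def partπ (Z : D.DoubleCoset) : S ⟶ S.part Z := (S.exists_partπ Z).choose

theorem partι_partπ (Z : D.DoubleCoset) (s : S.carrier) :
    Hom.lin (S.partι Z) (Hom.lin (S.partπ Z) s) = Z.idem • s :=
  (S.exists_partπ Z).choose_spec s

theorem idem_smul_partι (Z : D.DoubleCoset) (s : (S.part Z).carrier) :
    Z.idem • Hom.lin (S.partι Z) s = Hom.lin (S.partι Z) s :=
  (S.mem_range_partι Z _).1 ⟨s, rfl⟩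

open Classical in
/-- The decomposition of a sheaf by double cosets. -/
def bicone : Limits.Bicone fun Z : D.DoubleCoset => S.part Z where
  pt := S
  π Z := S.partπ Z
  ι Z := S.partι Z
  ι_π Z Z' := by
    split_ifs with h
    · subst h
      refine Hom.ext_lin fun s => S.partι_injective Z ?_
      exact (S.partι_partπ Z _).trans (S.idem_smul_partι Z s)
    · refine Hom.ext_lin fun s => S.partι_injective Z' ?_
      refine (S.partι_partπ Z' _).trans ?_
      refine (congrArg (Z'.idem • ·) (S.idem_smul_partι Z s).symm).trans ?_
      refine (mul_smul _ _ _).symm.trans ?_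
      rw [Datum.DoubleCoset.idem_mul_idem_of_ne (Ne.symm h), zero_smul]
      exact (map_zero _).symm

/-- The idempotents are orthogonal and sum to 1, so the projections to the parts add up to the
identity. -/
theorem nonempty_isBilimit_bicone : Nonempty S.bicone.IsBilimit := by
  have := Fintype.ofFinite D.DoubleCoset
  refine ⟨Limits.isBilimitOfTotal _ (Hom.ext_lin fun s => ?_)⟩
  rw [lin_sum]
  refine (Finset.sum_congr rfl fun Z _ => S.partι_partπ Z s).trans ?_
  refine Finset.sum_smul.symm.trans ?_
  rw [Datum.DoubleCoset.sum_idem]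
  exact one_smul OG s

end BiSheaf

theorem isDirectSum_serreClosure [IsAlgClosed k] [FiniteDimensional k OH] [FiniteDimensional k OK]
    (D : Datum k OG OH OK) :
    IsDirectSum fun Z : D.DoubleCoset => serreClosure (D.supportedOn Z) := by
  refine ⟨fun Z Z' hne X Y hX hY φ => BiSheaf.Hom.ext_lin fun x => ?_, fun S =>
    ⟨fun Z => S.part Z, fun Z => BiSheaf.serreClosure_supportedOn_iff.2 fun s => ?_, ?_⟩⟩
  · replace hX := BiSheaf.serreClosure_supportedOn_iff.1 hX
    replace hY := BiSheaf.serreClosure_supportedOn_iff.1 hY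
    rw [← hX x, (BiSheaf.Hom.lin_mem φ).1, ← hY (BiSheaf.Hom.lin φ x), ← mul_smul,
      Datum.DoubleCoset.idem_mul_idem_of_ne hne, zero_smul]
    rfl
  · exact S.partι_injective Z (by
      rw [(BiSheaf.Hom.lin_mem (S.partι Z)).1, S.idem_smul_partι])
  · obtain ⟨hb⟩ := S.nonempty_isBilimit_bicone
    have : Limits.HasBiproduct fun Z : D.DoubleCoset => S.part Z := Limits.HasBiproduct.mk ⟨_, hb⟩
    exact ⟨this, ⟨Limits.biproduct.uniqueUpToIso _ hb⟩⟩

end Decomposition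

end GroupSchemeSheaves
end

/-! ### The main theorem -/

theorem theorem4p3 {k : Type u} [Field k] [IsAlgClosed k]
    {OG OH OK : Type u} [CommRing OG] [HopfAlgebra k OG] [FiniteDimensional k OG]
    [CommRing OH] [HopfAlgebra k OH] [FiniteDimensional k OH]
    [CommRing OK] [HopfAlgebra k OK] [FiniteDimensional k OK]
    (D : Datum k OG OH OK) :
    ∃ Ind : ∀ (Z : D.DoubleCoset) (g : Pt k OG k), Z.IsRep g →
        (ProjRep D g ⥤ (D.supportedOn Z).FullSubcategory),
      (∀ (Z : D.DoubleCoset) (g : Pt k OG k) (hg : Z.IsRep g),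
        IsInduction g (Ind Z g hg ⋙ (D.supportedOn Z).ι) ∧
          (∃ _ : (Ind Z g hg).Additive, (Ind Z g hg).Linear k) ∧
            (Ind Z g hg).IsEquivalence) ∧
      (∀ (rep : D.DoubleCoset → Pt k OG k) (hrep : ∀ Z, Z.IsRep (rep Z)),
        ∃ Φ : (Σ Z : D.DoubleCoset, SimpleClass (ProjRep D (rep Z))) → SimpleClass (BiSheaf D),
          Function.Bijective Φ ∧
            ∀ (Z : D.DoubleCoset) (V : ProjRep D (rep Z)) (hV : Simple V),
              ∃ hS : Simple ((Ind Z (rep Z) (hrep Z)).obj V).obj,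
                Φ ⟨Z, SimpleClass.mk V hV⟩ = SimpleClass.mk _ hS) ∧
      IsDirectSum fun Z : D.DoubleCoset => serreClosure (D.supportedOn Z) := by
  -- The map on simple classes is defined through the induced sheaf, so its agreement with the
  -- functor holds by definition.
  refine ⟨fun Z g hg => indOn Z g hg, fun Z g hg => ⟨isInduction_indOn hg,
    ⟨inferInstance, inferInstance⟩, inferInstance⟩, fun rep hrep =>
    ⟨fun x => indClass D (rep x.1) x.2, bijective_indClass rep hrep, fun Z V hV =>
      ⟨V.simple_ind, rfl⟩⟩, isDirectSum_serreClosure D⟩
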